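/- **Proposition.** Let $q=2^f$ and $V=\mathbb F_q^{2m}$, and let $\mathrm{Sp}_{2m}(q)$ be the isometry group of the standard alternating form $\varphi(u,v)=\sum_{i=1}^m(u_iv_{m+i}+u_{m+i}v_i)$ on $V$. Every quadratic form on $V$ polarising to $\varphi$ can be written uniquely as $\theta_a(u)=\theta_0(u)+\varphi(u,a)^2$ with $a\in V$, where $\theta_0(u)=\sum_{i=1}^m u_iu_{m+i}$. Put $$\Omega^+=\{\theta_a : \mathrm{Tr}_{\mathbb F_q/\mathbb F_2}(\theta_0(a))=0\},\qquad \Omega^-=\{\theta_a : \mathrm{Tr}_{\mathbb F_q/\mathbb F_2}(\theta_0(a))=1\}.$$ The group $\mathrm{Sp}_{2m}(q)\rtimes\mathrm{Aut}(\mathbb F_q)$ acts on each of $\Omega^+$ and $\Omega^-$; as an $\mathrm{Sp}_{2m}(q)$-set, $\Omega^\pm$ is the set of cosets of $\mathrm O_{2m}^\pm(q)$. Let $\Omega\in\{\Omega^+,\Omega^-\}$, and let $G$ be a subgroup of the permutation group induced by $\mathrm{Sp}_{2m}(q)\rtimes\mathrm{Aut}(\mathbb F_q)$ on $\Omega$.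 Suppose that $G$ is almost simple with socle the permutation group induced by $\mathrm{Sp}_{2m}(q)'$ on $\Omega$. An irredundant base of $G$ is a finite sequence of points of $\Omega$ whose pointwise stabilizer in $G$ is trivial and in which no point is fixed by the pointwise stabilizer of its predecessors; $G$ is IBIS if all its irredundant bases have the same cardinality. Then $G$ is IBIS if and only if one of the following holds, where $\mathrm{Aut}(\mathrm{Sp}_2(q))=\mathrm{Sp}_2(q)\rtimes\mathrm{Aut}(\mathbb F_q)$ and equalities are between permutation groups on $\Omega$: 1. $m=1$, $\Omega=\Omega^-$, $f\ge 3$ and $G=\mathrm{Sp}_2(q)$; 2. $m=1$, $\Omega=\Omega^-$, $q=4$, and $G=\mathrm{Sp}_2(q)$ or $G=\mathrm{Aut}(\mathrm{Sp}_2(q))$; 3. $m=1$, $\Omega=\Omega^+$ or $\Omega=\Omega^-$, $f$ is an odd prime and $G=\mathrm{Aut}(\mathrm{Sp}_2(q))$; 4. $m=q=2$. -/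

import Mathlib

noncomputable section

namespace IBIS

/-! ### Permutation groups: irredundant bases, IBIS groups, almost simple groups -/

section PermutationGroups

variable {X : Type*}

/-- The pointwise stabilizer of `ω 0, …, ω (n - 1)` in `G` is trivial, and no `ω i` is fixed by
the pointwise stabilizer in `G` of its predecessors `ω 0, …, ω (i - 1)`. -/
def IsIrredundantBase (G : Subgroup (Equiv.Perm X)) {n : ℕ} (ω : Fin n → X) : Prop :=
  (∀ g ∈ G, (∀ i, g (ω i) = ω i) → g = 1) ∧
    ∀ i, ∃ g ∈ G, (∀ j < i, g (ω j) = ω j) ∧ g (ω i) ≠ ω i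

/-- All irredundant bases of `G` have the same cardinality. -/
def IsIBIS (G : Subgroup (Equiv.Perm X)) : Prop :=
  ∀ (n n' : ℕ) (ω : Fin n → X) (ω' : Fin n' → X),
    IsIrredundantBase G ω → IsIrredundantBase G ω' → n = n'

/-- `G` is almost simple with socle `N`: `N` is a nonabelian simple normal subgroup of `G`
with trivial centralizer in `G`, i.e. conjugation gives `N ≤ G ≤ Aut N`. -/
structure IsAlmostSimpleWithSocle (G N : Subgroup (Equiv.Perm X)) : Prop where
  le : N ≤ G
  normal : (N.subgroupOf G).Normal
  simple : IsSimpleGroup N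
  nonabelian : ∃ a ∈ N, ∃ b ∈ N, a * b ≠ b * a
  centralizer : ∀ g ∈ G, (∀ n ∈ N, g * n = n * g) → g = 1

end PermutationGroups

/-! ### Quadratic forms polarising to the standard symplectic form in characteristic two -/

section Forms

variable {m : ℕ} {F : Type*} [Field F]

/-- The space of row vectors `F ^ (2m)`; the coordinates `Sum.inl i` and `Sum.inr i` form the
`i`-th hyperbolic pair. -/
abbrev V (m : ℕ) (F : Type*) : Type _ := Fin m ⊕ Fin m → F

/-- The standard alternating form `u J vᵀ`. -/
def sform (u v : V m F) : F := u ⬝ᵥ (Matrix.J (Fin m) F).mulVec v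

/-- The quadratic form `u ↦ ∑ i, u i * u (m + i)`. -/
def theta0 (u : V m F) : F := ∑ i, u (Sum.inl i) * u (Sum.inr i)

theorem sform_eq (u v : V m F) :
    sform u v = ∑ i, (u (Sum.inr i) * v (Sum.inl i) - u (Sum.inl i) * v (Sum.inr i)) := by
  simp only [sform, Matrix.J, dotProduct, Fintype.sum_sum_type, Matrix.mulVec,
    Matrix.fromBlocks_apply₁₁, Matrix.fromBlocks_apply₁₂, Matrix.fromBlocks_apply₂₁,
    Matrix.fromBlocks_apply₂₂, Matrix.zero_apply, Matrix.neg_apply, zero_mul,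
    Finset.sum_const_zero, zero_add, add_zero, Matrix.one_apply]
  simp only [neg_mul, ite_mul, one_mul, zero_mul, Finset.sum_neg_distrib, Finset.sum_ite_eq,
    Finset.mem_univ, if_true, Finset.sum_sub_distrib, mul_neg]
  ring

theorem sform_add_left (u u' v : V m F) : sform (u + u') v = sform u v + sform u' v := by
  simp [sform, add_dotProduct]

theorem sform_smul_left (c : F) (u v : V m F) : sform (c • u) v = c * sform u v := by
  simp [sform, smul_dotProduct]

theorem sform_vecMul (x : Matrix.symplecticGroup (Fin m) F) (u v : V m F) :
    sform (Matrix.vecMul u x.1) (Matrix.vecMul v x.1) = sform u v := by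
  have hx := SymplecticGroup.mem_iff.mp x.2
  rw [sform, sform, ← Matrix.dotProduct_mulVec, ← Matrix.mulVec_transpose,
    Matrix.mulVec_mulVec, Matrix.mulVec_mulVec, hx]

variable [Algebra (ZMod 2) F]

theorem charTwo (F : Type*) [Field F] [Algebra (ZMod 2) F] : CharP F 2 :=
  charP_of_injective_algebraMap (algebraMap (ZMod 2) F).injective 2

theorem theta0_add (u v : V m F) : theta0 (u + v) = theta0 u + theta0 v + sform u v := by
  have := charTwo F
  simp only [theta0, sform_eq, ← Finset.sum_add_distrib, Pi.add_apply, CharTwo.sub_eq_add]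
  exact Finset.sum_congr rfl fun i _ => by ring

variable [Finite F]

/-- The trace of `F` over its prime field. -/
abbrev tr (x : F) : ZMod 2 := Algebra.trace (ZMod 2) F x

/-- For `t = 0` this is `Ω⁺` and for `t = 1` it is `Ω⁻`: the set of the quadratic forms `θ`
polarising to the symplectic form, `θ = θ_a : u ↦ θ₀ u + φ(u, a) ^ 2`, with `Tr (θ₀ a) = t`. -/
def Omega (m : ℕ) (F : Type*) [Field F] [Algebra (ZMod 2) F] (t : ZMod 2) : Type _ :=
  {θ : QuadraticForm F (V m F) //
    (∀ u v, QuadraticMap.polar θ u v = sform u v) ∧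
      ∃ a : V m F, tr (theta0 a) = t ∧ ∀ u, θ u = theta0 u + sform u a ^ 2}

/-- Every quadratic form polarising to the symplectic form is some `θ_a`. -/
theorem exists_eq_theta (θ : QuadraticForm F (V m F))
    (h : ∀ u v, QuadraticMap.polar θ u v = sform u v) :
    ∃ a : V m F, ∀ u, θ u = theta0 u + sform u a ^ 2 := by
  have := charTwo F
  have : Fact (Nat.Prime 2) := ⟨Nat.prime_two⟩
  have hsq : ∀ x : F, ∃ y : F, y ^ 2 = x := fun x => by
    obtain ⟨y, hy⟩ := (Finite.injective_iff_surjective.mp (frobenius_inj F 2)) x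
    exact ⟨y, by simpa [frobenius_def] using hy⟩
  choose r hr using hsq
  let l : V m F →+ F := AddMonoidHom.mk' (fun u => θ u + theta0 u) fun u v => by
    have h1 := h u v
    rw [QuadraticMap.polar, sub_sub, sub_eq_iff_eq_add] at h1
    rw [h1, theta0_add]
    linear_combination CharTwo.add_self_eq_zero (sform u v)
  have hl : ∀ (c : F) (u : V m F), l (c • u) = c ^ 2 * l u := fun c u => by
    change θ (c • u) + theta0 (c • u) = c ^ 2 * (θ u + theta0 u)
    rw [QuadraticMap.map_smul]
    simp only [theta0, Pi.smul_apply, smul_eq_mul, mul_add, Finset.mul_sum]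
    exact congrArg₂ _ (by ring) (Finset.sum_congr rfl fun i _ => by ring)
  refine ⟨Sum.elim (fun i => r (l (Pi.single (Sum.inr i) 1)))
    (fun i => r (l (Pi.single (Sum.inl i) 1))), fun u => ?_⟩
  have key : l u = ∑ j, (u j) ^ 2 * l (Pi.single j 1) := by
    conv_lhs => rw [pi_eq_sum_univ' u]
    rw [map_sum]
    refine Finset.sum_congr rfl fun j _ => ?_
    rw [← hl]
  have h2 : sform u (Sum.elim (fun i => r (l (Pi.single (Sum.inr i) 1)))
      (fun i => r (l (Pi.single (Sum.inl i) 1)))) ^ 2 = l u := by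
    rw [key, sform_eq]
    simp only [CharTwo.sub_eq_add, CharTwo.sum_sq, CharTwo.add_sq, mul_pow, Sum.elim_inl,
      Sum.elim_inr, hr, Fintype.sum_sum_type, Finset.sum_add_distrib]
    exact add_comm _ _
  rw [h2]
  change θ u = theta0 u + (θ u + theta0 u)
  linear_combination - CharTwo.add_self_eq_zero (theta0 u)

theorem tr_sq (x : F) : tr (x ^ 2) = tr x := by
  have := charTwo F
  have : Fact (Nat.Prime 2) := ⟨Nat.prime_two⟩
  let e : F ≃+* F := RingEquiv.ofBijective (frobenius F 2)
    ⟨frobenius_inj F 2, Finite.injective_iff_surjective.mp (frobenius_inj F 2)⟩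
  have he : ∀ c : ZMod 2, e (algebraMap (ZMod 2) F c) = algebraMap (ZMod 2) F c := fun c => by
    change (algebraMap (ZMod 2) F c) ^ 2 = _
    rw [← map_pow, ZMod.pow_card]
  exact Algebra.trace_eq_of_algEquiv (AlgEquiv.ofRingEquiv he) x

/-- The nontrivial sign character of `ZMod 2`. -/
def chi (x : ZMod 2) : ℤ := if x = 0 then 1 else -1

theorem chi_add (x y : ZMod 2) : chi (x + y) = chi x * chi y := by revert x y; decide

theorem chi_inj (x y : ZMod 2) : chi x = chi y → x = y := by revert x y; decide

theorem exists_tr_mul (x : F) (hx : x ≠ 0) : ∃ y : F, tr (y * x) = 1 := by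
  obtain ⟨z, hz⟩ : ∃ z : F, tr z ≠ 0 := by
    by_contra! hcon
    exact Algebra.trace_ne_zero (ZMod 2) F (LinearMap.ext hcon)
  refine ⟨z * x⁻¹, ?_⟩
  rw [mul_assoc, inv_mul_cancel₀ hx, mul_one]
  have : ∀ a : ZMod 2, a ≠ 0 → a = 1 := by decide
  exact this _ hz

/-- The character sum attached to a function on the space. -/
def charSum [Fintype F] (θ : V m F → F) : ℤ := ∑ u, chi (tr (θ u))

theorem charSum_theta [Fintype F] (a : V m F) :
    charSum (fun u => theta0 u + sform u a ^ 2) =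
      chi (tr (theta0 a)) * charSum (theta0 : V m F → F) := by
  have := charTwo F
  rw [charSum, charSum, Finset.mul_sum, ← Equiv.sum_comp (Equiv.addRight a)
    (fun u => chi (tr (theta0 a)) * chi (tr (theta0 u)))]
  refine Finset.sum_congr rfl fun u _ => ?_
  rw [← chi_add, Equiv.coe_addRight, theta0_add]
  congr 1
  have h2 : ∀ x : ZMod 2, x + x = 0 := by decide
  simp only [tr, map_add]
  have := tr_sq (sform u a)
  simp only [tr] at this
  rw [this]
  linear_combination - h2 (Algebra.trace (ZMod 2) F (theta0 a))

theorem charSum_theta0_ne_zero [Fintype F] : charSum (theta0 : V m F → F) ≠ 0 := by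
  classical
  have h1 : charSum (theta0 : V m F → F) =
      ∑ x : Fin m → F, ∑ y : Fin m → F, chi (tr (∑ i, x i * y i)) := by
    rw [charSum, ← Equiv.sum_comp (Equiv.sumArrowEquivProdArrow (Fin m) (Fin m) F).symm,
      Fintype.sum_prod_type]
    rfl
  have h2 : ∀ x : Fin m → F, x ≠ 0 → ∑ y : Fin m → F, chi (tr (∑ i, x i * y i)) = 0 := by
    intro x hx
    obtain ⟨i, hi⟩ := Function.ne_iff.mp hx
    obtain ⟨c, hc⟩ := exists_tr_mul (x i) hi
    have h3 : ∑ y : Fin m → F, chi (tr (∑ i, x i * y i)) =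
        - ∑ y : Fin m → F, chi (tr (∑ i, x i * y i)) := by
      conv_lhs => rw [← Equiv.sum_comp (Equiv.addRight (Pi.single i c))]
      rw [← Finset.sum_neg_distrib]
      refine Finset.sum_congr rfl fun y _ => ?_
      have h4 : ∑ j, x j * (y + Pi.single i c : Fin m → F) j = ∑ j, x j * y j + c * x i := by
        simp [mul_add, Finset.sum_add_distrib, Pi.single_apply, mul_comm]
      rw [Equiv.coe_addRight, h4, tr, map_add, chi_add, ← tr, ← tr, hc]
      have : chi 1 = -1 := by decide
      rw [this]; ring
    linarith
  rw [h1, Finset.sum_eq_single 0 (fun x _ hx => h2 x hx) (by simp)]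
  simp [chi]

/-- The sign of a quadratic form is preserved by every change of variables. -/
theorem sign_eq (e : V m F ≃ V m F) (a b : V m F)
    (h : ∀ u, tr (theta0 (e u) + sform (e u) a ^ 2) = tr (theta0 u + sform u b ^ 2)) :
    tr (theta0 b) = tr (theta0 a) := by
  have := Fintype.ofFinite F
  have h1 : charSum (fun u : V m F => theta0 u + sform u a ^ 2) =
      charSum (fun u : V m F => theta0 u + sform u b ^ 2) := by
    rw [charSum, charSum, ← Equiv.sum_comp e]
    exact Finset.sum_congr rfl fun u _ => by rw [h]
  rw [charSum_theta, charSum_theta] at h1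
  exact (chi_inj _ _ (mul_right_cancel₀ charSum_theta0_ne_zero h1)).symm

end Forms

/-! ### The actions of the symplectic group and of the field automorphisms -/

section Actions

variable {m : ℕ} {F : Type*} [Field F] [Algebra (ZMod 2) F] {t : ZMod 2}

theorem sform_map (σ : F ≃ₐ[ZMod 2] F) (u v : V m F) :
    sform (σ ∘ u) (σ ∘ v) = σ (sform u v) := by
  simp [sform_eq]

theorem theta0_map (σ : F ≃ₐ[ZMod 2] F) (u : V m F) : theta0 (σ ∘ u) = σ (theta0 u) := by
  simp [theta0]

/-- The conjugate `u ↦ σ (θ (σ⁻¹ u))`, where `σ⁻¹` is applied to every coordinate of `u`. -/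
def conjForm (σ : F ≃ₐ[ZMod 2] F) (θ : Omega m F t) : QuadraticForm F (V m F) :=
  have hp : ∀ u v : V m F,
      QuadraticMap.polar (fun u : V m F => σ (θ.1 (σ.symm ∘ u))) u v = sform u v := by
    intro u v
    have h1 := congrArg σ (θ.2.1 (σ.symm ∘ u) (σ.symm ∘ v))
    rw [sform_map, AlgEquiv.apply_symm_apply] at h1
    rw [← h1]
    have h2 : σ.symm ∘ (u + v) = σ.symm ∘ u + σ.symm ∘ v := by ext; simp
    simp [QuadraticMap.polar, h2]
  QuadraticMap.ofPolar (fun u : V m F => σ (θ.1 (σ.symm ∘ u)))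
    (fun a u => by
      have h2 : σ.symm ∘ (a • u) = σ.symm a • (σ.symm ∘ u) := by ext; simp
      rw [h2, QuadraticMap.map_smul]
      simp)
    (fun u u' v => by rw [hp, hp, hp, sform_add_left])
    (fun a u v => by rw [hp, hp, sform_smul_left, smul_eq_mul])

/-- `Aut F = Gal(F / F_2)` acts on `Ω±` by `(σ • θ)(u) = σ (θ (σ⁻¹ u))`. -/
instance : MulAction (F ≃ₐ[ZMod 2] F) (Omega m F t) where
  smul σ θ := ⟨conjForm σ θ, by
    obtain ⟨a, ha, hθ⟩ := θ.2.2
    refine ⟨fun u v => ?_, σ ∘ a, ?_, fun u => ?_⟩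
    · have h1 := congrArg σ (θ.2.1 (σ.symm ∘ u) (σ.symm ∘ v))
      rw [sform_map, AlgEquiv.apply_symm_apply] at h1
      rw [← h1]
      have h2 : σ.symm ∘ (u + v) = σ.symm ∘ u + σ.symm ∘ v := by ext; simp
      change σ (θ.1 (σ.symm ∘ (u + v))) - σ (θ.1 (σ.symm ∘ u)) - σ (θ.1 (σ.symm ∘ v)) = _
      simp [QuadraticMap.polar, h2]
    · rw [theta0_map, ← ha]
      exact Algebra.trace_eq_of_algEquiv σ _
    · change σ (θ.1 (σ.symm ∘ u)) = _
      have h3 : σ ∘ (σ.symm ∘ u) = u := by ext; simp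
      rw [hθ, map_add, map_pow, ← sform_map, ← theta0_map, h3]⟩
  one_smul θ := Subtype.ext (QuadraticMap.ext fun _ => rfl)
  mul_smul σ τ θ := Subtype.ext (QuadraticMap.ext fun _ => rfl)

theorem smul_field_apply (σ : F ≃ₐ[ZMod 2] F) (θ : Omega m F t) (u : V m F) :
    (σ • θ).1 u = σ (θ.1 (σ.symm ∘ u)) := rfl

variable [Finite F]

/-- `Sp_{2m}(F)` acts on `Ω±` by `(x • θ)(u) = θ (u x)`. -/
instance : MulAction (Matrix.symplecticGroup (Fin m) F) (Omega m F t) where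
  smul x θ := ⟨θ.1.comp x.1.vecMulLinear, by
    have hp : ∀ u v, QuadraticMap.polar (θ.1.comp x.1.vecMulLinear) u v = sform u v := by
      intro u v
      rw [← sform_vecMul x, ← θ.2.1]
      simp [QuadraticMap.polar]
    refine ⟨hp, ?_⟩
    obtain ⟨a, ha, hθ⟩ := θ.2.2
    obtain ⟨b, hb⟩ := exists_eq_theta _ hp
    refine ⟨b, ?_, hb⟩
    rw [← ha]
    refine sign_eq ⟨fun u => Matrix.vecMul u x.1, fun u => Matrix.vecMul u (x⁻¹).1,
      fun u => ?_, fun u => ?_⟩ a b fun u => ?_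
    · change Matrix.vecMul (Matrix.vecMul u x.1) (x⁻¹).1 = u
      rw [Matrix.vecMul_vecMul, ← Submonoid.coe_mul, mul_inv_cancel, Submonoid.coe_one,
        Matrix.vecMul_one]
    · change Matrix.vecMul (Matrix.vecMul u (x⁻¹).1) x.1 = u
      rw [Matrix.vecMul_vecMul, ← Submonoid.coe_mul, inv_mul_cancel, Submonoid.coe_one,
        Matrix.vecMul_one]
    · rw [← hb, ← hθ]
      rfl⟩
  one_smul θ := by
    refine Subtype.ext (QuadraticMap.ext fun u => ?_)
    change θ.1 (Matrix.vecMul u 1) = θ.1 u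
    rw [Matrix.vecMul_one]
  mul_smul x y θ := by
    refine Subtype.ext (QuadraticMap.ext fun u => ?_)
    change θ.1 (Matrix.vecMul u (x.1 * y.1)) = θ.1 (Matrix.vecMul (Matrix.vecMul u x.1) y.1)
    rw [Matrix.vecMul_vecMul]

theorem smul_symplectic_apply (x : Matrix.symplecticGroup (Fin m) F) (θ : Omega m F t)
    (u : V m F) : (x • θ).1 u = θ.1 (Matrix.vecMul u x.1) := rfl

variable (m F t)

/-- The permutation group induced by `Sp_{2m}(F)` on `Ω±`. -/
def spPerms : Subgroup (Equiv.Perm (Omega m F t)) :=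
  (MulAction.toPermHom (Matrix.symplecticGroup (Fin m) F) (Omega m F t)).range

/-- The permutation group induced on `Ω±` by the derived subgroup `Sp_{2m}(F)'`. -/
def spDerivedPerms : Subgroup (Equiv.Perm (Omega m F t)) :=
  (commutator (Matrix.symplecticGroup (Fin m) F)).map
    (MulAction.toPermHom (Matrix.symplecticGroup (Fin m) F) (Omega m F t))

/-- The permutation group induced on `Ω±` by `Sp_{2m}(F) ⋊ Aut F`; for `m = 1` this
is `Aut (Sp_2(F))`. -/
def gammaSpPerms : Subgroup (Equiv.Perm (Omega m F t)) :=
  spPerms m F t ⊔ (MulAction.toPermHom (F ≃ₐ[ZMod 2] F) (Omega m F t)).range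

end Actions

end IBIS

end

noncomputable section

set_option linter.unusedSectionVars false

/-! Fix θ in Ω. Every point of Ω is θ + φ(·, c)² for a unique vector c with Tr θ(c) = 0, and θ
itself is the case c = 0. If the product of a symplectic x and a field automorphism σ fixes θ, then
it fixes the point of c exactly when c x = σ(c) (`fix_shift_iff`). In that case σ also fixes θ(c)
and all values of φ between such vectors (`apply_vecMul_of_fix`, `sform_fix`). Pointwise stabilizers
in Ω thus become stabilizers of vectors inside an orthogonal group. For nonsingular v the
transvection `otv θ v` fixes θ, and it fixes precisely the points with c orthogonal to v.

The nonabelian socle excludes m = 0 and m = 1, q = 2, since there Ω has at most three points. If q >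
2 or m ≥ 3, all transvections lie in the derived subgroup, hence in G.

To refute IBIS, `not_isIBIS` asks for a pointwise stabilizer having a base shorter than one of its
irredundant sequences. Long sequences come from chains of transvections (`irr_map_shift`). Short
bases come from the fact that an isometry fixing a singular vector e and all of e^⊥ is trivial
(`eq_one_of_fix`). For q ≥ 4 and m ≥ 2 all but four dimensions are frozen, and three points compete
with four (`not_isIBIS_of_two_le`). For q = 2 and m ≥ 3 six dimensions remain, and five points
compete with six (`not_isIBIS_of_three_le`).

For q = m = 2 the transvections act on Ω⁻ as transpositions, so G is symmetric or alternating there.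
On Ω⁺ three distinct points have a stabilizer of order two in Sp_4(2), whose generator is odd. Hence
irredundant bases have size four in the full group and size three in the derived subgroup.

For m = 1 the group G is determined by the field automorphisms it contains (`isIBIS_one_iff`). The
linear stabilizer of two points has order two if θ(c) ≠ 0 and is trivial if θ(c) = 0; the latter
happens only in Ω⁺. A nontrivial field automorphism in G fixing a nonzero element of trace zero
destroys IBIS, except on Ω⁻ for q = 4. If there is none and G has a nontrivial field automorphism,
Galois theory forces f to be an odd prime and G to be everything, and then all two-point stabilizers
have prime order. -/

namespace IBIS

open Matrix

/-! ### Irredundant sequences and criteria for IBIS -/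

section Bases

variable {X : Type*}

/-- The stabilizer of a point in a permutation group. -/
def ptStab (H : Subgroup (Equiv.Perm X)) (a : X) : Subgroup (Equiv.Perm X) :=
  H ⊓ MulAction.stabilizer (Equiv.Perm X) a

theorem mem_ptStab {H : Subgroup (Equiv.Perm X)} {a : X} {g : Equiv.Perm X} :
    g ∈ ptStab H a ↔ g ∈ H ∧ g a = a := Iff.rfl

/-- The pointwise stabilizer of a list of points. -/
def listStab : Subgroup (Equiv.Perm X) → List X → Subgroup (Equiv.Perm X)
  | H, [] => H
  | H, a :: l => listStab (ptStab H a) l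

/-- Every point of the list is moved by the pointwise stabilizer of its predecessors. -/
def Irr : Subgroup (Equiv.Perm X) → List X → Prop
  | _, [] => True
  | H, a :: l => (∃ g ∈ H, g a ≠ a) ∧ Irr (ptStab H a) l

theorem mem_listStab {H : Subgroup (Equiv.Perm X)} {l : List X} {g : Equiv.Perm X} :
    g ∈ listStab H l ↔ g ∈ H ∧ ∀ a ∈ l, g a = a := by
  induction l generalizing H with
  | nil => simp [listStab]
  | cons a l ih => simp [listStab, ih, mem_ptStab, and_assoc]

theorem listStab_append (H : Subgroup (Equiv.Perm X)) (l l' : List X) :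
    listStab H (l ++ l') = listStab (listStab H l) l' := by
  induction l generalizing H with
  | nil => rfl
  | cons a l ih => exact ih _

theorem irr_append {H : Subgroup (Equiv.Perm X)} {l l' : List X} :
    Irr H (l ++ l') ↔ Irr H l ∧ Irr (listStab H l) l' := by
  induction l generalizing H with
  | nil => simp [Irr, listStab]
  | cons a l ih => simp [Irr, listStab, ih, and_assoc]

/-- Dropping every point already fixed by its predecessors does not change the stabilizer. So any
base, irredundant or not, bounds the size of some irredundant base. -/
theorem exists_irr_le (H : Subgroup (Equiv.Perm X)) (l : List X) :
    ∃ l' : List X, l'.length ≤ l.length ∧ Irr H l' ∧ listStab H l' = listStab H l := by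
  induction l generalizing H with
  | nil => exact ⟨[], le_rfl, trivial, rfl⟩
  | cons a l ih =>
    obtain ⟨l', h1, h2, h3⟩ := ih (ptStab H a)
    by_cases h : ∃ g ∈ H, g a ≠ a
    · exact ⟨a :: l', by simpa using h1, ⟨h, h2⟩, h3⟩
    · push Not at h
      have h4 : ptStab H a = H := le_antisymm inf_le_left fun g hg => ⟨hg, h g hg⟩
      exact ⟨l', by simp; omega, h4 ▸ h2, by rw [listStab, ← h3, h4]⟩

theorem exists_irr_listStab_eq_bot [Finite X] (H : Subgroup (Equiv.Perm X)) :
    ∃ l : List X, Irr H l ∧ listStab H l = ⊥ := by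
  induction h : Nat.card H using Nat.strong_induction_on generalizing H with
  | _ n ih =>
    by_cases hH : H = ⊥
    · exact ⟨[], trivial, hH⟩
    · obtain ⟨⟨g, hg⟩, hg1⟩ := Subgroup.ne_bot_iff_exists_ne_one.mp hH
      obtain ⟨a, ha⟩ : ∃ a, g a ≠ a := by
        by_contra! hcon
        exact hg1 (Subtype.ext (Equiv.ext hcon))
      have hlt : ptStab H a < H := lt_of_le_of_ne inf_le_left fun he =>
        ha (mem_ptStab.mp (he.symm ▸ hg : g ∈ ptStab H a)).2
      have hcard : Nat.card (ptStab H a) < n := by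
        rw [← h]
        exact Set.Finite.card_lt_card (Set.toFinite _) (SetLike.coe_ssubset_coe.mpr hlt)
      obtain ⟨l, h1, h2⟩ := ih _ hcard _ rfl
      exact ⟨a :: l, ⟨⟨g, hg, ha⟩, h1⟩, h2⟩

theorem isIrredundantBase_get {G : Subgroup (Equiv.Perm X)} {l : List X} (h : Irr G l)
    (hb : listStab G l = ⊥) : IsIrredundantBase G l.get := by
  refine ⟨fun g hg hfix => ?_, ?_⟩
  · rw [← Subgroup.mem_bot, ← hb, mem_listStab]
    refine ⟨hg, fun a ha => ?_⟩
    obtain ⟨i, rfl⟩ := List.get_of_mem ha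
    exact hfix i
  · clear hb
    induction l generalizing G with
    | nil => exact fun i => i.elim0
    | cons a l ih =>
      intro i
      refine Fin.cases ?_ (fun i => ?_) i
      · obtain ⟨g, hg, hga⟩ := h.1
        exact ⟨g, hg, fun j hj => absurd hj (Fin.not_lt_zero j), hga⟩
      · obtain ⟨g, hg, h1, h2⟩ := ih h.2 i
        refine ⟨g, (mem_ptStab.mp hg).1, fun j => ?_, h2⟩
        refine Fin.cases (fun _ => (mem_ptStab.mp hg).2) (fun j hj => ?_) j
        exact h1 j (Fin.succ_lt_succ_iff.mp hj)

/-- If a pointwise stabilizer has a base shorter than one of its irredundant sequences, then the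
group is not IBIS. -/
theorem not_isIBIS [Finite X] {G : Subgroup (Equiv.Perm X)} (p b c : List X)
    (hb : ∀ g ∈ listStab G p, (∀ a ∈ b, g a = a) → g = 1) (hc : Irr (listStab G p) c)
    (hlen : b.length < c.length) : ¬ IsIBIS G := by
  intro hG
  -- Two irredundant bases share the beginning p'. One continues with a thinned-out b, the other
  -- with c and a completion d, so their lengths differ.
  obtain ⟨p', -, hp, hps⟩ := exists_irr_le G p
  obtain ⟨b', hb1, hb2, hb3⟩ := exists_irr_le (listStab G p) b
  obtain ⟨d, hd1, hd2⟩ := exists_irr_listStab_eq_bot (listStab (listStab G p) c)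
  have h1 : IsIrredundantBase G (p' ++ b').get := by
    refine isIrredundantBase_get (irr_append.mpr ⟨hp, hps ▸ hb2⟩) ?_
    rw [listStab_append, hps, hb3, eq_bot_iff]
    intro g hg
    rw [mem_listStab] at hg
    exact hb g hg.1 hg.2
  have h2 : IsIrredundantBase G (p' ++ (c ++ d)).get := by
    refine isIrredundantBase_get (irr_append.mpr ⟨hp, ?_⟩) ?_
    · rw [hps]
      exact irr_append.mpr ⟨hc, hd1⟩
    · rw [listStab_append, listStab_append, hps, hd2]
  have := hG _ _ _ _ h1 h2
  simp only [List.length_append] at this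
  omega

theorem IsIrredundantBase.injective {G : Subgroup (Equiv.Perm X)} {n : ℕ} {ω : Fin n → X}
    (h : IsIrredundantBase G ω) : Function.Injective ω := by
  intro i j hij
  by_contra hne
  wlog hlt : i < j generalizing i j
  · exact this hij.symm (Ne.symm hne) (lt_of_le_of_ne (not_lt.mp hlt) (Ne.symm hne))
  obtain ⟨g, -, h1, h2⟩ := h.2 j
  exact h2 (hij ▸ h1 i hlt)

theorem exists_injective_extend [Finite X] {n k : ℕ} (hk : k ≤ Nat.card X) (ω : Fin n → X)
    (hω : Function.Injective ω) (hnk : n ≤ k) :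
    ∃ ω' : Fin k → X, Function.Injective ω' ∧ ∀ i, ∃ j, ω' j = ω i := by
  classical
  have := Fintype.ofFinite X
  rw [Nat.card_eq_fintype_card] at hk
  obtain ⟨s, hs1, -, hs2⟩ := Finset.exists_subsuperset_card_eq (n := k)
    (Finset.subset_univ (Finset.univ.image ω))
    (by rw [Finset.card_image_of_injective _ hω]; simpa using hnk) (by simpa using hk)
  refine ⟨fun i => (s.equivFinOfCardEq hs2).symm i,
    Subtype.val_injective.comp (Equiv.injective _), fun i => ?_⟩
  have : ω i ∈ s := hs1 (Finset.mem_image_of_mem _ (Finset.mem_univ i))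
  exact ⟨s.equivFinOfCardEq hs2 ⟨ω i, this⟩, by simp⟩

/-- If the pointwise stabilizer of any `k` distinct points is nontrivial, but becomes trivial on
stabilizing any further point which it moves, then all irredundant bases have `k + 1` points. -/
theorem isIBIS_of_forall_injective [Finite X] {G : Subgroup (Equiv.Perm X)} (k : ℕ)
    (hk : k ≤ Nat.card X)
    (h1 : ∀ ω : Fin k → X, Function.Injective ω → ∃ g ∈ G, (∀ i, g (ω i) = ω i) ∧ g ≠ 1)
    (h2 : ∀ ω : Fin k → X, Function.Injective ω → ∀ a, ∀ h ∈ G, (∀ i, h (ω i) = ω i) → h a ≠ a →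
      ∀ g ∈ G, (∀ i, g (ω i) = ω i) → g a = a → g = 1) : IsIBIS G := by
  suffices H : ∀ (n : ℕ) (ω : Fin n → X), IsIrredundantBase G ω → n = k + 1 from
    fun n n' ω ω' h h' => (H n ω h).trans (H n' ω' h').symm
  intro n ω h
  -- The points of an irredundant base are distinct. A base with n > k + 1 would move its last point
  -- with a stabilizer that is already trivial. A base with n ≤ k would extend to k distinct points,
  -- whose stabilizer is nontrivial.
  rcases Nat.lt_or_ge k n with hkn | hkn
  · by_contra hne
    have hlt : k + 1 < n := by omega
    let ω' : Fin k → X := fun i => ω ⟨i, by omega⟩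
    have hinj : Function.Injective ω' := fun i j hij => by
      have := h.injective hij
      simpa [Fin.ext_iff] using this
    obtain ⟨g, hg, hg1, hg2⟩ := h.2 ⟨k, hkn⟩
    obtain ⟨g', hg', hg1', hg2'⟩ := h.2 ⟨k + 1, hlt⟩
    have := h2 ω' hinj _ g hg (fun i => hg1 _ (by simp [Fin.lt_def])) hg2 g' hg'
      (fun i => hg1' _ (by simp only [Fin.lt_def]; omega)) (hg1' _ (by simp [Fin.lt_def]))
    exact hg2' (by rw [this]; rfl)
  · obtain ⟨ω', hinj, hω'⟩ := exists_injective_extend hk ω h.injective hkn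
    obtain ⟨g, hg, hg1, hg2⟩ := h1 ω' hinj
    refine absurd (h.1 g hg fun i => ?_) hg2
    obtain ⟨j, hj⟩ := hω' i
    rw [← hj, hg1]

theorem isIBIS_of_forall_pair [Finite X] {G : Subgroup (Equiv.Perm X)} (hX : 2 ≤ Nat.card X)
    (h1 : ∀ a b : X, a ≠ b → ∃ g ∈ G, g a = a ∧ g b = b ∧ g ≠ 1)
    (h2 : ∀ a b : X, a ≠ b → ∀ c, ∀ h ∈ G, h a = a → h b = b → h c ≠ c →
      ∀ g ∈ G, g a = a → g b = b → g c = c → g = 1) : IsIBIS G := by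
  refine isIBIS_of_forall_injective 2 hX (fun ω hω => ?_) fun ω hω c h hh hf hc g hg hgf hgc => ?_
  · obtain ⟨g, hg, ha, hb, hne⟩ := h1 (ω 0) (ω 1) (hω.ne (by decide))
    exact ⟨g, hg, fun i => by fin_cases i <;> assumption, hne⟩
  · exact h2 (ω 0) (ω 1) (hω.ne (by decide)) c h hh (hf 0) (hf 1) hc g hg (hgf 0) (hgf 1) hgc

end Bases

/-! ### Symplectic geometry: hyperbolic pairs and transvections -/

section Geometry

variable {m : ℕ} {F : Type*} [Field F]

theorem sform_add_right (u v v' : V m F) : sform u (v + v') = sform u v + sform u v' := by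
  simp [sform, mulVec_add]

theorem sform_smul_right (c : F) (u v : V m F) : sform u (c • v) = c * sform u v := by
  simp [sform, mulVec_smul]

theorem sform_self (u : V m F) : sform u u = 0 := by
  rw [sform_eq]
  exact Finset.sum_eq_zero fun i _ => by ring

/-- The linear form `sform · c`. -/
def sformLin (c : V m F) : V m F →ₗ[F] F where
  toFun u := sform u c
  map_add' u v := sform_add_left u v c
  map_smul' a u := sform_smul_left a u c

theorem sformLin_apply (c u : V m F) : sformLin c u = sform u c := rfl

theorem sform_zero_left (v : V m F) : sform 0 v = 0 := (sformLin v).map_zero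

theorem sform_zero_right (v : V m F) : sform v 0 = 0 := by simp [sform]

/-- The vector with coordinates `x, y` in the `i`-th hyperbolic pair and zero elsewhere. -/
def vec (i : Fin m) (x y : F) : V m F :=
  Sum.elim (Pi.single i x) (Pi.single i y)

theorem vec_inl (i : Fin m) (x y : F) (j : Fin m) :
    vec i x y (Sum.inl j) = if j = i then x else 0 := by
  simp [vec, Pi.single_apply]

theorem vec_inr (i : Fin m) (x y : F) (j : Fin m) :
    vec i x y (Sum.inr j) = if j = i then y else 0 := by
  simp [vec, Pi.single_apply]

theorem sform_vec_right (u : V m F) (i : Fin m) (x y : F) :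
    sform u (vec i x y) = u (Sum.inr i) * x - u (Sum.inl i) * y := by
  rw [sform_eq, Finset.sum_eq_single i]
  · simp [vec_inl, vec_inr]
  · intro j _ hj
    simp [vec_inl, vec_inr, hj]
  · simp

theorem theta0_vec (i : Fin m) (x y : F) : theta0 (vec i x y) = x * y := by
  rw [theta0, Finset.sum_eq_single i]
  · simp [vec_inl, vec_inr]
  · intro j _ hj
    simp [vec_inl, vec_inr, hj]
  · simp

theorem smul_vec (i : Fin m) (c x y : F) : c • vec i x y = vec i (c * x) (c * y) := by
  ext j
  rcases j with j | j <;> simp [vec_inl, vec_inr]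

theorem vec_add_vec (i : Fin m) (x y x' y' : F) :
    vec i x y + vec i x' y' = vec i (x + x') (y + y') := by
  ext j
  rcases j with j | j <;> simp only [Pi.add_apply, vec_inl, vec_inr] <;> split_ifs <;> simp

theorem comp_vec (σ : F ≃+* F) (i : Fin m) (x y : F) : σ ∘ vec i x y = vec i (σ x) (σ y) := by
  ext j
  rcases j with j | j <;> simp only [Function.comp, vec_inl, vec_inr] <;> split_ifs <;> simp

theorem eq_sum_vec (u : V m F) : u = ∑ i, vec i (u (Sum.inl i)) (u (Sum.inr i)) := by
  ext j
  rcases j with j | j <;> simp [Finset.sum_apply, vec_inl, vec_inr]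

theorem vec_ne_zero_left (i : Fin m) {x : F} (y : F) (hx : x ≠ 0) : vec i x y ≠ 0 := fun h => by
  have := congrFun h (Sum.inl i)
  rw [vec_inl, if_pos rfl] at this
  exact hx this

theorem eq_zero_of_sform_eq_zero {c : V m F} (h : ∀ u, sform u c = 0) : c = 0 := by
  ext j
  rcases j with j | j
  · have := h (vec j 0 1)
    rw [sform_eq, Finset.sum_eq_single j] at this
    · simpa [vec_inl, vec_inr] using this
    · intro k _ hk
      simp [vec_inl, vec_inr, hk]
    · simp
  · have := h (vec j 1 0)
    rw [sform_eq, Finset.sum_eq_single j] at this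
    · simpa [vec_inl, vec_inr] using this
    · intro k _ hk
      simp [vec_inl, vec_inr, hk]
    · simp

theorem exists_sform_ne_zero {c : V m F} (hc : c ≠ 0) : ∃ u, sform u c ≠ 0 := by
  by_contra! h
  exact hc (eq_zero_of_sform_eq_zero h)

theorem mem_symplecticGroup_of_sform {x : Matrix (Fin m ⊕ Fin m) (Fin m ⊕ Fin m) F}
    (h : ∀ u v : V m F, sform (u ᵥ* x) (v ᵥ* x) = sform u v) : x ∈ symplecticGroup (Fin m) F := by
  rw [SymplecticGroup.mem_iff]
  refine Matrix.ext_of_single_vecMul fun i => dotProduct_eq _ _ fun v => ?_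
  have := h (Pi.single i 1) v
  rw [sform, sform, ← dotProduct_mulVec, ← mulVec_transpose, mulVec_mulVec, mulVec_mulVec,
    dotProduct_mulVec, dotProduct_mulVec] at this
  exact this

/-- The symplectic matrix of an isometry. -/
def mkSp (L : V m F →ₗ[F] V m F) (h : ∀ u v, sform (L u) (L v) = sform u v) :
    symplecticGroup (Fin m) F :=
  ⟨LinearMap.toMatrixRight' L, mem_symplecticGroup_of_sform fun u v => by
    rw [← Matrix.toLinearMapRight'_apply, ← Matrix.toLinearMapRight'_apply]
    simpa using h u v⟩

theorem vecMul_mkSp (L : V m F →ₗ[F] V m F) (h : ∀ u v, sform (L u) (L v) = sform u v)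
    (u : V m F) : u ᵥ* (mkSp L h).1 = L u := by
  rw [← Matrix.toLinearMapRight'_apply]
  simp [mkSp]

theorem symplectic_ext {x y : symplecticGroup (Fin m) F} (h : ∀ u, u ᵥ* x.1 = u ᵥ* y.1) : x = y :=
  Subtype.ext (Matrix.ext_of_single_vecMul fun _ => h _)

theorem vecMul_mul_val (u : V m F) (x y : symplecticGroup (Fin m) F) :
    u ᵥ* (x * y).1 = (u ᵥ* x.1) ᵥ* y.1 := (vecMul_vecMul _ _ _).symm

theorem vecMul_one_val (u : V m F) : u ᵥ* (1 : symplecticGroup (Fin m) F).1 = u := vecMul_one u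

theorem vecMul_inv_cancel (u : V m F) (x : symplecticGroup (Fin m) F) :
    (u ᵥ* x.1) ᵥ* (x⁻¹).1 = u := by
  rw [← vecMul_mul_val, mul_inv_cancel, vecMul_one_val]

theorem vecMul_inv_cancel' (u : V m F) (x : symplecticGroup (Fin m) F) :
    (u ᵥ* (x⁻¹).1) ᵥ* x.1 = u := by
  rw [← vecMul_mul_val, inv_mul_cancel, vecMul_one_val]

/-- The transvection `u ↦ u + b φ(u, v) v`. -/
def tv (v : V m F) (b : F) : symplecticGroup (Fin m) F :=
  mkSp (LinearMap.id + (b • sformLin v).smulRight v) fun u w => by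
    have h : sform v w = - sform w v := by
      rw [sform_eq, sform_eq, ← Finset.sum_neg_distrib]
      exact Finset.sum_congr rfl fun i _ => by ring
    simp only [LinearMap.add_apply, LinearMap.id_apply, LinearMap.smulRight_apply,
      LinearMap.smul_apply, sformLin_apply, smul_eq_mul, sform_add_left, sform_add_right,
      sform_smul_left, sform_smul_right, sform_self, h]
    ring

theorem vecMul_tv (u v : V m F) (b : F) : u ᵥ* (tv v b).1 = u + (b * sform u v) • v := by
  rw [tv, vecMul_mkSp]
  rfl

theorem vecMul_tv_of_sform_eq_zero {u v : V m F} (b : F) (h : sform u v = 0) :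
    u ᵥ* (tv v b).1 = u := by
  rw [vecMul_tv, h, mul_zero, zero_smul, add_zero]

variable [Algebra (ZMod 2) F]

theorem sform_comm (u v : V m F) : sform u v = sform v u := by
  have := charTwo F
  simp only [sform_eq, CharTwo.sub_eq_add]
  exact Finset.sum_congr rfl fun i _ => by ring

theorem add_self (x : F) : x + x = 0 := by
  have := charTwo F
  exact CharTwo.add_self_eq_zero x

theorem vadd_self (x : V m F) : x + x = 0 := by
  ext i
  exact add_self _

theorem eq_of_add_eq_zero {x y : F} (h : x + y = 0) : x = y := by
  have := charTwo F
  exact CharTwo.add_eq_zero.mp h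

theorem eq_of_vadd_eq_zero {x y : V m F} (h : x + y = 0) : x = y := by
  ext i
  exact eq_of_add_eq_zero (congrFun h i)

theorem sq_injective {x y : F} (h : x ^ 2 = y ^ 2) : x = y := by
  have := charTwo F
  exact CharTwo.sq_injective h

theorem theta0_smul (c : F) (u : V m F) : theta0 (c • u) = c ^ 2 * theta0 u := by
  simp only [theta0, Pi.smul_apply, smul_eq_mul, Finset.mul_sum]
  exact Finset.sum_congr rfl fun i _ => by ring

theorem tv_mul_self (v : V m F) (b : F) : tv v b * tv v b = 1 := by
  refine symplectic_ext fun u => ?_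
  rw [vecMul_mul_val, vecMul_tv, vecMul_tv, vecMul_one_val, sform_add_left, sform_smul_left,
    sform_self, mul_zero, add_zero, add_assoc, vadd_self, add_zero]

end Geometry

/-! ### The points of Ω as translates of one form -/

section Points

variable {m : ℕ} {F : Type*} [Field F] [Algebra (ZMod 2) F] [Finite F] {t : ZMod 2}

theorem exists_sq_eq (x : F) : ∃ y : F, y ^ 2 = x := by
  have := charTwo F
  have : Fact (Nat.Prime 2) := ⟨Nat.prime_two⟩
  obtain ⟨y, hy⟩ := (Finite.injective_iff_surjective.mp (frobenius_inj F 2)) x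
  exact ⟨y, by simpa [frobenius_def] using hy⟩

theorem tr_add (x y : F) : tr (x + y) = tr x + tr y := map_add _ _ _

theorem tr_zero : tr (0 : F) = 0 := map_zero _

theorem omega_ext {θ θ' : Omega m F t} (h : ∀ u, θ.1 u = θ'.1 u) : θ = θ' :=
  Subtype.ext (QuadraticMap.ext h)

instance : Finite (Omega m F t) := by
  refine Finite.of_injective (fun θ : Omega m F t => (fun u => θ.1 u : V m F → F)) fun θ θ' h => ?_
  exact omega_ext (congrFun h)

theorem omega_add (θ : Omega m F t) (u v : V m F) :
    θ.1 (u + v) = θ.1 u + θ.1 v + sform u v := by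
  have h := θ.2.1 u v
  rw [QuadraticMap.polar] at h
  rw [← h]
  ring

theorem omega_smul (θ : Omega m F t) (c : F) (u : V m F) : θ.1 (c • u) = c ^ 2 * θ.1 u := by
  rw [QuadraticMap.map_smul, sq, smul_eq_mul]

theorem omega_zero (θ : Omega m F t) : θ.1 0 = 0 := QuadraticMap.map_zero _

/-- Modulo the trace, the last summand is θ_a(c). So passing from θ_a to θ_{a+c} preserves the type
exactly when Tr θ_a(c) = 0, which is the condition in `shift`. -/
theorem tr_theta0_add (a c : V m F) :
    tr (theta0 (a + c)) = tr (theta0 a) + tr (theta0 c + sform c a ^ 2) := by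
  rw [theta0_add, tr_add, tr_add, tr_add, tr_sq, sform_comm c a, add_assoc]

/-- The quadratic form `u ↦ θ u + φ(u, c) ^ 2`, if it has the same type as `θ`. -/
def shift (θ : Omega m F t) (c : V m F) : Omega m F t :=
  if h : tr (θ.1 c) = 0 then
    ⟨θ.1 + QuadraticMap.linMulLin (sformLin c) (sformLin c), by
      have h0 : ∀ u, (θ.1 + QuadraticMap.linMulLin (sformLin c) (sformLin c)) u =
          θ.1 u + sform u c ^ 2 := fun u => by
        rw [_root_.add_apply, QuadraticMap.linMulLin_apply, sformLin_apply, sq]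
      refine ⟨fun u v => ?_, ?_⟩
      · simp only [QuadraticMap.polar, h0, omega_add, sform_add_left]
        linear_combination (sform u c * sform v c) * add_self (1 : F)
      · obtain ⟨a, ha, hθ⟩ := θ.2.2
        refine ⟨a + c, ?_, fun u => ?_⟩
        · rw [tr_theta0_add, ← hθ, ha, h, add_zero]
        · rw [h0, hθ, sform_add_right]
          linear_combination -(sform u a * sform u c) * add_self (1 : F)⟩
  else θ

theorem shift_apply {θ : Omega m F t} {c : V m F} (h : tr (θ.1 c) = 0) (u : V m F) :
    (shift θ c).1 u = θ.1 u + sform u c ^ 2 := by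
  have e : shift θ c = _ := dif_pos h
  rw [e, sq]
  rfl

/-- With `shift_injective` this identifies Ω, seen from θ, with the vectors on which θ has trace
zero; c is the difference of the two labels. -/
theorem exists_eq_shift (θ θ' : Omega m F t) : ∃ c, tr (θ.1 c) = 0 ∧ θ' = shift θ c := by
  obtain ⟨a, ha, hθ⟩ := θ.2.2
  obtain ⟨b, hb, hθ'⟩ := θ'.2.2
  have hab : a + (a + b) = b := by rw [← add_assoc, vadd_self, zero_add]
  have h : tr (θ.1 (a + b)) = 0 := by
    have := tr_theta0_add a (a + b)
    rw [hab, ← hθ, ha, hb] at this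
    simpa using this
  refine ⟨a + b, h, omega_ext fun u => ?_⟩
  rw [shift_apply h, hθ, hθ', sform_add_right]
  linear_combination -(sform u a ^ 2 + sform u a * sform u b) * add_self (1 : F)

theorem shift_injective {θ : Omega m F t} {c d : V m F} (hc : tr (θ.1 c) = 0)
    (hd : tr (θ.1 d) = 0) (h : shift θ c = shift θ d) : c = d := by
  refine eq_of_vadd_eq_zero (eq_zero_of_sform_eq_zero fun u => ?_)
  have := shift_apply hc u
  rw [h, shift_apply hd] at this
  rw [sform_add_right, sq_injective (add_left_cancel this), add_self]

theorem shift_zero (θ : Omega m F t) : shift θ 0 = θ := omega_ext fun u => by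
  rw [shift_apply (by rw [omega_zero, tr_zero]), sform_zero_right, zero_pow two_ne_zero, add_zero]

theorem shift_ne_self {θ : Omega m F t} {c : V m F} (hc : tr (θ.1 c) = 0) (h0 : c ≠ 0) :
    shift θ c ≠ θ := fun h => by
  rw [← shift_zero θ, shift_zero θ] at h
  refine h0 (shift_injective (θ := θ) hc (by rw [omega_zero, tr_zero]) ?_)
  rw [h, shift_zero]

/-- The quadratic form `θ_a`. -/
def thetaPt (a : V m F) (h : tr (theta0 a) = t) : Omega m F t :=
  ⟨QuadraticMap.ofPolar (fun u => theta0 u + sform u a ^ 2)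
    (fun c u => by
      rw [theta0_smul, sform_smul_left, smul_eq_mul]
      ring)
    (fun u u' v => by
      simp only [QuadraticMap.polar, theta0_add, sform_add_left]
      ring)
    (fun c u v => by
      simp only [QuadraticMap.polar, theta0_add, sform_add_left, theta0_smul, sform_smul_left,
        smul_eq_mul]
      linear_combination (c * sform u a * sform v a - c * sform u a * sform v a) *
        add_self (1 : F)), fun u v => by
      change theta0 (u + v) + sform (u + v) a ^ 2 - (theta0 u + sform u a ^ 2) -
        (theta0 v + sform v a ^ 2) = _
      rw [theta0_add, sform_add_left]
      linear_combination (sform u a * sform v a) * add_self (1 : F), a, h, fun u => rfl⟩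

theorem thetaPt_apply (a : V m F) (h : tr (theta0 a) = t) (u : V m F) :
    (thetaPt a h).1 u = theta0 u + sform u a ^ 2 := rfl

theorem thetaPt_eq {a b : V m F} (ha : tr (theta0 a) = t) (hb : tr (theta0 b) = t) (h : a = b) :
    thetaPt a ha = thetaPt b hb := by
  subst h
  rfl

theorem exists_eq_thetaPt (θ : Omega m F t) : ∃ a h, θ = thetaPt a h := by
  obtain ⟨a, ha, hθ⟩ := θ.2.2
  exact ⟨a, ha, omega_ext hθ⟩

end Points

/-! ### Semilinear isometries and their fixed points -/

section Action

variable {m : ℕ} {F : Type*} [Field F] [Algebra (ZMod 2) F] [Finite F] {t : ZMod 2}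

/-- The permutation induced by a symplectic matrix. -/
abbrev spHom (m : ℕ) (F : Type*) [Field F] [Algebra (ZMod 2) F] [Finite F] (t : ZMod 2) :
    symplecticGroup (Fin m) F →* Equiv.Perm (Omega m F t) :=
  MulAction.toPermHom _ _

/-- The permutation induced by a field automorphism. -/
abbrev autHom (m : ℕ) (F : Type*) [Field F] [Algebra (ZMod 2) F] (t : ZMod 2) :
    (F ≃ₐ[ZMod 2] F) →* Equiv.Perm (Omega m F t) :=
  MulAction.toPermHom _ _

theorem spHom_apply_apply (x : symplecticGroup (Fin m) F) (θ : Omega m F t) (u : V m F) :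
    (spHom m F t x θ).1 u = θ.1 (u ᵥ* x.1) := rfl

/-- The image of a symplectic matrix under a field automorphism. -/
def mapSp (σ : F ≃ₐ[ZMod 2] F) (x : symplecticGroup (Fin m) F) : symplecticGroup (Fin m) F :=
  mkSp
    { toFun := fun u => σ ∘ ((σ.symm ∘ u) ᵥ* x.1)
      map_add' := fun u v => by
        have h : σ.symm ∘ (u + v) = σ.symm ∘ u + σ.symm ∘ v := by ext; simp
        rw [h, add_vecMul]
        ext
        simp
      map_smul' := fun c u => by
        have h : σ.symm ∘ (c • u) = σ.symm c • (σ.symm ∘ u) := by ext; simp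
        rw [h, smul_vecMul]
        ext
        simp }
    fun u v => by
      change sform (σ ∘ _) (σ ∘ _) = _
      rw [sform_map, sform_vecMul, ← sform_map]
      congr 1 <;> ext <;> simp

theorem autHom_mul_spHom (σ : F ≃ₐ[ZMod 2] F) (x : symplecticGroup (Fin m) F) :
    autHom m F t σ * spHom m F t x = spHom m F t (mapSp σ x) * autHom m F t σ := by
  refine Equiv.ext fun θ => omega_ext fun u => ?_
  change σ (θ.1 ((σ.symm ∘ u) ᵥ* x.1)) = σ (θ.1 (σ.symm ∘ (u ᵥ* (mapSp σ x).1)))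
  rw [mapSp, vecMul_mkSp]
  congr 2
  ext
  simp

theorem exists_eq_of_mem_gammaSpPerms {g : Equiv.Perm (Omega m F t)}
    (hg : g ∈ gammaSpPerms m F t) : ∃ x σ, g = spHom m F t x * autHom m F t σ := by
  rw [gammaSpPerms, spPerms, Subgroup.sup_eq_closure] at hg
  induction hg using Subgroup.closure_induction with
  | mem g hg =>
    rcases hg with ⟨x, rfl⟩ | ⟨σ, rfl⟩
    · exact ⟨x, 1, by rw [map_one, mul_one]⟩
    · exact ⟨1, σ, by rw [map_one, one_mul]⟩
  | one => exact ⟨1, 1, by rw [map_one, map_one, one_mul]⟩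
  | mul g h _ _ hg hh =>
    obtain ⟨x, σ, rfl⟩ := hg
    obtain ⟨y, τ, rfl⟩ := hh
    refine ⟨x * mapSp σ y, σ * τ, ?_⟩
    rw [mul_assoc, ← mul_assoc (autHom m F t σ), autHom_mul_spHom, map_mul, map_mul]
    simp only [mul_assoc]
  | inv g _ hg =>
    obtain ⟨x, σ, rfl⟩ := hg
    refine ⟨mapSp σ⁻¹ x⁻¹, σ⁻¹, ?_⟩
    rw [← autHom_mul_spHom, _root_.mul_inv_rev, map_inv, map_inv]

theorem spHom_mem_gammaSpPerms (x : symplecticGroup (Fin m) F) :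
    spHom m F t x ∈ gammaSpPerms m F t := Subgroup.mem_sup_left ⟨x, rfl⟩

theorem autHom_mem_gammaSpPerms (σ : F ≃ₐ[ZMod 2] F) :
    autHom m F t σ ∈ gammaSpPerms m F t := Subgroup.mem_sup_right ⟨σ, rfl⟩

/-- Used to eliminate field automorphisms: fixed points whose vectors have suitable values under θ
force σ to fix a generator of the field. -/
theorem apply_vecMul_of_fix {x : symplecticGroup (Fin m) F} {σ : F ≃ₐ[ZMod 2] F}
    {θ : Omega m F t} (h : (spHom m F t x * autHom m F t σ) θ = θ) {c : V m F}
    (hc : c ᵥ* x.1 = σ ∘ c) : σ (θ.1 c) = θ.1 c := by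
  conv_rhs => rw [← h]
  change σ (θ.1 c) = σ (θ.1 (σ.symm ∘ (c ᵥ* x.1)))
  rw [hc]
  have : σ.symm ∘ (σ ∘ c) = c := by ext; simp
  rw [this]

/-- The image of θ + φ(·, c)² is θ + φ(· x, σ(c))². Since squaring is injective and φ is
nondegenerate and preserved by x, equality of the two forms is equality of the vectors c x and σ(c).
-/
theorem fix_shift_iff {x : symplecticGroup (Fin m) F} {σ : F ≃ₐ[ZMod 2] F}
    {θ : Omega m F t} (h : (spHom m F t x * autHom m F t σ) θ = θ) {c : V m F}
    (hc : tr (θ.1 c) = 0) :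
    (spHom m F t x * autHom m F t σ) (shift θ c) = shift θ c ↔ c ᵥ* x.1 = σ ∘ c := by
  have h1 : ∀ u, ((spHom m F t x * autHom m F t σ) (shift θ c)).1 u =
      θ.1 u + sform (u ᵥ* x.1) (σ ∘ c) ^ 2 := fun u => by
    conv_rhs => rw [← h]
    change σ ((shift θ c).1 (σ.symm ∘ (u ᵥ* x.1))) = σ (θ.1 (σ.symm ∘ (u ᵥ* x.1))) + _
    have h2 : σ ∘ (σ.symm ∘ (u ᵥ* x.1)) = u ᵥ* x.1 := by ext; simp
    rw [shift_apply hc, map_add, map_pow, ← sform_map, h2]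
  constructor
  · intro h2
    refine eq_of_vadd_eq_zero (eq_zero_of_sform_eq_zero fun w => ?_)
    obtain ⟨u, rfl⟩ : ∃ u, u ᵥ* x.1 = w := ⟨_, vecMul_inv_cancel' w x⟩
    have h3 := h1 u
    rw [h2, shift_apply hc] at h3
    rw [sform_add_right, sform_vecMul, sq_injective (add_left_cancel h3), add_self]
  · intro h2
    refine omega_ext fun u => ?_
    rw [h1, ← h2, sform_vecMul, shift_apply hc]

theorem sform_fix {x : symplecticGroup (Fin m) F} {σ : F ≃ₐ[ZMod 2] F} {c d : V m F}
    (hc : c ᵥ* x.1 = σ ∘ c) (hd : d ᵥ* x.1 = σ ∘ d) : σ (sform c d) = sform c d := by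
  rw [← sform_map, ← hc, ← hd, sform_vecMul]

theorem spHom_fix_shift_iff {x : symplecticGroup (Fin m) F} {θ : Omega m F t}
    (h : spHom m F t x θ = θ) {c : V m F} (hc : tr (θ.1 c) = 0) :
    spHom m F t x (shift θ c) = shift θ c ↔ c ᵥ* x.1 = c := by
  have := fix_shift_iff (x := x) (σ := 1) (θ := θ) (by rw [map_one, mul_one, h]) hc
  rw [map_one, mul_one] at this
  exact this

theorem spHom_tv_apply (θ : Omega m F t) (v : V m F) (b : F) (u : V m F) :
    (spHom m F t (tv v b) θ).1 u = θ.1 u + (b + b ^ 2 * θ.1 v) * sform u v ^ 2 := by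
  rw [spHom_apply_apply, vecMul_tv, omega_add, omega_smul, sform_smul_right]
  ring

/-- The transvection with centre `v` preserving `θ`. -/
def otv (θ : Omega m F t) (v : V m F) : symplecticGroup (Fin m) F := tv v (θ.1 v)⁻¹

/-- By `spHom_tv_apply` the coefficient b must satisfy b + b²θ(v) = 0, which b = θ(v)⁻¹ solves. For
singular v the inverse is 0 and the transvection is the identity. -/
theorem otv_fix (θ : Omega m F t) (v : V m F) : spHom m F t (otv θ v) θ = θ := by
  refine omega_ext fun u => ?_
  rw [otv, spHom_tv_apply]
  by_cases h : θ.1 v = 0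
  · rw [h]; simp
  · have : (θ.1 v)⁻¹ + (θ.1 v)⁻¹ ^ 2 * θ.1 v = 0 := by
      rw [sq, mul_assoc, inv_mul_cancel₀ h, mul_one, add_self]
    rw [this, zero_mul, add_zero]

theorem otv_fix_shift_iff (θ : Omega m F t) {v c : V m F} (hv : θ.1 v ≠ 0)
    (hc : tr (θ.1 c) = 0) :
    spHom m F t (otv θ v) (shift θ c) = shift θ c ↔ sform c v = 0 := by
  rw [spHom_fix_shift_iff (otv_fix θ v) hc, otv, vecMul_tv, add_eq_left, smul_eq_zero,
    mul_eq_zero, or_iff_left, or_iff_right (inv_ne_zero hv)]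
  rintro rfl
  exact hv (omega_zero θ)

/-- A chain of transvections: each point is moved by a transvection which preserves `θ` and the
earlier points. -/
theorem irr_map_shift (θ : Omega m F t) (l : List (V m F × V m F))
    (H : Subgroup (Equiv.Perm (Omega m F t)))
    (hH : ∀ p ∈ l, spHom m F t (otv θ p.2) ∈ H)
    (hl : ∀ p ∈ l, tr (θ.1 p.1) = 0 ∧ θ.1 p.2 ≠ 0 ∧ sform p.1 p.2 ≠ 0)
    (hp : l.Pairwise fun p q => sform p.1 q.2 = 0) :
    Irr H (l.map fun p => shift θ p.1) := by
  induction l generalizing H with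
  | nil => trivial
  | cons p l ih =>
    rw [List.pairwise_cons] at hp
    have h1 := hl p List.mem_cons_self
    refine ⟨⟨_, hH p List.mem_cons_self, fun h => h1.2.2 ?_⟩, ih _ (fun q hq => ?_)
      (fun q hq => hl q (List.mem_cons_of_mem _ hq)) hp.2⟩
    · exact (otv_fix_shift_iff θ h1.2.1 h1.1).mp h
    · refine ⟨hH q (List.mem_cons_of_mem _ hq), ?_⟩
      exact (otv_fix_shift_iff θ (hl q (List.mem_cons_of_mem _ hq)).2.1 h1.1).mpr (hp.1 q hq)

/-- An isometry of a quadratic form which is trivial on a hyperplane `v^⊥` with `v` singular is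
trivial. -/
theorem eq_one_of_fix (i : Fin m) {x : symplecticGroup (Fin m) F} {θ : Omega m F t}
    (h : spHom m F t x θ = θ) (h0 : θ.1 (vec i 1 0) = 0) (hi : vec i 1 0 ᵥ* x.1 = vec i 1 0)
    (hj : ∀ j ≠ i, ∀ a b, vec j a b ᵥ* x.1 = vec j a b) : x = 1 := by
  have key : vec i 0 1 ᵥ* x.1 = vec i 0 1 := by
    set w := vec i 0 1 ᵥ* x.1 with hw
    have hwj : ∀ j ≠ i, ∀ a b, sform w (vec j a b) = 0 := fun j hji a b => by
      have := sform_vecMul x (vec i 0 1) (vec j a b)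
      rw [hj j hji] at this
      rw [hw, this, sform_vec_right, vec_inl, vec_inr, if_neg hji, if_neg hji]
      ring
    have hwi : w (Sum.inr i) = 1 := by
      have : sform w (vec i 1 0) = sform (vec i 0 1) (vec i 1 0) := by
        rw [hw, ← sform_vecMul x (vec i 0 1), hi]
      rw [sform_vec_right, sform_vec_right, vec_inr, if_pos rfl] at this
      simpa using this
    -- With e, f the i-th hyperbolic pair, the image w of f is orthogonal to the other planes and
    -- has φ(w, e) = φ(f, e), so w = f + λe. As θ(e) = 0, comparing θ(w) with θ(f) leaves λ = 0.
    have h1 : w = vec i (w (Sum.inl i)) 0 + vec i 0 1 := by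
      rw [vec_add_vec, add_zero, zero_add]
      ext k
      rcases k with k | k
      · rw [vec_inl]
        split_ifs with hk
        · rw [hk]
        · have := hwj k hk 0 1
          rw [sform_vec_right] at this
          simpa using this
      · rw [vec_inr]
        split_ifs with hk
        · rw [hk, hwi]
        · have := hwj k hk 1 0
          rw [sform_vec_right] at this
          simpa using this
    have h2 : θ.1 w = θ.1 (vec i 0 1) := by
      rw [hw, ← spHom_apply_apply, h]
    have h3 : vec i (w (Sum.inl i)) 0 = w (Sum.inl i) • vec i 1 0 := by
      rw [smul_vec, mul_one, mul_zero]
    rw [h1, h3, omega_add, omega_smul, h0, mul_zero, zero_add, sform_smul_left, sform_vec_right,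
      vec_inl, vec_inr, if_pos rfl, if_pos rfl] at h2
    have h4 : w (Sum.inl i) = 0 := by simpa using h2
    rw [h1, h4, vec_add_vec, add_zero, zero_add]
  have hall : ∀ j a b, vec j a b ᵥ* x.1 = vec j a b := fun j a b => by
    by_cases hji : j = i
    · subst hji
      have : vec j a b = a • vec j 1 0 + b • vec j 0 1 := by
        rw [smul_vec, smul_vec, vec_add_vec]
        simp
      rw [this, add_vecMul, smul_vecMul, smul_vecMul, hi, key]
    · exact hj j hji a b
  refine symplectic_ext fun u => ?_
  rw [vecMul_one_val]
  conv_lhs => rw [eq_sum_vec u, sum_vecMul]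
  conv_rhs => rw [eq_sum_vec u]
  exact Finset.sum_congr rfl fun j _ => hall _ _ _

end Action

/-! ### Transvections generate, and lie in the derived subgroup -/

section Generation

variable {m : ℕ} {F : Type*} [Field F] [Algebra (ZMod 2) F]

theorem vecMul_tv_add {u w : V m F} (h : sform u w ≠ 0) :
    u ᵥ* (tv (u + w) (sform u w)⁻¹).1 = w := by
  rw [vecMul_tv, sform_add_right, sform_self, zero_add, inv_mul_cancel₀ h, one_smul, ← add_assoc,
    vadd_self, zero_add]

variable (m F) in
/-- The group generated by the symplectic transvections. -/
def tvGroup : Subgroup (symplecticGroup (Fin m) F) :=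
  Subgroup.closure {x | ∃ v b, x = tv v b}

theorem tv_mem_tvGroup (v : V m F) (b : F) : tv v b ∈ tvGroup m F :=
  Subgroup.subset_closure ⟨v, b, rfl⟩

theorem vec_fix_of_sform {v : V m F} {j : Fin m} (b : F) (h : ∀ x y, sform v (vec j x y) = 0)
    (x y : F) : vec j x y ᵥ* (tv v b).1 = vec j x y :=
  vecMul_tv_of_sform_eq_zero b (by rw [sform_comm, h])

/-- The transvections fixing the hyperbolic pairs in `S` are transitive on the nonzero vectors
orthogonal to these. -/
theorem exists_mem_tvGroup_vecMul_eq (S : Finset (Fin m)) {u w : V m F} (hu : u ≠ 0) (hw : w ≠ 0)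
    (huS : ∀ j ∈ S, ∀ x y, sform u (vec j x y) = 0)
    (hwS : ∀ j ∈ S, ∀ x y, sform w (vec j x y) = 0) :
    ∃ h ∈ tvGroup m F, u ᵥ* h.1 = w ∧ ∀ j ∈ S, ∀ x y, vec j x y ᵥ* h.1 = vec j x y := by
  have step : ∀ u w : V m F, (∀ j ∈ S, ∀ x y, sform u (vec j x y) = 0) →
      (∀ j ∈ S, ∀ x y, sform w (vec j x y) = 0) → sform u w ≠ 0 →
      ∃ h ∈ tvGroup m F, u ᵥ* h.1 = w ∧ ∀ j ∈ S, ∀ x y, vec j x y ᵥ* h.1 = vec j x y := by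
    intro u w hu hw h
    refine ⟨_, tv_mem_tvGroup _ _, vecMul_tv_add h, fun j hj => vec_fix_of_sform _ fun x y => ?_⟩
    rw [sform_add_left, hu j hj, hw j hj, add_zero]
  have dual : ∀ u : V m F, u ≠ 0 → (∀ j ∈ S, ∀ x y, sform u (vec j x y) = 0) →
      ∃ z : V m F, sform u z ≠ 0 ∧ ∀ j ∈ S, ∀ x y, sform z (vec j x y) = 0 := by
    intro u hu huS
    obtain ⟨k, x, y, hk⟩ : ∃ k x y, sform u (vec k x y) ≠ 0 := by
      by_contra! hcon
      refine hu (eq_zero_of_sform_eq_zero fun z => ?_)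
      rw [sform_comm, eq_sum_vec z, ← sformLin_apply]
      have : ∀ s : Finset (Fin m), sform u (∑ i ∈ s, vec i (z (Sum.inl i)) (z (Sum.inr i))) = 0 :=
        fun s => by
          induction s using Finset.cons_induction with
          | empty => rw [Finset.sum_empty, sform_zero_right]
          | cons i s hi ih => rw [Finset.sum_cons, sform_add_right, ih, hcon, add_zero]
      exact this _
    refine ⟨vec k x y, hk, fun j hj x' y' => ?_⟩
    have hjk : j ≠ k := fun h => hk (h ▸ huS j hj x y)
    rw [sform_vec_right, vec_inl, vec_inr, if_neg hjk, if_neg hjk]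
    ring
  -- One transvection joins two vectors that are not orthogonal. In general u and w are joined
  -- through a z orthogonal to neither; one of z, z', z + z' always serves.
  have two : ∀ z : V m F, (∀ j ∈ S, ∀ x y, sform z (vec j x y) = 0) → sform u z ≠ 0 →
      sform w z ≠ 0 →
      ∃ h ∈ tvGroup m F, u ᵥ* h.1 = w ∧ ∀ j ∈ S, ∀ x y, vec j x y ᵥ* h.1 = vec j x y := by
    intro z hz h1 h2
    obtain ⟨g, hg, hg1, hg2⟩ := step u z huS hz h1
    obtain ⟨h, hh, hh1, hh2⟩ := step z w hz hwS (by rwa [sform_comm])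
    refine ⟨g * h, mul_mem hg hh, by rw [vecMul_mul_val, hg1, hh1], fun j hj x y => ?_⟩
    rw [vecMul_mul_val, hg2 j hj, hh2 j hj]
  obtain ⟨z, hz, hzS⟩ := dual u hu huS
  obtain ⟨z', hz', hzS'⟩ := dual w hw hwS
  by_cases h1 : sform w z = 0
  · by_cases h2 : sform u z' = 0
    · refine two (z + z') (fun j hj x y => ?_) ?_ ?_
      · rw [sform_add_left, hzS j hj, hzS' j hj, add_zero]
      · rwa [sform_add_right, h2, add_zero]
      · rwa [sform_add_right, h1, zero_add]
    · exact two z' hzS' h2 hz'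
  · exact two z hzS hz h1

theorem sform_vec_self (i : Fin m) (a b c d : F) :
    sform (vec i a b) (vec i c d) = b * c - a * d := by
  rw [sform_vec_right, vec_inl, vec_inr, if_pos rfl, if_pos rfl]

theorem sform_vec_of_ne {i j : Fin m} (h : i ≠ j) (a b c d : F) :
    sform (vec i a b) (vec j c d) = 0 := by
  rw [sform_vec_right, vec_inl, vec_inr, if_neg h.symm, if_neg h.symm]
  ring

/-- The symplectic group is generated by the transvections. -/
theorem mem_tvGroup (x : symplecticGroup (Fin m) F) : x ∈ tvGroup m F := by
  classical
  -- The matrix is multiplied by transvections until it fixes one more hyperbolic plane, keeping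
  -- those already fixed.
  have key : ∀ S : Finset (Fin m), ∃ h ∈ tvGroup m F, ∀ j ∈ S, ∀ a b,
      vec j a b ᵥ* (x * h).1 = vec j a b := by
    intro S
    induction S using Finset.cons_induction with
    | empty => exact ⟨1, one_mem _, by simp⟩
    | cons i S hi ih =>
      obtain ⟨h, hh, hS⟩ := ih
      have hne : ∀ j ∈ S, i ≠ j := fun j hj hij => hi (hij ▸ hj)
      have perp : ∀ y : symplecticGroup (Fin m) F,
          (∀ j ∈ S, ∀ a b, vec j a b ᵥ* y.1 = vec j a b) → ∀ p q, ∀ j ∈ S, ∀ a b,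
          sform (vec i p q ᵥ* y.1) (vec j a b) = 0 := fun y hy p q j hj a b => by
        rw [← hy j hj, sform_vecMul, sform_vec_of_ne (hne j hj)]
      obtain ⟨h1, hh1, h1i, h1S⟩ := exists_mem_tvGroup_vecMul_eq S
        (u := vec i 1 0 ᵥ* (x * h).1) (w := vec i 1 0)
        (fun h0 => vec_ne_zero_left i (x := (1 : F)) 0 one_ne_zero (by
          rw [← vecMul_inv_cancel (vec i 1 0) (x * h), h0, zero_vecMul]))
        (vec_ne_zero_left i 0 one_ne_zero) (perp _ hS 1 0)
        (fun j hj a b => sform_vec_of_ne (hne j hj) _ _ _ _)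
      set y := x * h * h1 with hy
      have yS : ∀ j ∈ S, ∀ a b, vec j a b ᵥ* y.1 = vec j a b := fun j hj a b => by
        rw [hy, vecMul_mul_val, hS j hj, h1S j hj]
      have yi : vec i 1 0 ᵥ* y.1 = vec i 1 0 := by rw [hy, vecMul_mul_val, h1i]
      set w := vec i 0 1 ᵥ* y.1 with hw
      have hwi : sform w (vec i 1 0) = 1 := by
        have := sform_vecMul y (vec i 0 1) (vec i 1 0)
        rw [yi, sform_vec_self] at this
        rw [hw, this]
        ring
      have hwS : ∀ j ∈ S, ∀ a b, sform w (vec j a b) = 0 := perp y yS 0 1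
      suffices H : ∃ h2 ∈ tvGroup m F, w ᵥ* h2.1 = vec i 0 1 ∧ vec i 1 0 ᵥ* h2.1 = vec i 1 0 ∧
          ∀ j ∈ S, ∀ a b, vec j a b ᵥ* h2.1 = vec j a b by
        obtain ⟨h2, hh2, h2w, h2i, h2S⟩ := H
        refine ⟨h * h1 * h2, mul_mem (mul_mem hh hh1) hh2, fun j hj a b => ?_⟩
        have e : x * (h * h1 * h2) = y * h2 := by rw [hy]; simp only [mul_assoc]
        rw [e, vecMul_mul_val]
        rcases Finset.mem_cons.mp hj with rfl | hj
        · have : vec j a b = a • vec j 1 0 + b • vec j 0 1 := by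
            rw [smul_vec, smul_vec, vec_add_vec]
            simp
          rw [this, add_vecMul, add_vecMul, smul_vecMul, smul_vecMul, smul_vecMul, smul_vecMul, yi,
            h2i, ← hw, h2w]
        · rw [yS j hj, h2S j hj]
      have step : ∀ w : V m F, sform w (vec i 1 0) = 1 →
          (∀ j ∈ S, ∀ a b, sform w (vec j a b) = 0) → sform w (vec i 0 1) ≠ 0 →
          ∃ h2 ∈ tvGroup m F, w ᵥ* h2.1 = vec i 0 1 ∧ vec i 1 0 ᵥ* h2.1 = vec i 1 0 ∧
          ∀ j ∈ S, ∀ a b, vec j a b ᵥ* h2.1 = vec j a b := by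
        intro w hwi hwS h0
        refine ⟨_, tv_mem_tvGroup _ _, vecMul_tv_add h0, vecMul_tv_of_sform_eq_zero _ ?_,
          fun j hj => vec_fix_of_sform _ fun a b => ?_⟩
        · rw [sform_comm, sform_add_left, hwi, sform_vec_self]
          linear_combination add_self (1 : F)
        · rw [sform_add_left, hwS j hj, sform_vec_of_ne (hne j hj), add_zero]
      -- A transvection moving w to f and fixing e exists when φ(w, f) ≠ 0. If φ(w, f) = 0, w is
      -- first replaced by w + e by means of the transvection with centre e.
      by_cases h0 : sform w (vec i 0 1) = 0
      · obtain ⟨h2, hh2, h2w, h2i, h2S⟩ := step (w + vec i 1 0)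
          (by rw [sform_add_left, hwi, sform_self, add_zero])
          (fun j hj a b => by
            rw [sform_add_left, hwS j hj, sform_vec_of_ne (hne j hj), add_zero])
          (by
            rw [sform_add_left, h0, sform_vec_self]
            simp)
        refine ⟨tv (vec i 1 0) 1 * h2, mul_mem (tv_mem_tvGroup _ _) hh2, ?_, ?_,
          fun j hj a b => ?_⟩
        · rw [vecMul_mul_val, vecMul_tv, hwi, one_mul, one_smul, h2w]
        · rw [vecMul_mul_val, vecMul_tv_of_sform_eq_zero _ (sform_self _), h2i]
        · rw [vecMul_mul_val, vecMul_tv_of_sform_eq_zero _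
            (sform_vec_of_ne (hne j hj).symm _ _ _ _),
            h2S j hj]
      · exact step w hwi hwS h0
  obtain ⟨h, hh, hx⟩ := key Finset.univ
  have : x * h = 1 := symplectic_ext fun u => by
    rw [vecMul_one_val]
    conv_lhs => rw [eq_sum_vec u, sum_vecMul]
    conv_rhs => rw [eq_sum_vec u]
    exact Finset.sum_congr rfl fun j hj => hx j hj _ _
  rw [eq_inv_of_mul_eq_one_left this]
  exact inv_mem hh

theorem tv_conj (v : V m F) (b : F) (h : symplecticGroup (Fin m) F) :
    tv (v ᵥ* h.1) b = h⁻¹ * tv v b * h := by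
  refine symplectic_ext fun u => ?_
  rw [vecMul_mul_val, vecMul_mul_val, vecMul_tv, vecMul_tv, add_vecMul, smul_vecMul,
    vecMul_inv_cancel']
  congr 3
  rw [← sform_vecMul h (u ᵥ* (h⁻¹).1), vecMul_inv_cancel']

theorem tv_add (v : V m F) (b c : F) : tv v (b + c) = tv v b * tv v c := by
  refine symplectic_ext fun u => ?_
  rw [vecMul_mul_val, vecMul_tv, vecMul_tv, vecMul_tv, sform_add_left, sform_smul_left, sform_self]
  module

theorem tv_smul (v : V m F) (b c : F) : tv (c • v) b = tv v (c ^ 2 * b) := by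
  refine symplectic_ext fun u => ?_
  rw [vecMul_tv, vecMul_tv, sform_smul_right, smul_smul]
  congr 2
  ring

theorem tv_zero (b : F) : tv (0 : V m F) b = 1 := by
  refine symplectic_ext fun u => ?_
  rw [vecMul_tv, smul_zero, add_zero, vecMul_one_val]

theorem tv_zero_right (v : V m F) : tv v 0 = 1 := by
  refine symplectic_ext fun u => ?_
  rw [vecMul_tv, zero_mul, zero_smul, add_zero, vecMul_one_val]

/-- Transvections with equal coefficient are conjugate, because the group is transitive on nonzero
vectors. -/
theorem abelianization_tv_eq {u w : V m F} (hu : u ≠ 0) (hw : w ≠ 0) (b : F) :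
    Abelianization.of (tv u b) = Abelianization.of (tv w b) := by
  obtain ⟨h, -, h1, -⟩ := exists_mem_tvGroup_vecMul_eq ∅ hu hw (by simp) (by simp)
  rw [← h1, tv_conj, map_mul, map_mul, mul_comm, ← mul_assoc, ← map_mul, mul_inv_cancel, map_one,
    one_mul]

theorem mem_commutator_iff {x : symplecticGroup (Fin m) F} :
    x ∈ commutator (symplecticGroup (Fin m) F) ↔ Abelianization.of x = 1 := by
  rw [← MonoidHom.mem_ker, Abelianization.ker_of]

/-- The transvections lie in the derived subgroup if the field has more than two elements. -/
theorem tv_mem_commutator_of_ne {c : F} (h0 : c ≠ 0) (h1 : c ≠ 1) (v : V m F) (b : F) :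
    tv v b ∈ commutator (symplecticGroup (Fin m) F) := by
  by_cases hv : v = 0
  · rw [hv, tv_zero]
    exact one_mem _
  rw [mem_commutator_iff]
  have hc : 1 + c ^ 2 ≠ 0 := fun h => h1 (sq_injective (by
    rw [← eq_of_add_eq_zero h, one_pow]))
  -- In the abelianization, coefficients b' and c²b' give the same element. Writing b = b' + c²b'
  -- makes the class of `tv v b` a square of the class of an involution.
  have key := abelianization_tv_eq hv (smul_ne_zero h0 hv) ((1 + c ^ 2)⁻¹ * b)
  rw [tv_smul] at key
  have e : b = (1 + c ^ 2)⁻¹ * b + c ^ 2 * ((1 + c ^ 2)⁻¹ * b) := by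
    field_simp
  rw [e, tv_add, map_mul, ← key, ← map_mul, tv_mul_self, map_one]

/-- The transvections lie in the derived subgroup if the dimension is at least six. -/
theorem tv_mem_commutator_of_three_le (hm : 3 ≤ m) (hF : ∀ x : F, x = 0 ∨ x = 1) (v : V m F)
    (b : F) : tv v b ∈ commutator (symplecticGroup (Fin m) F) := by
  rcases hF b with rfl | rfl
  · rw [tv_zero_right]
    exact one_mem _
  by_cases hv : v = 0
  · rw [hv, tv_zero]
    exact one_mem _
  rw [mem_commutator_iff]
  let i : Fin m := ⟨0, by omega⟩
  let j : Fin m := ⟨1, by omega⟩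
  let k : Fin m := ⟨2, by omega⟩
  have hij : i ≠ j := by simp [i, j, Fin.ext_iff]
  have hik : i ≠ k := by simp [i, k, Fin.ext_iff]
  have hjk : j ≠ k := by simp [j, k, Fin.ext_iff]
  -- The seven centres are the nonzero vectors over the field with two elements of a totally
  -- isotropic 3-space. Their transvections commute, and each term of the product occurs an even
  -- number of times. All seven have the same class T with T² = 1, so T = T⁷ = 1.
  have hprod : tv (vec i 1 0) (1 : F) * tv (vec j 1 0) 1 * tv (vec k 1 0) 1 *
      tv (vec i 1 0 + vec j 1 0) 1 * tv (vec i 1 0 + vec k 1 0) 1 *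
      tv (vec j 1 0 + vec k 1 0) 1 * tv (vec i 1 0 + vec j 1 0 + vec k 1 0) 1 = 1 := by
    refine symplectic_ext fun u => ?_
    simp only [vecMul_mul_val, vecMul_tv, sform_add_left, sform_add_right, sform_smul_left,
      sform_self, sform_vec_of_ne hij, sform_vec_of_ne hik, sform_vec_of_ne hjk,
      sform_vec_of_ne hij.symm, sform_vec_of_ne hik.symm, sform_vec_of_ne hjk.symm, mul_zero,
      add_zero, one_mul, vecMul_one_val]
    ext l
    simp only [Pi.add_apply, Pi.smul_apply, smul_eq_mul]
    generalize sform u (vec i 1 0) = A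
    generalize sform u (vec j 1 0) = B
    generalize sform u (vec k 1 0) = C
    linear_combination ((2 * A + B + C) * vec i 1 0 l + (A + 2 * B + C) * vec j 1 0 l +
      (A + B + 2 * C) * vec k 1 0 l) * add_self (1 : F)
  have hone := fun w (hw : w ≠ 0) => abelianization_tv_eq (u := w) (w := v) hw hv (1 : F)
  have hi : ∀ w : V m F, w (Sum.inl i) = 1 → w ≠ 0 := fun w hw h => by
    rw [h] at hw
    exact zero_ne_one hw
  have hj : ∀ w : V m F, w (Sum.inl j) = 1 → w ≠ 0 := fun w hw h => by
    rw [h] at hw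
    exact zero_ne_one hw
  have e := congrArg Abelianization.of hprod
  have hsq : Abelianization.of (tv v (1 : F)) * Abelianization.of (tv v 1) = 1 := by
    rw [← map_mul, tv_mul_self, map_one]
  simp only [map_mul] at e
  rw [hone _ (vec_ne_zero_left i 0 one_ne_zero), hone _ (vec_ne_zero_left j 0 one_ne_zero),
    hone _ (vec_ne_zero_left k 0 one_ne_zero),
    hone _ (hi (vec i 1 0 + vec j 1 0) (by simp [vec_inl, hij])),
    hone _ (hi (vec i 1 0 + vec k 1 0) (by simp [vec_inl, hik])),
    hone _ (hj (vec j 1 0 + vec k 1 0) (by simp [vec_inl, hjk])),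
    hone _ (hi (vec i 1 0 + vec j 1 0 + vec k 1 0) (by simp [vec_inl, hij, hik])),
    map_one] at e
  simpa only [hsq, one_mul, mul_one] using e

end Generation

/-! ### Traces and small finite fields -/

section Field

variable {F : Type*} [Field F] [Algebra (ZMod 2) F] [Finite F] {f : ℕ}

theorem tr_eq_zero_or (x : F) : tr x = 0 ∨ tr x = 1 := by
  generalize tr x = y
  revert y
  decide

theorem finrank_eq (hF : Nat.card F = 2 ^ f) : Module.finrank (ZMod 2) F = f := by
  have := Module.natCard_eq_pow_finrank (K := ZMod 2) (V := F)
  rw [hF, Nat.card_zmod] at this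
  exact (Nat.pow_right_injective le_rfl this).symm

theorem tr_one (hF : Nat.card F = 2 ^ f) : tr (1 : F) = f := by
  have := Algebra.trace_algebraMap (R := ZMod 2) (S := F) 1
  rw [map_one, finrank_eq hF, nsmul_one] at this
  exact this

theorem eq_zero_or_one (hF : Nat.card F = 2 ^ 1) (x : F) : x = 0 ∨ x = 1 := by
  have := Fintype.ofFinite F
  classical
  by_contra! h
  have h2 : ({0, 1, x} : Finset F).card ≤ 2 := by
    rw [← pow_one 2, ← hF, Nat.card_eq_fintype_card]
    exact Finset.card_le_univ _
  rw [Finset.card_eq_three.mpr ⟨0, 1, x, zero_ne_one, h.1.symm, h.2.symm, rfl⟩] at h2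
  omega

theorem exists_ne_zero_ker (hF : Nat.card F = 2 ^ f) {A : Type*} [AddGroup A] [Finite A]
    (hA : Nat.card A < 2 ^ f) (φ : F →+ A) : ∃ x, x ≠ 0 ∧ φ x = 0 := by
  by_contra! h
  have hinj : Function.Injective φ := (injective_iff_map_eq_zero φ).mpr fun x hx => by
    by_contra h0
    exact h x h0 hx
  have := Nat.card_le_card_of_injective φ hinj
  omega

theorem exists_ne_zero_tr_eq_zero (hF : Nat.card F = 2 ^ f) (hf : 2 ≤ f) :
    ∃ x : F, x ≠ 0 ∧ tr x = 0 := by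
  refine exists_ne_zero_ker hF (A := ZMod 2) ?_ (Algebra.trace (ZMod 2) F).toAddMonoidHom
  rw [Nat.card_zmod]
  calc 2 < 2 ^ 2 := by norm_num
    _ ≤ 2 ^ f := Nat.pow_le_pow_right two_pos hf

theorem exists_ne_zero_tr_eq_zero_two (hF : Nat.card F = 2 ^ f) (hf : 3 ≤ f) (c : F) :
    ∃ x : F, x ≠ 0 ∧ tr x = 0 ∧ tr (c * x) = 0 := by
  obtain ⟨x, hx, h⟩ := exists_ne_zero_ker hF (A := ZMod 2 × ZMod 2) (by
    rw [Nat.card_prod, Nat.card_zmod]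
    calc 2 * 2 < 2 ^ 3 := by norm_num
      _ ≤ 2 ^ f := Nat.pow_le_pow_right two_pos hf)
    ((Algebra.trace (ZMod 2) F).toAddMonoidHom.prod
      ((Algebra.trace (ZMod 2) F).toAddMonoidHom.comp (AddMonoidHom.mulLeft c)))
  exact ⟨x, hx, (Prod.ext_iff.mp h).1, (Prod.ext_iff.mp h).2⟩

theorem exists_not_mem_of_card {f : ℕ} (hF : Nat.card F = 2 ^ f) (S : Finset F)
    (hS : S.card < 2 ^ f) : ∃ x, x ∉ S := by
  have := Fintype.ofFinite F
  by_contra! h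
  rw [Finset.eq_univ_iff_forall.mpr h, Finset.card_univ, ← Nat.card_eq_fintype_card, hF] at hS
  exact lt_irrefl _ hS

theorem exists_ne_zero_ne_one (hF : Nat.card F = 2 ^ f) (hf : 2 ≤ f) :
    ∃ x : F, x ≠ 0 ∧ x ≠ 1 := by
  classical
  obtain ⟨x, hx⟩ := exists_not_mem_of_card hF {0, 1} (lt_of_le_of_lt Finset.card_le_two
    (calc 2 < 2 ^ 2 := by norm_num
      _ ≤ 2 ^ f := Nat.pow_le_pow_right two_pos hf))
  simp only [Finset.mem_insert, Finset.mem_singleton, not_or] at hx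
  exact ⟨x, hx⟩

variable (F) in
-- A generator of the cyclic multiplicative group determines every field automorphism by its image.
theorem exists_generator :
    ∃ x : F, x ≠ 0 ∧ ∀ σ : F ≃ₐ[ZMod 2] F, σ x = x → σ = 1 := by
  obtain ⟨g, hg⟩ := IsCyclic.exists_generator (α := Fˣ)
  refine ⟨g, g.ne_zero, fun σ h => AlgEquiv.ext fun x => ?_⟩
  by_cases hx : x = 0
  · simp [hx]
  · obtain ⟨n, hn⟩ := Subgroup.mem_zpowers_iff.mp (hg (Units.mk0 x hx))
    have : x = (g : F) ^ n := by
      rw [← Units.val_zpow_eq_zpow_val, hn, Units.val_mk0]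
    rw [this, map_zpow₀, h]
    rfl

/-- Additive Hilbert 90: x ↦ x + x² has kernel {0, 1} and image inside the kernel of the trace. Both
have index two, so they coincide. -/
theorem exists_sq_add_self_eq {y : F} (hy : tr y = 0) : ∃ x : F, x + x ^ 2 = y := by
  have := charTwo F
  let p : F →+ F := AddMonoidHom.mk' (fun x => x + x ^ 2) fun x y => by
    rw [CharTwo.add_sq]
    ring
  let T : F →+ ZMod 2 := (Algebra.trace (ZMod 2) F).toAddMonoidHom
  have hle : p.range ≤ T.ker := by
    rintro _ ⟨x, rfl⟩
    change tr (x + x ^ 2) = 0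
    rw [tr_add, tr_sq]
    generalize tr x = z
    revert z
    decide
  have hker : Nat.card p.ker = 2 := by
    have h : (p.ker : Set F) = {0, 1} := by
      ext x
      simp only [SetLike.mem_coe, AddMonoidHom.mem_ker, Set.mem_insert_iff, Set.mem_singleton_iff]
      change x + x ^ 2 = 0 ↔ _
      constructor
      · intro h
        have : x * (x - 1) = 0 := by linear_combination h - x * add_self (1 : F)
        rcases mul_eq_zero.mp this with h | h
        · exact Or.inl h
        · exact Or.inr (sub_eq_zero.mp h)
      · rintro (rfl | rfl)
        · simp
        · rw [one_pow, add_self]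
    have := Set.ncard_pair (zero_ne_one (α := F))
    rw [← h] at this
    exact this
  have hT : Nat.card T.range = 2 := by
    have : T.range = ⊤ := by
      rw [AddMonoidHom.range_eq_top]
      intro z
      obtain ⟨y, hy⟩ := exists_tr_mul (1 : F) one_ne_zero
      have h2 : ∀ z : ZMod 2, z = 0 ∨ z = 1 := by decide
      rcases h2 z with rfl | rfl
      · exact ⟨0, map_zero _⟩
      · exact ⟨_, hy⟩
    rw [this, AddSubgroup.card_top, Nat.card_zmod]
  have h1 := AddSubgroup.card_mul_index p.ker
  have h2 := AddSubgroup.card_mul_index T.ker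
  rw [AddSubgroup.index_ker] at h1 h2
  have heq : p.range = T.ker := AddSubgroup.eq_of_le_of_card_ge hle (by
    rw [hker] at h1
    rw [hT] at h2
    omega)
  have : y ∈ p.range := heq ▸ hy
  exact this

end Field

/-! ### Not IBIS for q ≥ 4 and m ≥ 2 -/

section Planes

variable {m : ℕ} {F : Type*} [Field F] [Algebra (ZMod 2) F] [Finite F] {t : ZMod 2} {f : ℕ}

theorem tr_add_sq (s : F) : tr (s + s ^ 2) = 0 := by
  rw [tr_add, tr_sq]
  generalize tr s = z
  revert z
  decide

theorem left_ne_zero_of_tr {a b : F} (h : tr (a * b) = 1) : a ≠ 0 := by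
  rintro rfl
  rw [zero_mul, tr_zero] at h
  exact zero_ne_one h

theorem right_ne_zero_of_tr {a b : F} (h : tr (a * b) = 1) : b ≠ 0 := by
  rw [mul_comm] at h
  exact left_ne_zero_of_tr h

theorem thetaPt_vec (j : Fin m) {a b : F} (h : tr (theta0 (vec j a b)) = t) (x y : F) :
    (thetaPt (vec j a b) h).1 (vec j x y) = x * y + (y * a - x * b) ^ 2 := by
  rw [thetaPt_apply, theta0_vec, sform_vec_self]

theorem thetaPt_vec_of_ne {i j : Fin m} (hij : i ≠ j) {a b : F}
    (h : tr (theta0 (vec j a b)) = t) (x y : F) :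
    (thetaPt (vec j a b) h).1 (vec i x y) = x * y := by
  rw [thetaPt_apply, theta0_vec, sform_vec_of_ne hij, zero_pow two_ne_zero, add_zero]

/-- The binary quadratic form `x y + (y a - x b) ^ 2` is anisotropic if `a b` has trace one. -/
theorem eq_zero_of_anisotropic {a b : F} (h : tr (a * b) = 1) {x y : F}
    (hxy : x * y + (y * a - x * b) ^ 2 = 0) : x = 0 ∧ y = 0 := by
  by_cases hx : x = 0
  · subst hx
    refine ⟨rfl, ?_⟩
    have h1 : (y * a) ^ 2 = 0 := by linear_combination hxy
    exact (mul_eq_zero.mp (pow_eq_zero_iff two_ne_zero |>.mp h1)).resolve_right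
      (left_ne_zero_of_tr h)
  · exfalso
    -- A zero with x ≠ 0 would present ab as s + s² with this s, so ab would have trace zero.
    have h1 := tr_add_sq (a * (y * a - x * b) / x)
    have e : a * (y * a - x * b) / x + (a * (y * a - x * b) / x) ^ 2 = a * b := by
      field_simp
      linear_combination a ^ 2 * hxy - a * x ^ 2 * b * add_self (1 : F)
    rw [e, h] at h1
    exact one_ne_zero h1

theorem exists_type (t : ZMod 2) :
    ∃ a b : F, tr (a * b) = t ∧ ((a = 0 ∧ b = 0) ∨ tr (a * b) = 1) := by
  have h2 : ∀ t : ZMod 2, t = 0 ∨ t = 1 := by decide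
  rcases h2 t with rfl | rfl
  · exact ⟨0, 0, by rw [mul_zero, tr_zero], Or.inl ⟨rfl, rfl⟩⟩
  · obtain ⟨y, hy⟩ := exists_tr_mul (1 : F) one_ne_zero
    exact ⟨y, 1, hy, Or.inr hy⟩

theorem exists_smul_eq {θ : Omega m F t} {v : V m F} (hv : θ.1 v ≠ 0) {d : F} (hd : d ≠ 0) :
    ∃ c : F, c ≠ 0 ∧ θ.1 (c • v) = d := by
  obtain ⟨c, hc⟩ := exists_sq_eq (d / θ.1 v)
  refine ⟨c, ?_, ?_⟩
  · rintro rfl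
    rw [zero_pow two_ne_zero] at hc
    exact div_ne_zero hd hv hc.symm
  · rw [omega_smul, hc, div_mul_cancel₀ _ hv]

theorem exists_smul_tr_eq_zero (hF : Nat.card F = 2 ^ f) (hf : 2 ≤ f) (θ : Omega m F t)
    (v : V m F) : ∃ c : F, c ≠ 0 ∧ tr (θ.1 (c • v)) = 0 := by
  by_cases hv : θ.1 v = 0
  · exact ⟨1, one_ne_zero, by rw [one_smul, hv, tr_zero]⟩
  · obtain ⟨d, hd, hd'⟩ := exists_ne_zero_tr_eq_zero hF hf
    obtain ⟨c, hc, h⟩ := exists_smul_eq hv hd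
    exact ⟨c, hc, by rw [h, hd']⟩

theorem eq_of_card_four (hF : Nat.card F = 2 ^ 2) {z : F} (h0 : z ≠ 0) (h1 : z ≠ 1) :
    z ^ 2 + z + 1 = 0 ∧ ∀ x : F, x = 0 ∨ x = 1 ∨ x = z ∨ x = z + 1 := by
  have := Fintype.ofFinite F
  have h4 : ∀ x : F, x ^ 4 = x := fun x => by
    have := FiniteField.pow_card x
    rwa [← Nat.card_eq_fintype_card, hF] at this
  have hz : z ^ 2 + z + 1 = 0 := by
    have : z * ((z - 1) * (z ^ 2 + z + 1)) = 0 := by linear_combination h4 z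
    exact ((mul_eq_zero.mp this).resolve_left h0 |> mul_eq_zero.mp).resolve_left
      (sub_ne_zero.mpr h1)
  refine ⟨hz, fun x => ?_⟩
  have : x * ((x - 1) * ((x - z) * (x - (z + 1)))) = 0 := by
    linear_combination h4 x + (x ^ 2 - x) * hz - (x ^ 2 - x) * (z * x + x + 1) * add_self (1 : F)
  simpa [sub_eq_zero] using this

theorem eq_one_of_card_four (hF : Nat.card F = 2 ^ 2) {z : F} (h0 : z ≠ 0) (h1 : z ≠ 1)
    {σ : F ≃ₐ[ZMod 2] F} (hσ : σ z = z) : σ = 1 := by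
  refine AlgEquiv.ext fun x => ?_
  rcases (eq_of_card_four hF h0 h1).2 x with rfl | rfl | rfl | rfl <;> simp [hσ]

/-- Two vectors of a plane on which no nontrivial field automorphism can preserve the values of
the form. -/
theorem exists_plane_base (hF : Nat.card F = 2 ^ f) (hf : 2 ≤ f) (j : Fin m) {a b : F}
    (hab : (a = 0 ∧ b = 0) ∨ tr (a * b) = 1) (ht : tr (theta0 (vec j a b)) = t) :
    ∃ x y x' y' : F, y * x' - x * y' ≠ 0 ∧ tr ((thetaPt (vec j a b) ht).1 (vec j x y)) = 0 ∧
      tr ((thetaPt (vec j a b) ht).1 (vec j x' y')) = 0 ∧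
      ∀ σ : F ≃ₐ[ZMod 2] F,
        σ ((thetaPt (vec j a b) ht).1 (vec j x y)) = (thetaPt (vec j a b) ht).1 (vec j x y) →
        σ ((thetaPt (vec j a b) ht).1 (vec j x' y')) = (thetaPt (vec j a b) ht).1 (vec j x' y') →
        σ (y * x' - x * y') = y * x' - x * y' → σ = 1 := by
  simp only [thetaPt_vec]
  rcases hab with ⟨rfl, rfl⟩ | hab
  · obtain ⟨g, hg, hσ⟩ := exists_generator F
    refine ⟨0, g, 1, 0, by simpa using hg, by simp, by simp, fun σ _ _ h => hσ σ ?_⟩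
    simpa using h
  · have ha := left_ne_zero_of_tr hab
    have hb := right_ne_zero_of_tr hab
    -- In the anisotropic plane with q ≥ 8, take one vector on each coordinate axis with values d
    -- and gd, both of trace zero. An automorphism fixing both values fixes their quotient, the
    -- generator g. For q = 4 both values are 1, and it is φ of the two vectors, the inverse of ab,
    -- that generates the field.
    rcases Nat.lt_or_ge 2 f with hf3 | hf2
    · obtain ⟨g, hg, hσ⟩ := exists_generator F
      obtain ⟨d, hd, hd1, hd2⟩ := exists_ne_zero_tr_eq_zero_two hF hf3 g
      obtain ⟨p, hp⟩ := exists_sq_eq (d / b ^ 2)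
      obtain ⟨q, hq⟩ := exists_sq_eq (g * d / a ^ 2)
      have e1 : (p * b) ^ 2 = d := by
        rw [mul_pow, hp, div_mul_cancel₀ _ (pow_ne_zero 2 hb)]
      have e2 : (q * a) ^ 2 = g * d := by
        rw [mul_pow, hq, div_mul_cancel₀ _ (pow_ne_zero 2 ha)]
      have hp0 : p ≠ 0 := by
        rintro rfl
        rw [zero_mul, zero_pow two_ne_zero] at e1
        exact hd e1.symm
      have hq0 : q ≠ 0 := by
        rintro rfl
        rw [zero_mul, zero_pow two_ne_zero] at e2
        exact mul_ne_zero hg hd e2.symm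
      have e1' : p * 0 + (0 * a - p * b) ^ 2 = d := by rw [← e1]; ring
      have e2' : 0 * q + (q * a - 0 * b) ^ 2 = g * d := by rw [← e2]; ring
      refine ⟨p, 0, 0, q, by simp [hp0, hq0], by rw [e1', hd1], by rw [e2', hd2],
        fun σ h1 h2 _ => hσ σ ?_⟩
      rw [e1'] at h1
      rw [e2', map_mul, h1] at h2
      exact mul_right_cancel₀ hd h2
    · obtain rfl : f = 2 := le_antisymm hf2 hf
      have h1 : tr (1 : F) = 0 := by
        rw [tr_one hF]
        decide
      have e1 : b⁻¹ * 0 + (0 * a - b⁻¹ * b) ^ 2 = 1 := by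
        rw [inv_mul_cancel₀ hb]
        ring
      have e2 : 0 * a⁻¹ + (a⁻¹ * a - 0 * b) ^ 2 = 1 := by
        rw [inv_mul_cancel₀ ha]
        ring
      refine ⟨b⁻¹, 0, 0, a⁻¹, by simp [ha, hb], by rw [e1, h1], by rw [e2, h1],
        fun σ _ _ h => ?_⟩
      have hσ : σ (a * b) = a * b := by
        have e : 0 * 0 - b⁻¹ * a⁻¹ = - (a * b)⁻¹ := by
          rw [mul_inv]
          ring
        rw [e, map_neg, map_inv₀] at h
        exact inv_injective (neg_injective h)
      have h0 : a * b ≠ 0 := mul_ne_zero ha hb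
      -- Here Tr 1 = 0 because f = 2, whereas Tr(ab) = 1.
      have hne1 : a * b ≠ 1 := fun h => by
        rw [h, h1] at hab
        exact zero_ne_one hab
      exact eq_one_of_card_four hF h0 hne1 hσ

/-- Points which determine a pair of nonsingular vectors: the two vectors are scaled to have
trace zero. -/
theorem exists_plane_chain (hF : Nat.card F = 2 ^ f) (hf : 2 ≤ f) {θ : Omega m F t} {v w : V m F}
    (hv : θ.1 v ≠ 0) (hw : θ.1 w ≠ 0) :
    ∃ p q : F, p ≠ 0 ∧ q ≠ 0 ∧ tr (θ.1 (p • v)) = 0 ∧ tr (θ.1 (q • w)) = 0 ∧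
      θ.1 (p • v) ≠ 0 ∧ θ.1 (q • w) ≠ 0 := by
  obtain ⟨p, hp, hp'⟩ := exists_smul_tr_eq_zero hF hf θ v
  obtain ⟨q, hq, hq'⟩ := exists_smul_tr_eq_zero hF hf θ w
  refine ⟨p, q, hp, hq, hp', hq', ?_, ?_⟩
  · rw [omega_smul]
    exact mul_ne_zero (pow_ne_zero 2 hp) hv
  · rw [omega_smul]
    exact mul_ne_zero (pow_ne_zero 2 hq) hw

/-- The point `θ` and the points given by the hyperbolic pairs with index in `S`. -/
def pairPoints (θ : Omega m F t) (S : Finset (Fin m)) : List (Omega m F t) :=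
  θ :: S.toList.flatMap fun k => [shift θ (vec k 1 0), shift θ (vec k 0 1)]

theorem fix_pairPoints_iff {θ : Omega m F t} {S : Finset (Fin m)} {g : Equiv.Perm (Omega m F t)} :
    (∀ a ∈ pairPoints θ S, g a = a) ↔ g θ = θ ∧
      ∀ k ∈ S, g (shift θ (vec k 1 0)) = shift θ (vec k 1 0) ∧
        g (shift θ (vec k 0 1)) = shift θ (vec k 0 1) := by
  simp only [pairPoints, List.mem_cons, List.mem_flatMap, Finset.mem_toList, List.not_mem_nil,
    or_false, forall_eq_or_imp, forall_exists_index, and_imp, and_congr_right_iff]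
  intro _
  constructor
  · intro h k hk
    exact ⟨h _ k hk (Or.inl rfl), h _ k hk (Or.inr rfl)⟩
  · rintro h a k hk (rfl | rfl)
    · exact (h k hk).1
    · exact (h k hk).2

theorem otv_mem_listStab_pairPoints {θ : Omega m F t} {S : Finset (Fin m)}
    (hS : ∀ k ∈ S, θ.1 (vec k 1 0) = 0 ∧ θ.1 (vec k 0 1) = 0)
    {G : Subgroup (Equiv.Perm (Omega m F t))} (hG : ∀ v b, spHom m F t (tv v b) ∈ G)
    {v : V m F} (hv : θ.1 v ≠ 0) (hvS : ∀ k ∈ S, ∀ a b, sform (vec k a b) v = 0) :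
    spHom m F t (otv θ v) ∈ listStab G (pairPoints θ S) := by
  rw [mem_listStab]
  refine ⟨hG _ _, fix_pairPoints_iff.mpr ⟨otv_fix _ _, fun k hk => ⟨?_, ?_⟩⟩⟩
  · rw [otv_fix_shift_iff θ hv (by rw [(hS k hk).1, tr_zero])]
    exact hvS k hk _ _
  · rw [otv_fix_shift_iff θ hv (by rw [(hS k hk).2, tr_zero])]
    exact hvS k hk _ _

theorem vecMul_vec_of_fix {x : symplecticGroup (Fin m) F} {k : Fin m}
    {p q p' q' : F} (hd : q * p' - p * q' ≠ 0) (h1 : vec k p q ᵥ* x.1 = vec k p q)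
    (h2 : vec k p' q' ᵥ* x.1 = vec k p' q') (a b : F) : vec k a b ᵥ* x.1 = vec k a b := by
  have e : vec k a b = ((b * p' - a * q') / (q * p' - p * q')) • vec k p q +
      ((a * q - b * p) / (q * p' - p * q')) • vec k p' q' := by
    rw [smul_vec, smul_vec, vec_add_vec]
    congr 1 <;> rw [div_mul_eq_mul_div, div_mul_eq_mul_div, ← add_div, eq_div_iff hd] <;> ring
  rw [e, add_vecMul, smul_vecMul, smul_vecMul, h1, h2]

theorem vecMul_vec_of_fix_pairPoints {x : symplecticGroup (Fin m) F} {θ : Omega m F t}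
    {S : Finset (Fin m)} (hS : ∀ k ∈ S, θ.1 (vec k 1 0) = 0 ∧ θ.1 (vec k 0 1) = 0)
    (h : ∀ a ∈ pairPoints θ S, spHom m F t x a = a) {k : Fin m} (hk : k ∈ S) (a b : F) :
    vec k a b ᵥ* x.1 = vec k a b := by
  obtain ⟨h0, h1⟩ := fix_pairPoints_iff.mp h
  refine vecMul_vec_of_fix (p := 1) (q := 0) (p' := 0) (q' := 1) (by simp) ?_ ?_ a b
  · exact (spHom_fix_shift_iff h0 (by rw [(hS k hk).1, tr_zero])).mp (h1 k hk).1
  · exact (spHom_fix_shift_iff h0 (by rw [(hS k hk).2, tr_zero])).mp (h1 k hk).2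

/-- The form is hyperbolic off the plane j, which carries the type. After freezing all planes but i
and j, two points from plane j kill the field automorphism and the action on j, and one singular
vector of plane i finishes by `eq_one_of_fix`. A chain of transvections gets two steps from each of
the two planes, hence four. -/
theorem not_isIBIS_of_two_le (hm : 2 ≤ m) (hF : Nat.card F = 2 ^ f) (hf : 2 ≤ f)
    (G : Subgroup (Equiv.Perm (Omega m F t))) (hG : ∀ v b, spHom m F t (tv v b) ∈ G)
    (hGamma : G ≤ gammaSpPerms m F t) : ¬ IsIBIS G := by
  classical
  obtain ⟨a, b, hab, htype⟩ := exists_type (F := F) t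
  obtain ⟨i, j, hij⟩ : ∃ i j : Fin m, i ≠ j :=
    ⟨⟨0, by omega⟩, ⟨1, by omega⟩, by simp [Fin.ext_iff]⟩
  have ht : tr (theta0 (vec j a b)) = t := by rw [theta0_vec, hab]
  obtain ⟨x, y, x', y', hd, hx, hx', hσ⟩ := exists_plane_base hF hf j htype ht
  generalize hθ : thetaPt (vec j a b) ht = θ at hx hx' hσ
  obtain ⟨S, hSmem⟩ : ∃ S : Finset (Fin m), ∀ k, k ∈ S ↔ k ≠ i ∧ k ≠ j :=
    ⟨Finset.univ.filter fun k => k ≠ i ∧ k ≠ j, fun k => by simp⟩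
  have hS : ∀ k ∈ S, θ.1 (vec k 1 0) = 0 ∧ θ.1 (vec k 0 1) = 0 := fun k hk => by
    rw [← hθ, thetaPt_vec_of_ne ((hSmem k).mp hk).2, thetaPt_vec_of_ne ((hSmem k).mp hk).2]
    simp
  have hi0 : θ.1 (vec i 1 0) = 0 := by rw [← hθ, thetaPt_vec_of_ne hij, mul_zero]
  obtain ⟨c, hc0, hc1⟩ := exists_ne_zero_ne_one hF hf
  have hplane : ∃ v w : F × F, θ.1 (vec j v.1 v.2) ≠ 0 ∧ θ.1 (vec j w.1 w.2) ≠ 0 ∧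
      sform (vec j v.1 v.2) (vec j w.1 w.2) ≠ 0 := by
    rcases htype with ⟨h1, h2⟩ | htype
    · refine ⟨(1, 1), (c, 1), ?_, ?_, ?_⟩
      · rw [← hθ, thetaPt_vec, h1, h2]
        simp
      · rw [← hθ, thetaPt_vec, h1, h2]
        simpa using hc0
      · rw [sform_vec_self]
        simpa [sub_eq_zero] using hc1
    · refine ⟨(1, 0), (0, 1), ?_, ?_, ?_⟩
      · rw [← hθ, thetaPt_vec]
        exact fun h => one_ne_zero (eq_zero_of_anisotropic htype h).1
      · rw [← hθ, thetaPt_vec]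
        exact fun h => one_ne_zero (eq_zero_of_anisotropic htype h).2
      · rw [sform_vec_self]
        simp
  obtain ⟨⟨v1, v2⟩, ⟨w1, w2⟩, hv, hw, hvw⟩ := hplane
  obtain ⟨p, q, hp, hq, hpt, hqt, hp0, hq0⟩ := exists_plane_chain hF hf hv hw
  have hv' : θ.1 (vec i 1 1) ≠ 0 := by
    rw [← hθ, thetaPt_vec_of_ne hij, mul_one]
    exact one_ne_zero
  have hw' : θ.1 (vec i c 1) ≠ 0 := by
    rw [← hθ, thetaPt_vec_of_ne hij, mul_one]
    exact hc0
  have hvw' : sform (vec i 1 1) (vec i c 1) ≠ 0 := by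
    rw [sform_vec_self]
    simpa [sub_eq_zero] using hc1
  obtain ⟨p', q', hp', hq', hpt', hqt', hp0', hq0'⟩ := exists_plane_chain hF hf hv' hw'
  -- Two nonorthogonal nonsingular vectors of a plane serve alternately as point and as centre,
  -- since v is orthogonal to itself but not to w.
  let l : List (V m F × V m F) :=
    [(p • vec j v1 v2, q • vec j w1 w2), (q • vec j w1 w2, p • vec j v1 v2),
      (p' • vec i 1 1, q' • vec i c 1), (q' • vec i c 1, p' • vec i 1 1)]
  refine not_isIBIS (pairPoints θ S)
    [shift θ (vec i 1 0), shift θ (vec j x y), shift θ (vec j x' y')]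
    (l.map fun p => shift θ p.1) ?_ (irr_map_shift θ l _ ?_ ?_ ?_) (by simp [l])
  · intro g hg hb
    rw [mem_listStab] at hg
    obtain ⟨s, σ, rfl⟩ := exists_eq_of_mem_gammaSpPerms (hGamma hg.1)
    have hg2 := hg.2
    have hfix := (fix_pairPoints_iff.mp hg2).1
    have h0 := hb _ List.mem_cons_self
    have h1 := (fix_shift_iff hfix hx).mp (hb _ (by simp))
    have h2 := (fix_shift_iff hfix hx').mp (hb _ (by simp))
    have hσ1 : σ = 1 := by
      refine hσ σ (apply_vecMul_of_fix hfix h1) (apply_vecMul_of_fix hfix h2) ?_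
      rw [← sform_vec_self j]
      exact sform_fix h1 h2
    subst hσ1
    rw [map_one, mul_one] at *
    have hs : s = 1 := by
      refine eq_one_of_fix i hfix hi0 ?_ fun k hk p q => ?_
      · exact (spHom_fix_shift_iff hfix (by rw [hi0, tr_zero])).mp h0
      · by_cases hkj : k = j
        · rw [hkj]
          exact vecMul_vec_of_fix hd h1 h2 p q
        · exact vecMul_vec_of_fix_pairPoints hS hg2 ((hSmem k).mpr ⟨hk, hkj⟩) p q
    rw [hs, map_one]
  · intro r hr
    simp only [l, List.mem_cons, List.not_mem_nil, or_false] at hr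
    rcases hr with rfl | rfl | rfl | rfl
    · refine otv_mem_listStab_pairPoints hS hG hq0 fun k hk a b => ?_
      rw [sform_smul_right, sform_vec_of_ne ((hSmem k).mp hk).2, mul_zero]
    · refine otv_mem_listStab_pairPoints hS hG hp0 fun k hk a b => ?_
      rw [sform_smul_right, sform_vec_of_ne ((hSmem k).mp hk).2, mul_zero]
    · refine otv_mem_listStab_pairPoints hS hG hq0' fun k hk a b => ?_
      rw [sform_smul_right, sform_vec_of_ne ((hSmem k).mp hk).1, mul_zero]
    · refine otv_mem_listStab_pairPoints hS hG hp0' fun k hk a b => ?_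
      rw [sform_smul_right, sform_vec_of_ne ((hSmem k).mp hk).1, mul_zero]
  · intro r hr
    simp only [l, List.mem_cons, List.not_mem_nil, or_false] at hr
    rcases hr with rfl | rfl | rfl | rfl
    · refine ⟨hpt, hq0, ?_⟩
      rw [sform_smul_left, sform_smul_right]
      exact mul_ne_zero hp (mul_ne_zero hq hvw)
    · refine ⟨hqt, hp0, ?_⟩
      rw [sform_smul_left, sform_smul_right, sform_comm]
      exact mul_ne_zero hq (mul_ne_zero hp hvw)
    · refine ⟨hpt', hq0', ?_⟩
      rw [sform_smul_left, sform_smul_right]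
      exact mul_ne_zero hp' (mul_ne_zero hq' hvw')
    · refine ⟨hqt', hp0', ?_⟩
      rw [sform_smul_left, sform_smul_right, sform_comm]
      exact mul_ne_zero hq' (mul_ne_zero hp' hvw')
  · simp [l, sform_smul_left, sform_smul_right, sform_self, sform_vec_of_ne hij.symm]

end Planes

/-! ### Not IBIS for q = 2 and m ≥ 3 -/

section BinaryField

variable {m : ℕ} {F : Type*} [Field F] [Algebra (ZMod 2) F] [Finite F] {t : ZMod 2}

/-- A vector supported on three hyperbolic pairs. -/
def vec3 (i j k : Fin m) (a b c d p q : F) : V m F := vec i a b + vec j c d + vec k p q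

theorem sform_vec3 {i j k : Fin m} (hij : i ≠ j) (hik : i ≠ k) (hjk : j ≠ k)
    (a b c d p q a' b' c' d' p' q' : F) :
    sform (vec3 i j k a b c d p q) (vec3 i j k a' b' c' d' p' q') =
      (b * a' - a * b') + (d * c' - c * d') + (q * p' - p * q') := by
  simp only [vec3, sform_add_left, sform_add_right, sform_vec_self, sform_vec_of_ne hij,
    sform_vec_of_ne hik, sform_vec_of_ne hjk, sform_vec_of_ne hij.symm, sform_vec_of_ne hik.symm,
    sform_vec_of_ne hjk.symm]
  ring

theorem thetaPt_vec3 {i j k : Fin m} (hij : i ≠ j) (hik : i ≠ k) (hjk : j ≠ k) {z w : F}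
    (h : tr (theta0 (vec k z w)) = t) (a b c d p q : F) :
    (thetaPt (vec k z w) h).1 (vec3 i j k a b c d p q) =
      a * b + c * d + (p * q + (q * z - p * w) ^ 2) := by
  simp only [vec3, omega_add, sform_add_left, thetaPt_vec, thetaPt_vec_of_ne hik,
    thetaPt_vec_of_ne hjk, sform_vec_of_ne hij, sform_vec_of_ne hik, sform_vec_of_ne hjk, add_zero]

theorem sform_vec_vec3_of_ne {i j k l : Fin m} (hi : l ≠ i) (hj : l ≠ j) (hk : l ≠ k)
    (x y a b c d p q : F) : sform (vec l x y) (vec3 i j k a b c d p q) = 0 := by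
  simp only [vec3, sform_add_right, sform_vec_of_ne hi, sform_vec_of_ne hj, sform_vec_of_ne hk,
    add_zero]

/-- Singular vectors and nonsingular centres of transvections for the form of plus type. -/
def chainPlus (F : Type*) [Field F] (i j k : Fin m) : List (V m F × V m F) :=
    [(vec3 i j k 0 0 0 0 0 1, vec3 i j k 0 0 0 0 1 1),
      (vec3 i j k 0 0 0 0 1 0, vec3 i j k 0 0 1 1 0 1),
      (vec3 i j k 0 0 1 1 1 1, vec3 i j k 1 1 0 1 0 0),
      (vec3 i j k 0 1 0 0 0 0, vec3 i j k 1 1 0 0 0 0),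
      (vec3 i j k 1 0 0 0 0 0, vec3 i j k 0 1 1 1 0 0),
      (vec3 i j k 0 0 0 1 0 0, vec3 i j k 0 0 1 1 0 0)]

/-- Singular vectors and nonsingular centres of transvections for the form of minus type. -/
def chainMinus (F : Type*) [Field F] (i j k : Fin m) : List (V m F × V m F) :=
    [(vec3 i j k 0 0 0 1 0 0, vec3 i j k 0 0 1 0 0 1),
      (vec3 i j k 0 1 0 0 0 0, vec3 i j k 1 0 0 0 0 1),
      (vec3 i j k 0 0 1 0 0 0, vec3 i j k 0 0 0 1 0 1),
      (vec3 i j k 1 0 0 0 0 0, vec3 i j k 0 1 0 0 0 1),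
      (vec3 i j k 0 0 1 1 0 1, vec3 i j k 0 0 0 0 1 0),
      (vec3 i j k 0 0 1 1 1 0, vec3 i j k 0 0 0 0 0 1)]

/-- Six steps are one more than the number of points that suffice in the same six dimensions. Over
the field with two elements z = 0 gives plus type and z = 1 minus type, and both chains are verified
by evaluation. -/
theorem exists_chain_of_three {i j k : Fin m} (hij : i ≠ j) (hik : i ≠ k) (hjk : j ≠ k) {z : F}
    (hz : z = 0 ∨ z = 1) (h : tr (theta0 (vec k z z)) = t) :
    ∃ l : List (V m F × V m F), l.length = 6 ∧
      (∀ p ∈ l, (thetaPt (vec k z z) h).1 p.1 = 0 ∧ (thetaPt (vec k z z) h).1 p.2 ≠ 0 ∧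
        sform p.1 p.2 ≠ 0) ∧
      (∀ p ∈ l, ∀ n, n ≠ i → n ≠ j → n ≠ k → ∀ x y, sform (vec n x y) p.2 = 0) ∧
      l.Pairwise fun p q => sform p.1 q.2 = 0 := by
  have h2 : (2 : F) = 0 := by rw [← one_add_one_eq_two, add_self]
  have h3 : (-1 : F) ≠ 0 := neg_ne_zero.mpr one_ne_zero
  have h4 : (-1 : F) + 1 = 0 := neg_add_cancel 1
  rcases hz with rfl | rfl
  · refine ⟨chainPlus F i j k, rfl, ?_, ?_, ?_⟩
    · simp [chainPlus, thetaPt_vec3 hij hik hjk, sform_vec3 hij hik hjk, one_add_one_eq_two, h2]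
    · intro p hp n hi hj hk x y
      simp only [chainPlus, List.mem_cons, List.not_mem_nil, or_false] at hp
      rcases hp with rfl | rfl | rfl | rfl | rfl | rfl <;>
        exact sform_vec_vec3_of_ne hi hj hk _ _ _ _ _ _ _ _
    · simp [chainPlus, sform_vec3 hij hik hjk]
  · refine ⟨chainMinus F i j k, rfl, ?_, ?_, ?_⟩
    · simp [chainMinus, thetaPt_vec3 hij hik hjk, sform_vec3 hij hik hjk, one_add_one_eq_two, h2]
    · intro p hp n hi hj hk x y
      simp only [chainMinus, List.mem_cons, List.not_mem_nil, or_false] at hp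
      rcases hp with rfl | rfl | rfl | rfl | rfl | rfl <;>
        exact sform_vec_vec3_of_ne hi hj hk _ _ _ _ _ _ _ _
    · simp [chainMinus, sform_vec3 hij hik hjk]

theorem algEquiv_eq_one (h01 : ∀ x : F, x = 0 ∨ x = 1) (σ : F ≃ₐ[ZMod 2] F) : σ = 1 :=
  AlgEquiv.ext fun x => by rcases h01 x with rfl | rfl <;> simp

theorem exists_eq_spHom (h01 : ∀ x : F, x = 0 ∨ x = 1) {g : Equiv.Perm (Omega m F t)}
    (hg : g ∈ gammaSpPerms m F t) : ∃ x, g = spHom m F t x := by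
  obtain ⟨x, σ, rfl⟩ := exists_eq_of_mem_gammaSpPerms hg
  exact ⟨x, by rw [algEquiv_eq_one h01 σ, map_one, mul_one]⟩

theorem not_isIBIS_of_three_le (hm : 3 ≤ m) (hF : Nat.card F = 2 ^ 1)
    (G : Subgroup (Equiv.Perm (Omega m F t))) (hG : ∀ v b, spHom m F t (tv v b) ∈ G)
    (hGamma : G ≤ gammaSpPerms m F t) : ¬ IsIBIS G := by
  have h01 := eq_zero_or_one hF
  obtain ⟨z, hz, hzt⟩ : ∃ z : F, (z = 0 ∨ z = 1) ∧ tr (z * z) = t := by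
    have h2 : ∀ t : ZMod 2, t = 0 ∨ t = 1 := by decide
    rcases h2 t with rfl | rfl
    · exact ⟨0, Or.inl rfl, by rw [mul_zero, tr_zero]⟩
    · exact ⟨1, Or.inr rfl, by rw [mul_one, tr_one hF, Nat.cast_one]⟩
  obtain ⟨i, j, k, hij, hik, hjk⟩ : ∃ i j k : Fin m, i ≠ j ∧ i ≠ k ∧ j ≠ k :=
    ⟨⟨0, by omega⟩, ⟨1, by omega⟩, ⟨2, by omega⟩, by simp [Fin.ext_iff]⟩
  have ht : tr (theta0 (vec k z z)) = t := by rw [theta0_vec, hzt]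
  obtain ⟨l, hl6, hl, hlS, hp⟩ := exists_chain_of_three hij hik hjk hz ht
  obtain ⟨S, hSmem⟩ : ∃ S : Finset (Fin m), ∀ n, n ∈ S ↔ n ≠ i ∧ n ≠ j ∧ n ≠ k :=
    ⟨Finset.univ.filter fun n => n ≠ i ∧ n ≠ j ∧ n ≠ k, fun n => by simp⟩
  have hval : ∀ a b c d p q : F, (thetaPt (vec k z z) ht).1 (vec3 i j k a b c d p q) =
      a * b + c * d + (p * q + (q * z - p * z) ^ 2) := thetaPt_vec3 hij hik hjk ht
  have hS : ∀ n ∈ S, (thetaPt (vec k z z) ht).1 (vec n 1 0) = 0 ∧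
      (thetaPt (vec k z z) ht).1 (vec n 0 1) = 0 := fun n hn => by
    rw [thetaPt_vec_of_ne ((hSmem n).mp hn).2.2, thetaPt_vec_of_ne ((hSmem n).mp hn).2.2]
    simp
  have hi0 : (thetaPt (vec k z z) ht).1 (vec i 1 0) = 0 := by
    rw [thetaPt_vec_of_ne hik, mul_zero]
  generalize thetaPt (vec k z z) ht = θ at *
  have e1 : θ.1 (vec3 i j k 0 0 1 0 0 0) = 0 := by rw [hval]; ring
  have e2 : θ.1 (vec3 i j k 0 0 0 1 0 0) = 0 := by rw [hval]; ring
  -- For minus type the vectors of plane k are nonsingular. Adding the nonsingular vector (1, 1) of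
  -- plane j makes them singular, and once plane j is fixed pointwise this does no harm.
  have e3 : θ.1 (vec3 i j k 0 0 z z 1 0) = 0 := by
    rw [hval]
    linear_combination z ^ 2 * add_self (1 : F)
  have e4 : θ.1 (vec3 i j k 0 0 z z 0 1) = 0 := by
    rw [hval]
    linear_combination z ^ 2 * add_self (1 : F)
  have hv0 : ∀ n : Fin m, vec n (0 : F) 0 = 0 := fun n => by
    rw [← zero_smul F (vec n 0 0), smul_vec, zero_mul]
  refine not_isIBIS (pairPoints θ S)
    [shift θ (vec i 1 0), shift θ (vec3 i j k 0 0 1 0 0 0), shift θ (vec3 i j k 0 0 0 1 0 0),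
      shift θ (vec3 i j k 0 0 z z 1 0), shift θ (vec3 i j k 0 0 z z 0 1)]
    (l.map fun p => shift θ p.1) ?_ (irr_map_shift θ l _ (fun p hpl => ?_)
      (fun p hpl => ⟨by rw [(hl p hpl).1, tr_zero], (hl p hpl).2⟩) hp) (by simp [hl6])
  · intro g hg hb
    rw [mem_listStab] at hg
    obtain ⟨x, rfl⟩ := exists_eq_spHom h01 (hGamma hg.1)
    have hfix := (fix_pairPoints_iff.mp hg.2).1
    have h0 := (spHom_fix_shift_iff hfix (by rw [hi0, tr_zero])).mp (hb _ (by simp))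
    have h1 := (spHom_fix_shift_iff hfix (by rw [e1, tr_zero])).mp (hb _ (by simp))
    have h2 := (spHom_fix_shift_iff hfix (by rw [e2, tr_zero])).mp (hb _ (by simp))
    have h3 := (spHom_fix_shift_iff hfix (by rw [e3, tr_zero])).mp (hb _ (by simp))
    have h4 := (spHom_fix_shift_iff hfix (by rw [e4, tr_zero])).mp (hb _ (by simp))
    simp only [vec3, hv0, zero_add, add_zero] at h1 h2
    have hj := vecMul_vec_of_fix (by simp) h1 h2
    simp only [vec3, hv0, zero_add, add_vecMul, hj, add_right_inj] at h3 h4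
    have hk := vecMul_vec_of_fix (by simp) h3 h4
    have hx : x = 1 := by
      refine eq_one_of_fix i hfix hi0 h0 fun n hn p q => ?_
      by_cases hnj : n = j
      · rw [hnj, hj]
      by_cases hnk : n = k
      · rw [hnk, hk]
      exact vecMul_vec_of_fix_pairPoints hS hg.2 ((hSmem n).mpr ⟨hn, hnj, hnk⟩) p q
    rw [hx, map_one]
  · refine otv_mem_listStab_pairPoints hS hG (hl p hpl).2.1 fun n hn x y => ?_
    exact hlS p hpl n ((hSmem n).mp hn).1 ((hSmem n).mp hn).2.1 ((hSmem n).mp hn).2.2 x y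

end BinaryField

/-! ### Symmetric and alternating groups are IBIS -/

section SymmetricGroup

variable {X : Type*} [Finite X]

theorem eq_one_or_swap [DecidableEq X] {g : Equiv.Perm X} {b c : X}
    (h : ∀ x, x ≠ b → x ≠ c → g x = x) : g = 1 ∨ g = Equiv.swap b c := by
  have key : ∀ b c : X, (∀ x, x ≠ b → x ≠ c → g x = x) → g b = b ∨ g b = c := by
    intro b c h
    by_contra! hcon
    exact hcon.1 (g.injective (h _ hcon.1 hcon.2))
  rcases key b c h with hb | hb
  · left
    have hc : g c = c := by
      rcases key c b (fun x h1 h2 => h x h2 h1) with hc | hc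
      · exact hc
      · have : c = b := g.injective (hc.trans hb.symm)
        rwa [this]
    ext x
    by_cases h1 : x = b
    · rw [h1, hb, Equiv.Perm.one_apply]
    · by_cases h2 : x = c
      · rw [h2, hc, Equiv.Perm.one_apply]
      · rw [h x h1 h2, Equiv.Perm.one_apply]
  · right
    have hc : g c = b := by
      rcases key c b (fun x h1 h2 => h x h2 h1) with hc | hc
      · have : b = c := g.injective (hb.trans hc.symm)
        rw [this, hc]
      · exact hc
    ext x
    by_cases h1 : x = b
    · rw [h1, hb, Equiv.swap_apply_left]
    · by_cases h2 : x = c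
      · rw [h2, hc, Equiv.swap_apply_right]
      · rw [h x h1 h2, Equiv.swap_apply_of_ne_of_ne h1 h2]

theorem exists_compl_range {n k : ℕ} (hn : Nat.card X = n + k) (ω : Fin n → X)
    (hω : Function.Injective ω) : ∃ s : Finset X, s.card = k ∧ ∀ x, x ∈ s ↔ ∀ i, ω i ≠ x := by
  classical
  have := Fintype.ofFinite X
  refine ⟨Finset.univ \ Finset.univ.image ω, ?_, fun x => by simp⟩
  rw [Finset.card_sdiff_of_subset (Finset.subset_univ _), Finset.card_image_of_injective _ hω,
    Finset.card_univ, ← Nat.card_eq_fintype_card, hn, Finset.card_univ, Fintype.card_fin]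
  omega

/-- The symmetric group is IBIS. -/
theorem isIBIS_of_swap_mem [DecidableEq X] {G : Subgroup (Equiv.Perm X)} (hX : 2 ≤ Nat.card X)
    (hG : ∀ a b : X, Equiv.swap a b ∈ G) : IsIBIS G := by
  obtain ⟨n, hn⟩ := Nat.exists_eq_add_of_le' hX
  refine isIBIS_of_forall_injective n (by omega) (fun ω hω => ?_)
    fun ω hω x h _ hh hx g _ hg hgx => ?_
  · obtain ⟨s, hs, hsω⟩ := exists_compl_range hn ω hω
    obtain ⟨a, b, hab, rfl⟩ := Finset.card_eq_two.mp hs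
    refine ⟨_, hG a b, fun i => ?_, fun h => hab ?_⟩
    · exact Equiv.swap_apply_of_ne_of_ne ((hsω a).mp (by simp) i) ((hsω b).mp (by simp) i)
    · have := Equiv.congr_fun h a
      rw [Equiv.swap_apply_left] at this
      exact this.symm
  · obtain ⟨s, hs, hsω⟩ := exists_compl_range hn ω hω
    have hxs : x ∈ s := (hsω x).mpr fun i hi => hx (hi ▸ hh i)
    have h1 : (s.erase x).card = 1 := by
      rw [Finset.card_erase_of_mem hxs, hs]
    obtain ⟨b, hb⟩ := Finset.card_eq_one.mp h1
    have h2 := eq_one_or_swap (g := g) (b := b) (c := b) fun y hy _ => by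
      by_cases hys : y ∈ s
      · by_cases hyx : y = x
        · rw [hyx, hgx]
        · have := Finset.mem_erase.mpr ⟨hyx, hys⟩
          rw [hb, Finset.mem_singleton] at this
          exact absurd this hy
      · rw [hsω] at hys
        push Not at hys
        obtain ⟨i, rfl⟩ := hys
        exact hg i
    rw [Equiv.swap_self] at h2
    exact h2.elim id id

/-- The alternating group is IBIS. -/
theorem isIBIS_of_sign [Fintype X] [DecidableEq X] {G : Subgroup (Equiv.Perm X)}
    (hX : 3 ≤ Nat.card X)
    (hG : ∀ a b c : X, a ≠ b → b ≠ c → a ≠ c → Equiv.swap a b * Equiv.swap b c ∈ G)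
    (hsign : ∀ g ∈ G, Equiv.Perm.sign g = 1) : IsIBIS G := by
  obtain ⟨n, hn⟩ := Nat.exists_eq_add_of_le' hX
  refine isIBIS_of_forall_injective n (by omega) (fun ω hω => ?_)
    fun ω hω x h _ hh hx g hgG hg hgx => ?_
  · obtain ⟨s, hs, hsω⟩ := exists_compl_range hn ω hω
    obtain ⟨a, b, c, hab, hac, hbc, rfl⟩ := Finset.card_eq_three.mp hs
    refine ⟨_, hG a b c hab hbc hac, fun i => ?_, fun h => hac ?_⟩
    · have ha := (hsω a).mp (by simp) i
      have hb := (hsω b).mp (by simp) i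
      have hc := (hsω c).mp (by simp) i
      rw [Equiv.Perm.mul_apply, Equiv.swap_apply_of_ne_of_ne hb hc,
        Equiv.swap_apply_of_ne_of_ne ha hb]
    · have := Equiv.congr_fun h c
      rwa [Equiv.Perm.mul_apply, Equiv.swap_apply_right, Equiv.swap_apply_right] at this
  · obtain ⟨s, hs, hsω⟩ := exists_compl_range hn ω hω
    have hxs : x ∈ s := (hsω x).mpr fun i hi => hx (hi ▸ hh i)
    have h1 : (s.erase x).card = 2 := by
      rw [Finset.card_erase_of_mem hxs, hs]
    obtain ⟨b, c, hbc, hb⟩ := Finset.card_eq_two.mp h1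
    have h2 := eq_one_or_swap (g := g) (b := b) (c := c) fun y hyb hyc => by
      by_cases hys : y ∈ s
      · by_cases hyx : y = x
        · rw [hyx, hgx]
        · have := Finset.mem_erase.mpr ⟨hyx, hys⟩
          rw [hb, Finset.mem_insert, Finset.mem_singleton] at this
          exact absurd this (not_or.mpr ⟨hyb, hyc⟩)
      · rw [hsω] at hys
        push Not at hys
        obtain ⟨i, rfl⟩ := hys
        exact hg i
    refine h2.resolve_right fun h3 => ?_
    have := hsign g hgG
    rw [h3, Equiv.Perm.sign_swap hbc] at this
    exact absurd this (by decide)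

end SymmetricGroup

/-! ### Symplectic bases in dimension four -/

section DimensionFour

variable {F : Type*} [Field F] [Algebra (ZMod 2) F] [Finite F] {t : ZMod 2}

theorem eq_vec_add_vec (u : V 2 F) :
    u = vec 0 (u (Sum.inl 0)) (u (Sum.inr 0)) + vec 1 (u (Sum.inl 1)) (u (Sum.inr 1)) := by
  conv_lhs => rw [eq_sum_vec u, Fin.sum_univ_two]

theorem theta0_two (u : V 2 F) :
    theta0 u = u (Sum.inl 0) * u (Sum.inr 0) + u (Sum.inl 1) * u (Sum.inr 1) := by
  rw [theta0, Fin.sum_univ_two]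

theorem sform_two (u v : V 2 F) :
    sform u v = (u (Sum.inr 0) * v (Sum.inl 0) - u (Sum.inl 0) * v (Sum.inr 0)) +
      (u (Sum.inr 1) * v (Sum.inl 1) - u (Sum.inl 1) * v (Sum.inr 1)) := by
  rw [sform_eq, Fin.sum_univ_two]

/-- A symplectic basis of a four-dimensional space. -/
structure IsSympBasis (c c' p r : V 2 F) : Prop where
  cc' : sform c c' = 1
  pr : sform p r = 1
  cp : sform c p = 0
  cr : sform c r = 0
  cp' : sform c' p = 0
  cr' : sform c' r = 0

theorem IsSympBasis.expand {c c' p r : V 2 F} (h : IsSympBasis c c' p r) (u : V 2 F) :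
    u = sform u c' • c + sform u c • c' + sform u r • p + sform u p • r := by
  have hcc := h.cc'
  have hpr := h.pr
  have hcc' : sform c' c = 1 := by rw [sform_comm, hcc]
  have hpr' : sform r p = 1 := by rw [sform_comm, hpr]
  have h1 := h.cp
  have h2 := h.cr
  have h3 := h.cp'
  have h4 := h.cr'
  have h1' : sform p c = 0 := by rw [sform_comm, h1]
  have h2' : sform r c = 0 := by rw [sform_comm, h2]
  have h3' : sform p c' = 0 := by rw [sform_comm, h3]
  have h4' : sform r c' = 0 := by rw [sform_comm, h4]
  let L : V 2 F →ₗ[F] V 2 F :=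
    (LinearMap.proj (Sum.inl 0)).smulRight c + (LinearMap.proj (Sum.inr 0)).smulRight c' +
      (LinearMap.proj (Sum.inl 1)).smulRight p + (LinearMap.proj (Sum.inr 1)).smulRight r
  have hL : ∀ u, L u = u (Sum.inl 0) • c + u (Sum.inr 0) • c' + u (Sum.inl 1) • p +
      u (Sum.inr 1) • r := fun u => rfl
  have hs : ∀ u v, sform (L u) (L v) = sform u v := fun u v => by
    rw [hL, hL, sform_two u v]
    simp only [sform_add_left, sform_add_right, sform_smul_left, sform_smul_right, sform_self,
      hcc, hpr, hcc', hpr', h1, h2, h3, h4, h1', h2', h3', h4']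
    linear_combination (u (Sum.inl 0) * v (Sum.inr 0) + u (Sum.inl 1) * v (Sum.inr 1)) *
      add_self (1 : F)
  -- The map sending the standard basis to c, c', p, r is an isometry, hence invertible, so u is a
  -- combination of these vectors. The coefficients are then read off with φ.
  have hu : L (u ᵥ* ((mkSp L hs)⁻¹).1) = u := by
    rw [← vecMul_mkSp L hs, vecMul_inv_cancel']
  generalize u ᵥ* ((mkSp L hs)⁻¹).1 = w at hu
  rw [hL] at hu
  rw [← hu]
  simp only [sform_add_left, sform_smul_left, sform_self, hcc, hpr, hcc', hpr', h1, h2, h3, h4,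
    h1', h2', h3', h4', mul_zero, mul_one, add_zero, zero_add]

theorem IsSympBasis.ext {c c' p r : V 2 F} (h : IsSympBasis c c' p r)
    {x y : symplecticGroup (Fin 2) F} (h1 : c ᵥ* x.1 = c ᵥ* y.1) (h2 : c' ᵥ* x.1 = c' ᵥ* y.1)
    (h3 : p ᵥ* x.1 = p ᵥ* y.1) (h4 : r ᵥ* x.1 = r ᵥ* y.1) : x = y := by
  refine symplectic_ext fun u => ?_
  rw [h.expand u]
  simp only [add_vecMul, smul_vecMul, h1, h2, h3, h4]

/-- Up to an isometry, a nonzero vector is the first vector of the standard basis. -/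
theorem exists_vecMul_eq {c : V 2 F} (hc : c ≠ 0) :
    ∃ h : symplecticGroup (Fin 2) F, c ᵥ* h.1 = vec 0 1 0 := by
  obtain ⟨h, -, hh, -⟩ := exists_mem_tvGroup_vecMul_eq ∅ hc
    (vec_ne_zero_left 0 0 one_ne_zero : (vec 0 1 0 : V 2 F) ≠ 0) (by simp) (by simp)
  exact ⟨h, hh⟩

theorem omega_vecMul (θ : Omega 2 F t) (h : symplecticGroup (Fin 2) F) (u : V 2 F) :
    (spHom 2 F t h⁻¹ θ).1 (u ᵥ* h.1) = θ.1 u := by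
  rw [spHom_apply_apply, vecMul_inv_cancel]

/-- A form of minus type has no totally singular subspace of dimension two. -/
theorem sform_ne_zero_of_singular {θ : Omega 2 F 1} {c d : V 2 F} (hc : c ≠ 0)
    (hdc : ∀ b : F, d ≠ b • c) (hθc : θ.1 c = 0) (hθd : θ.1 d = 0) : sform c d ≠ 0 := by
  intro hcd
  obtain ⟨h, hh⟩ := exists_vecMul_eq hc
  have h1 := omega_vecMul θ h c
  have h2 := omega_vecMul θ h d
  rw [hh, hθc] at h1
  rw [hθd] at h2
  have h3 : sform (vec 0 1 0) (d ᵥ* h.1) = 0 := by rw [← hh, sform_vecMul, hcd]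
  have h4 : ∀ b : F, d ᵥ* h.1 ≠ b • vec 0 1 0 := fun b hb => hdc b (by
    rw [← vecMul_inv_cancel d h, hb, smul_vecMul, ← hh, vecMul_inv_cancel])
  generalize d ᵥ* h.1 = w at *
  obtain ⟨a, ha, hθ⟩ := exists_eq_thetaPt (spHom 2 F 1 h⁻¹ θ)
  rw [hθ, thetaPt_apply, theta0_vec, sform_two] at h1
  have ha0 : a (Sum.inr 0) = 0 := by simpa [vec_inl, vec_inr] using h1
  have hw0 : w (Sum.inr 0) = 0 := by
    rw [sform_two] at h3
    simpa [vec_inl, vec_inr] using h3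
  rw [theta0_two, ha0, mul_zero, zero_add] at ha
  rw [hθ, thetaPt_apply, theta0_two, sform_two, hw0, ha0] at h2
  -- With c moved to the first basis vector, singularity of c kills one coordinate of the label a,
  -- so the trace of its plane-1 part is one. The form is anisotropic on plane 1, and d, singular
  -- and orthogonal to c, has no component there.
  obtain ⟨h5, h6⟩ := eq_zero_of_anisotropic ha (x := w (Sum.inl 1)) (y := w (Sum.inr 1)) (by
    linear_combination h2)
  refine h4 (w (Sum.inl 0)) ?_
  rw [eq_vec_add_vec w, hw0, h5, h6, smul_vec]
  ext j
  rcases j with j | j <;> simp [vec_inl, vec_inr]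

/-- The hypothesis on the trace says that q = 2, so the label a has θ₀(a) = 0 and not merely trace
zero. Once c is the first basis vector this becomes a product of two coordinates being zero. -/
theorem exists_hyperbolic_basis (h01 : ∀ x : F, tr x = 0 → x = 0) {θ : Omega 2 F 0} {c : V 2 F}
    (hc : c ≠ 0) (hθc : θ.1 c = 0) :
    ∃ c' p r, IsSympBasis c c' p r ∧ θ.1 c' = 0 ∧ θ.1 p = 0 ∧ θ.1 r = 0 := by
  obtain ⟨h, hh⟩ := exists_vecMul_eq hc
  suffices H : ∃ c' p r, IsSympBasis (vec 0 1 0) c' p r ∧ (spHom 2 F 0 h⁻¹ θ).1 c' = 0 ∧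
      (spHom 2 F 0 h⁻¹ θ).1 p = 0 ∧ (spHom 2 F 0 h⁻¹ θ).1 r = 0 by
    obtain ⟨c', p, r, hb, h1, h2, h3⟩ := H
    rw [spHom_apply_apply] at h1 h2 h3
    have e : c = vec 0 1 0 ᵥ* (h⁻¹).1 := by rw [← hh, vecMul_inv_cancel]
    refine ⟨_, _, _, ?_, h1, h2, h3⟩
    rw [e]
    constructor <;> rw [sform_vecMul]
    exacts [hb.cc', hb.pr, hb.cp, hb.cr, hb.cp', hb.cr']
  have h1 := omega_vecMul θ h c
  rw [hh, hθc] at h1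
  obtain ⟨a, ha, hθ⟩ := exists_eq_thetaPt (spHom 2 F 0 h⁻¹ θ)
  rw [hθ] at h1 ⊢
  rw [thetaPt_apply, theta0_vec, sform_two] at h1
  have ha0 : a (Sum.inr 0) = 0 := by simpa [vec_inl, vec_inr] using h1
  have ha1 := h01 _ ha
  rw [theta0_two, ha0, mul_zero, zero_add] at ha1
  have h2 := add_self (1 : F)
  have hθv : ∀ u, (thetaPt a ha).1 u = u (Sum.inl 0) * u (Sum.inr 0) +
      u (Sum.inl 1) * u (Sum.inr 1) + (u (Sum.inr 0) * a (Sum.inl 0) +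
      (u (Sum.inr 1) * a (Sum.inl 1) - u (Sum.inl 1) * a (Sum.inr 1))) ^ 2 := fun u => by
    rw [thetaPt_apply, theta0_two, sform_two, ha0, mul_zero, sub_zero]
  -- Each vector has one coordinate 1 in its plane, and the other solves θ = 0.
  refine ⟨vec 0 (a (Sum.inl 0) ^ 2) 1, vec 1 1 (a (Sum.inr 1) ^ 2), vec 1 (a (Sum.inl 1) ^ 2) 1,
    ⟨?_, ?_, ?_, ?_, ?_, ?_⟩, ?_, ?_, ?_⟩
  · rw [sform_vec_self]
    linear_combination -h2
  · rw [sform_vec_self]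
    linear_combination a (Sum.inl 1) * a (Sum.inr 1) * ha1 - h2
  · exact sform_vec_of_ne (by decide) _ _ _ _
  · exact sform_vec_of_ne (by decide) _ _ _ _
  · exact sform_vec_of_ne (by decide) _ _ _ _
  · exact sform_vec_of_ne (by decide) _ _ _ _
  · rw [hθv]
    simp only [vec_inl, vec_inr]
    simp only [if_true, one_ne_zero, if_false]
    linear_combination a (Sum.inl 0) ^ 2 * h2
  · rw [hθv]
    simp only [vec_inl, vec_inr]
    simp only [if_true, zero_ne_one, if_false]
    linear_combination a (Sum.inr 1) ^ 2 * h2 +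
      (a (Sum.inr 1) ^ 2 * (a (Sum.inl 1) * a (Sum.inr 1)) - 2 * a (Sum.inr 1) ^ 2) * ha1
  · rw [hθv]
    simp only [vec_inl, vec_inr]
    simp only [if_true, zero_ne_one, if_false]
    linear_combination a (Sum.inl 1) ^ 2 * h2 +
      (a (Sum.inl 1) ^ 2 * (a (Sum.inl 1) * a (Sum.inr 1)) - 2 * a (Sum.inl 1) ^ 2) * ha1

end DimensionFour

/-! ### Sp_4(2) on the forms of minus type -/

section SixPoints

variable {F : Type*} [Field F] [Algebra (ZMod 2) F] [Finite F] {t : ZMod 2}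

theorem eq_zero_of_tr_eq_zero (hF : Nat.card F = 2 ^ 1) {x : F} (h : tr x = 0) : x = 0 := by
  rcases eq_zero_or_one hF x with rfl | rfl
  · rfl
  · rw [tr_one hF, Nat.cast_one] at h
    exact absurd h one_ne_zero

theorem eq_one_of_ne_zero (hF : Nat.card F = 2 ^ 1) {x : F} (h : x ≠ 0) : x = 1 :=
  (eq_zero_or_one hF x).resolve_left h

open scoped Classical in
/-- On the forms of minus type in dimension four over the field of two elements, the transvections
act as transpositions. -/
theorem spHom_tv_eq_swap (hF : Nat.card F = 2 ^ 1) (θ : Omega 2 F 1) {c : V 2 F}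
    (hθc : θ.1 c = 0) : spHom 2 F 1 (tv c 1) = Equiv.swap θ (shift θ c) := by
  by_cases hc : c = 0
  · rw [hc, tv_zero, map_one, shift_zero, Equiv.swap_self]
    rfl
  have hc0 : tr (θ.1 c) = 0 := by rw [hθc, tr_zero]
  have h1 : spHom 2 F 1 (tv c 1) θ = shift θ c := omega_ext fun u => by
    rw [spHom_tv_apply, hθc, shift_apply hc0]
    ring
  refine Equiv.ext fun θ' => ?_
  obtain ⟨d, hd, rfl⟩ := exists_eq_shift θ θ'
  by_cases hd0 : d = 0
  · rw [hd0, shift_zero, Equiv.swap_apply_left, h1]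
  by_cases hdc : d = c
  · rw [hdc, Equiv.swap_apply_right, ← h1, ← Equiv.Perm.mul_apply, ← map_mul, tv_mul_self, map_one,
      Equiv.Perm.one_apply]
  have hθd := eq_zero_of_tr_eq_zero hF hd
  rw [Equiv.swap_apply_of_ne_of_ne (shift_ne_self hd hd0)
    fun h => hdc (shift_injective hd hc0 h)]
  -- In minus type, distinct nonzero singular vectors are not orthogonal. So the form of d takes the
  -- value 1 at c, and the transvection with centre c preserves it.
  have hcd : sform c d = 1 := by
    refine eq_one_of_ne_zero hF (sform_ne_zero_of_singular hc (fun b hb => ?_) hθc hθd)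
    rcases eq_zero_or_one hF b with rfl | rfl
    · exact hd0 (by rw [hb, zero_smul])
    · exact hdc (by rw [hb, one_smul])
  refine omega_ext fun u => ?_
  rw [spHom_tv_apply, shift_apply hd, shift_apply hd, hθc, hcd]
  linear_combination sform u c ^ 2 * add_self (1 : F)

variable (F) in
/-- The sign of the action on the forms of minus type in dimension four. -/
def spSign : symplecticGroup (Fin 2) F →* ℤˣ := by
  classical
  letI := Fintype.ofFinite (Omega 2 F 1)
  exact Equiv.Perm.sign.comp (spHom 2 F 1)

theorem spSign_tv (hF : Nat.card F = 2 ^ 1) {c : V 2 F} (hc : c ≠ 0) : spSign F (tv c 1) = -1 := by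
  classical
  have h0 : (vec 0 1 0 : V 2 F) ≠ 0 := vec_ne_zero_left 0 0 one_ne_zero
  have h1 : spSign F (tv c 1) = spSign F (tv (vec 0 1 0) 1) := by
    have := congrArg (Abelianization.lift (spSign F)) (abelianization_tv_eq hc h0 1)
    simpa using this
  have ht : tr (theta0 (vec 1 1 1 : V 2 F)) = 1 := by
    rw [theta0_vec, mul_one, tr_one hF, Nat.cast_one]
  have hθ : (thetaPt (vec 1 1 1 : V 2 F) ht).1 (vec 0 1 0) = 0 := by
    rw [thetaPt_vec_of_ne (by decide), mul_zero]
  rw [h1]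
  let _ := Fintype.ofFinite (Omega 2 F 1)
  change Equiv.Perm.sign (spHom 2 F 1 (tv (vec 0 1 0) 1)) = -1
  rw [spHom_tv_eq_swap hF _ hθ]
  exact Equiv.Perm.sign_swap (shift_ne_self (by rw [hθ, tr_zero]) h0).symm

/-- The abelianization is generated by the common class T of all nontrivial transvections, with T² =
1. Transvections are odd, so the sign detects it completely. -/
theorem mem_commutator_of_spSign (hF : Nat.card F = 2 ^ 1) {x : symplecticGroup (Fin 2) F}
    (h : spSign F x = 1) : x ∈ commutator (symplecticGroup (Fin 2) F) := by
  have h0 : (vec 0 1 0 : V 2 F) ≠ 0 := vec_ne_zero_left 0 0 one_ne_zero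
  set T := Abelianization.of (tv (vec 0 1 0 : V 2 F) 1) with hT
  have key : ∀ x ∈ tvGroup 2 F, Abelianization.of x = 1 ∨ Abelianization.of x = T := by
    have hTT : T * T = 1 := by rw [hT, ← map_mul, tv_mul_self, map_one]
    intro x hx
    induction hx using Subgroup.closure_induction with
    | mem x hx =>
      obtain ⟨v, b, rfl⟩ := hx
      rcases eq_zero_or_one hF b with rfl | rfl
      · left
        rw [tv_zero_right, map_one]
      · by_cases hv : v = 0
        · left
          rw [hv, tv_zero, map_one]
        · exact Or.inr (abelianization_tv_eq hv h0 1)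
    | one => exact Or.inl (map_one _)
    | mul x y _ _ hx hy =>
      rw [map_mul]
      rcases hx with hx | hx <;> rcases hy with hy | hy <;> rw [hx, hy] <;> simp [hTT]
    | inv x _ hx =>
      rw [map_inv]
      rcases hx with hx | hx <;> rw [hx]
      · simp
      · exact Or.inr (inv_eq_of_mul_eq_one_left hTT)
  rw [mem_commutator_iff]
  refine (key x (mem_tvGroup x)).resolve_right fun hxT => ?_
  have := congrArg (Abelianization.lift (spSign F)) hxT
  rw [hT] at this
  simp only [Abelianization.lift_apply_of] at this
  rw [h, spSign_tv hF h0] at this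
  exact absurd this (by decide)

/-- A subgroup containing the derived subgroup consists of even elements or is the whole group. -/
theorem even_or_eq_top (hF : Nat.card F = 2 ^ 1) {H : Subgroup (symplecticGroup (Fin 2) F)}
    (hH : commutator (symplecticGroup (Fin 2) F) ≤ H) : (∀ x ∈ H, spSign F x = 1) ∨ H = ⊤ := by
  by_cases h : ∀ x ∈ H, spSign F x = 1
  · exact Or.inl h
  · right
    push Not at h
    obtain ⟨x, hx, hx1⟩ := h
    have hx2 := (Int.units_eq_one_or (spSign F x)).resolve_left hx1
    rw [eq_top_iff]
    intro y _
    rcases Int.units_eq_one_or (spSign F y) with hy | hy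
    · exact hH (mem_commutator_of_spSign hF hy)
    · have : y * x⁻¹ ∈ H := hH (mem_commutator_of_spSign hF (by
        rw [map_mul, map_inv, hx2, hy]
        decide))
      have := mul_mem this hx
      rwa [inv_mul_cancel_right] at this

theorem three_le_card_omega (F : Type*) [Field F] [Algebra (ZMod 2) F] [Finite F] (t : ZMod 2) :
    3 ≤ Nat.card (Omega 2 F t) := by
  obtain ⟨a, b, hab, -⟩ := exists_type (F := F) t
  have ht : tr (theta0 (vec 1 a b : V 2 F)) = t := by rw [theta0_vec, hab]
  have h0 : (vec 0 1 0 : V 2 F) ≠ 0 := vec_ne_zero_left 0 0 one_ne_zero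
  have h1 : (vec 0 0 1 : V 2 F) ≠ 0 := fun h => by
    have := congrFun h (Sum.inr 0)
    simp [vec_inr] at this
  have h2 : (vec 0 1 0 : V 2 F) ≠ vec 0 0 1 := fun h => by
    have := congrFun h (Sum.inr 0)
    simp [vec_inr] at this
  have e1 : (thetaPt (vec 1 a b : V 2 F) ht).1 (vec 0 1 0) = 0 := by
    rw [thetaPt_vec_of_ne (by decide), mul_zero]
  have e2 : (thetaPt (vec 1 a b : V 2 F) ht).1 (vec 0 0 1) = 0 := by
    rw [thetaPt_vec_of_ne (by decide), zero_mul]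
  generalize thetaPt (vec 1 a b : V 2 F) ht = θ at *
  have e1' : tr (θ.1 (vec 0 1 0)) = 0 := by rw [e1, tr_zero]
  have e2' : tr (θ.1 (vec 0 0 1)) = 0 := by rw [e2, tr_zero]
  classical
  have := Fintype.ofFinite (Omega 2 F t)
  have h3 : ({θ, shift θ (vec 0 1 0), shift θ (vec 0 0 1)} : Finset (Omega 2 F t)).card = 3 :=
    Finset.card_eq_three.mpr ⟨_, _, _, (shift_ne_self e1' h0).symm, (shift_ne_self e2' h1).symm,
      fun h => h2 (shift_injective e1' e2' h), rfl⟩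
  rw [← h3, Nat.card_eq_fintype_card]
  exact Finset.card_le_univ _

/-- All transpositions of Ω come from transvections. By `even_or_eq_top` the group is therefore the
alternating or the symmetric group on Ω. -/
theorem isIBIS_minus (hF : Nat.card F = 2 ^ 1) (G : Subgroup (Equiv.Perm (Omega 2 F 1)))
    (hN : spDerivedPerms 2 F 1 ≤ G) (hGamma : G ≤ gammaSpPerms 2 F 1) : IsIBIS G := by
  classical
  let _ := Fintype.ofFinite (Omega 2 F 1)
  have hcard := three_le_card_omega F 1
  have hswap : ∀ θ θ' : Omega 2 F 1, ∃ x, Equiv.swap θ θ' = spHom 2 F 1 x := fun θ θ' => by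
    obtain ⟨c, hc, rfl⟩ := exists_eq_shift θ θ'
    exact ⟨_, (spHom_tv_eq_swap hF θ (eq_zero_of_tr_eq_zero hF hc)).symm⟩
  rcases even_or_eq_top hF (Subgroup.map_le_iff_le_comap.mp hN) with h | h
  · refine isIBIS_of_sign hcard (fun θ₁ θ₂ θ₃ h12 h23 _ => ?_) fun g hg => ?_
    · obtain ⟨x, hx⟩ := hswap θ₁ θ₂
      obtain ⟨y, hy⟩ := hswap θ₂ θ₃
      rw [hx, hy, ← map_mul]
      refine hN ⟨x * y, mem_commutator_of_spSign hF ?_, rfl⟩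
      change Equiv.Perm.sign (spHom 2 F 1 (x * y)) = 1
      rw [map_mul, ← hx, ← hy, map_mul, Equiv.Perm.sign_swap h12, Equiv.Perm.sign_swap h23]
      decide
    · obtain ⟨x, rfl⟩ := exists_eq_spHom (eq_zero_or_one hF) (hGamma hg)
      exact h x hg
  · refine isIBIS_of_swap_mem (by omega) fun θ θ' => ?_
    obtain ⟨x, hx⟩ := hswap θ θ'
    have : x ∈ G.comap (spHom 2 F 1) := h ▸ Subgroup.mem_top x
    rw [hx]
    exact this

end SixPoints

/-! ### Sp_4(2) on the forms of plus type -/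

section TenPoints

variable {F : Type*} [Field F] [Algebra (ZMod 2) F] [Finite F]

/-- The pointwise stabilizer in `Sp_4(2)` of three forms of plus type has order two and is
generated by an odd element. -/
theorem exists_stabilizer_generator (hF : Nat.card F = 2 ^ 1) {θ : Omega 2 F 0} {c d : V 2 F}
    (hc : c ≠ 0) (hd : d ≠ 0) (hcd : c ≠ d) (hθc : θ.1 c = 0) (hθd : θ.1 d = 0) :
    ∃ s : symplecticGroup (Fin 2) F, spSign F s = -1 ∧ spHom 2 F 0 s θ = θ ∧
      c ᵥ* s.1 = c ∧ d ᵥ* s.1 = d ∧ (∃ e, θ.1 e = 0 ∧ e ᵥ* s.1 ≠ e) ∧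
      ∀ x : symplecticGroup (Fin 2) F, spHom 2 F 0 x θ = θ → c ᵥ* x.1 = c → d ᵥ* x.1 = d →
        x = 1 ∨ x = s := by
  have h01 := eq_zero_or_one hF
  have h2 := add_self (1 : F)
  obtain ⟨c', p, r, hb, hθc', hθp, hθr⟩ := exists_hyperbolic_basis
    (fun x hx => eq_zero_of_tr_eq_zero hF hx) hc hθc
  have hθx : ∀ {x : symplecticGroup (Fin 2) F}, spHom 2 F 0 x θ = θ → ∀ u, θ.1 (u ᵥ* x.1) = θ.1 u :=
    fun {x} hx u => by rw [← spHom_apply_apply, hx]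
  have hexp := hb.expand d
  by_cases h : sform c d = 0
  · -- reduce to a symplectic basis with the pairs `c, p'` and `d, r'`
    obtain ⟨p', r', hb', hθp', hθr'⟩ : ∃ p' r', IsSympBasis c p' d r' ∧ θ.1 p' = 0 ∧
        θ.1 r' = 0 := by
      have key : ∀ p r, IsSympBasis c c' p r → θ.1 p = 0 → θ.1 r = 0 →
          ∀ a : F, d = a • c + p → ∃ p' r', IsSympBasis c p' d r' ∧ θ.1 p' = 0 ∧ θ.1 r' = 0 := by
        rintro p r hb hθp hθr a rfl
        refine ⟨c' + a • r, r, ⟨?_, ?_, h, hb.cr, ?_, ?_⟩, ?_, hθr⟩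
        · rw [sform_add_right, sform_smul_right, hb.cc', hb.cr, mul_zero, add_zero]
        · rw [sform_add_left, sform_smul_left, hb.cr, hb.pr, mul_zero, zero_add]
        · rw [sform_add_left, sform_add_right, sform_add_right, sform_smul_right, sform_smul_left,
            sform_smul_left, sform_comm c', hb.cc', hb.cp', sform_smul_right, sform_comm r c,
            hb.cr, sform_comm r p, hb.pr]
          linear_combination a * h2
        · rw [sform_add_left, sform_smul_left, sform_self, hb.cr', mul_zero, add_zero]
        · rw [omega_add, omega_smul, sform_smul_right, hθc', hθr, hb.cr']
          ring
      have hdc : sform d c = 0 := by rw [sform_comm, h]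
      rw [hdc, zero_smul, add_zero] at hexp
      have hθ : sform d r * sform d p = 0 := by
        have := hθd
        rw [hexp] at this
        simp only [omega_add, omega_smul, hθc, hθp, hθr, sform_add_left, sform_smul_left,
          sform_smul_right, hb.cp, hb.cr, hb.pr] at this
        linear_combination this
      rcases h01 (sform d r) with hr | hr <;> rcases h01 (sform d p) with hp | hp
      · rw [hr, hp, zero_smul, zero_smul, add_zero, add_zero] at hexp
        rcases h01 (sform d c') with h' | h' <;> rw [h'] at hexp
        · exact absurd (by rw [hexp, zero_smul]) hd
        · exact absurd (by rw [hexp, one_smul]) hcd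
      · rw [hr, hp, zero_smul, one_smul, add_zero] at hexp
        refine key r p ⟨hb.cc', by rw [sform_comm, hb.pr], hb.cr, hb.cp, hb.cr', hb.cp'⟩ hθr hθp
          _ hexp
      · rw [hr, hp, zero_smul, one_smul, add_zero] at hexp
        exact key p r hb hθp hθr _ hexp
      · rw [hr, hp, mul_one] at hθ
        exact absurd hθ one_ne_zero
    clear hexp hb hθc' hθp hθr
    have hc1 : sform p' c = 1 := by rw [sform_comm, hb'.cc']
    have hd1 : sform r' d = 1 := by rw [sform_comm, hb'.pr]
    have hrc : sform r' c = 0 := by rw [sform_comm, hb'.cr]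
    have hdc : sform d c = 0 := by rw [sform_comm, hb'.cp]
    -- When c and d span a totally singular plane, the generator is this product of three
    -- transvections, odd because each factor is.
    have hs : ∀ u, u ᵥ* (tv c 1 * tv d 1 * tv (c + d) 1).1 =
        u + sform u c • d + sform u d • c := fun u => by
      simp only [vecMul_mul_val, vecMul_tv, sform_add_left, sform_add_right, sform_smul_left,
        sform_self, hb'.cp, hdc]
      ext l
      simp only [Pi.add_apply, Pi.smul_apply, smul_eq_mul]
      linear_combination (sform u c * c l + sform u d * d l) * h2
    refine ⟨tv c 1 * tv d 1 * tv (c + d) 1, ?_, ?_, ?_, ?_, ⟨p', hθp', ?_⟩, fun x hx hxc hxd => ?_⟩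
    · rw [map_mul, map_mul, spSign_tv hF hc, spSign_tv hF hd,
        spSign_tv hF fun h => hcd (eq_of_vadd_eq_zero h)]
      decide
    · refine omega_ext fun u => ?_
      rw [spHom_apply_apply, hs]
      simp only [omega_add, omega_smul, sform_add_left, sform_smul_left, sform_smul_right, hθc, hθd,
        hdc]
      linear_combination sform u c * sform u d * h2
    · rw [hs, sform_self, hb'.cp, zero_smul, zero_smul, add_zero, add_zero]
    · rw [hs, sform_self, hdc, zero_smul, zero_smul, add_zero, add_zero]
    · rw [hs, hc1, hb'.cp', zero_smul, add_zero, one_smul]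
      exact fun h => hd (add_eq_left.mp h)
    · have e1 := hb'.expand (p' ᵥ* x.1)
      have e2 := hb'.expand (r' ᵥ* x.1)
      have g1 : sform (p' ᵥ* x.1) c = 1 := by rw [← hc1, ← sform_vecMul x p' c, hxc]
      have g2 : sform (p' ᵥ* x.1) d = 0 := by rw [← hb'.cp', ← sform_vecMul x p' d, hxd]
      have g3 : sform (r' ᵥ* x.1) c = 0 := by rw [← hrc, ← sform_vecMul x r' c, hxc]
      have g4 : sform (r' ᵥ* x.1) d = 1 := by rw [← hd1, ← sform_vecMul x r' d, hxd]
      rw [g1, g2] at e1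
      rw [g3, g4] at e2
      have f1 := hθx hx p'
      have f2 := hθx hx r'
      have f3 : sform (p' ᵥ* x.1) (r' ᵥ* x.1) = 0 := by rw [sform_vecMul, hb'.cr']
      -- The images of p' and r' are p' and r' plus combinations of c and d. The quadratic form
      -- kills A1 and B2, and orthogonality gives A2 = B1, so a single bit remains.
      generalize sform (p' ᵥ* x.1) p' = A1 at *
      generalize sform (p' ᵥ* x.1) r' = A2 at *
      generalize sform (r' ᵥ* x.1) p' = B1 at *
      generalize sform (r' ᵥ* x.1) r' = B2 at *
      rw [e1] at f1
      rw [e2] at f2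
      rw [e1, e2] at f3
      simp only [omega_add, omega_smul, sform_add_left, sform_add_right, sform_smul_left,
        sform_smul_right, hθc, hθd, hθp', hθr', hb'.cc', hb'.cp, hb'.cr, hb'.cp', hb'.cr', hb'.pr,
        hc1, hd1, hrc, hdc, sform_self, sform_comm r' p', sform_comm d p'] at f1 f2 f3
      have a1 : A1 = 0 := by linear_combination f1
      have b2 : B2 = 0 := by linear_combination f2
      have a2 : A2 = B1 := eq_of_add_eq_zero (by linear_combination f3)
      subst a1 b2 a2
      rcases h01 A2 with rfl | rfl
      · left
        refine hb'.ext ?_ ?_ ?_ ?_ <;> rw [vecMul_one_val]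
        · exact hxc
        · rw [e1]; simp
        · exact hxd
        · rw [e2]; simp
      · right
        refine hb'.ext ?_ ?_ ?_ ?_ <;> rw [hs]
        · rw [hxc, sform_self, hb'.cp]; simp
        · rw [e1, hc1, hb'.cp']; simp
        · rw [hxd, sform_self, hdc]; simp
        · rw [e2, hrc, hd1]; simp [add_comm]
  · have hcd1 := eq_one_of_ne_zero hF h
    obtain ⟨p', r', hb', hθp', hθr'⟩ : ∃ p' r', IsSympBasis c d p' r' ∧ θ.1 p' = 0 ∧
        θ.1 r' = 0 := by
      -- Adding multiples of c makes p and r orthogonal to d and keeps them singular. The generator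
      -- is then the transvection exchanging the two singular vectors of the plane orthogonal to c
      -- and d.
      refine ⟨p + sform d p • c, r + sform d r • c, ⟨hcd1, ?_, ?_, ?_, ?_, ?_⟩, ?_, ?_⟩
      · rw [sform_add_left, sform_add_right, sform_add_right, sform_smul_right, sform_smul_left,
          sform_smul_left, sform_smul_right, sform_self, hb.cr, hb.pr, sform_comm p c, hb.cp]
        ring
      · rw [sform_add_right, sform_smul_right, hb.cp, sform_self, mul_zero, add_zero]
      · rw [sform_add_right, sform_smul_right, hb.cr, sform_self, mul_zero, add_zero]
      · rw [sform_add_right, sform_smul_right, sform_comm d c, hcd1]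
        linear_combination sform d p * h2
      · rw [sform_add_right, sform_smul_right, sform_comm d c, hcd1]
        linear_combination sform d r * h2
      · rw [omega_add, omega_smul, sform_smul_right, hθp, hθc, sform_comm p c, hb.cp]
        ring
      · rw [omega_add, omega_smul, sform_smul_right, hθr, hθc, sform_comm r c, hb.cr]
        ring
    clear hexp hb hθc' hθp hθr
    have hv : θ.1 (p' + r') = 1 := by rw [omega_add, hθp', hθr', hb'.pr]; ring
    have hrp : sform r' p' = 1 := by rw [sform_comm, hb'.pr]
    have hpr : p' ≠ r' := fun h => by
      have := hb'.pr
      rw [h, sform_self] at this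
      exact zero_ne_one this
    have hs := otv_fix θ (p' + r')
    rw [otv, hv, inv_one] at hs
    have s1 : p' ᵥ* (tv (p' + r') (1 : F)).1 = r' := by
      have := vecMul_tv_add (u := p') (w := r') (by rw [hb'.pr]; exact one_ne_zero)
      rwa [hb'.pr, inv_one] at this
    have s2 : r' ᵥ* (tv (p' + r') (1 : F)).1 = p' := by
      have := vecMul_tv_add (u := r') (w := p') (by rw [hrp]; exact one_ne_zero)
      rwa [hrp, inv_one, add_comm] at this
    have s3 : c ᵥ* (tv (p' + r') (1 : F)).1 = c := vecMul_tv_of_sform_eq_zero _ (by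
      rw [sform_add_right, hb'.cp, hb'.cr, add_zero])
    have s4 : d ᵥ* (tv (p' + r') (1 : F)).1 = d := vecMul_tv_of_sform_eq_zero _ (by
      rw [sform_add_right, hb'.cp', hb'.cr', add_zero])
    refine ⟨tv (p' + r') 1, spSign_tv hF fun h => hpr (eq_of_vadd_eq_zero h), hs, s3, s4,
      ⟨p', hθp', by rw [s1]; exact hpr.symm⟩, fun x hx hxc hxd => ?_⟩
    have key : ∀ w, sform c w = 0 → sform d w = 0 → θ.1 w = 0 → w ≠ 0 → w ᵥ* x.1 = p' ∨
        w ᵥ* x.1 = r' := by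
      intro w hwc hwd hθw hw0
      have e := hb'.expand (w ᵥ* x.1)
      have g1 : sform (w ᵥ* x.1) c = 0 := by rw [← hwc, sform_comm c, ← sform_vecMul x w c, hxc]
      have g2 : sform (w ᵥ* x.1) d = 0 := by rw [← hwd, sform_comm d, ← sform_vecMul x w d, hxd]
      rw [g1, g2, zero_smul, zero_smul, zero_add, zero_add] at e
      have f1 := hθx hx w
      rw [hθw, e] at f1
      rw [omega_add, omega_smul, omega_smul, sform_smul_left, sform_smul_right, hθp', hθr', hb'.pr]
        at f1
      rcases h01 (sform (w ᵥ* x.1) r') with h1 | h1 <;>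
        rcases h01 (sform (w ᵥ* x.1) p') with h3 | h3 <;> rw [h1, h3] at e f1
      · refine absurd ?_ hw0
        rw [← vecMul_inv_cancel w x, e]
        simp
      · right
        rw [e]; simp
      · left
        rw [e]; simp
      · simp at f1
    have hp0 : p' ≠ 0 := fun h => by
      have := hb'.pr
      rw [h, sform_zero_left] at this
      exact zero_ne_one this
    have hr0 : r' ≠ 0 := fun h => by
      have := hb'.pr
      rw [h, sform_zero_right] at this
      exact zero_ne_one this
    have hne : p' ᵥ* x.1 ≠ r' ᵥ* x.1 := fun h => hpr (by
      rw [← vecMul_inv_cancel p' x, h, vecMul_inv_cancel])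
    rcases key p' hb'.cp hb'.cp' hθp' hp0 with h1 | h1 <;>
      rcases key r' hb'.cr hb'.cr' hθr' hr0 with h3 | h3
    · exact absurd (h1.trans h3.symm) hne
    · left
      refine hb'.ext ?_ ?_ ?_ ?_ <;> rw [vecMul_one_val] <;> assumption
    · right
      refine hb'.ext ?_ ?_ ?_ ?_
      · rw [hxc, s3]
      · rw [hxd, s4]
      · rw [h1, s1]
      · rw [h3, s2]
    · exact absurd (h1.trans h3.symm) hne

/-- Take the orthogonal transvections with the nonsingular centres p + r and p + r + c in c^⊥. Their
product is even, fixes θ and c, and moves c'. -/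
theorem exists_even_stabilizer (hF : Nat.card F = 2 ^ 1) {θ : Omega 2 F 0} {c : V 2 F}
    (hc : c ≠ 0) (hθc : θ.1 c = 0) :
    ∃ s : symplecticGroup (Fin 2) F, spSign F s = 1 ∧ spHom 2 F 0 s θ = θ ∧
      spHom 2 F 0 s (shift θ c) = shift θ c ∧ spHom 2 F 0 s ≠ 1 := by
  obtain ⟨c', p, r, hb, hθc', hθp, hθr⟩ := exists_hyperbolic_basis
    (fun x hx => eq_zero_of_tr_eq_zero hF hx) hc hθc
  have hv : θ.1 (p + r) = 1 := by rw [omega_add, hθp, hθr, hb.pr]; ring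
  have hcv : sform c (p + r) = 0 := by rw [sform_add_right, hb.cp, hb.cr, add_zero]
  have hcv' : sform c (p + r + c) = 0 := by rw [sform_add_right, hcv, sform_self, add_zero]
  have hv' : θ.1 (p + r + c) = 1 := by
    rw [omega_add, hv, hθc, sform_comm, hcv]
    ring
  have hnz : ∀ v, θ.1 v = 1 → v ≠ 0 := by
    rintro v hv rfl
    rw [omega_zero] at hv
    exact zero_ne_one hv
  have hfix : spHom 2 F 0 (otv θ (p + r) * otv θ (p + r + c)) θ = θ := by
    rw [map_mul, Equiv.Perm.mul_apply, otv_fix, otv_fix]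
  refine ⟨otv θ (p + r) * otv θ (p + r + c), ?_, hfix, ?_, fun h1 => ?_⟩
  · rw [map_mul, otv, otv, hv, hv', inv_one, spSign_tv hF (hnz _ hv), spSign_tv hF (hnz _ hv')]
    decide
  · rw [spHom_fix_shift_iff hfix (by rw [hθc, tr_zero]), vecMul_mul_val, otv, otv,
      vecMul_tv_of_sform_eq_zero _ hcv, vecMul_tv_of_sform_eq_zero _ hcv']
  · have h2 := (spHom_fix_shift_iff hfix (c := c') (by rw [hθc', tr_zero])).mp (by rw [h1]; rfl)
    have hcc : sform c' c = 1 := by rw [sform_comm, hb.cc']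
    have hcv : sform c' (p + r) = 0 := by rw [sform_add_right, hb.cp', hb.cr', add_zero]
    rw [vecMul_mul_val, otv, otv, vecMul_tv_of_sform_eq_zero (u := c') _ hcv, vecMul_tv, hv', inv_one,
      one_mul,
      sform_add_right, hcv, hcc, zero_add, one_smul, add_eq_left] at h2
    exact hnz _ hv' h2

/-- If G consists of even elements, two points have a nontrivial stabilizer and three have a trivial
one. If G is everything, three points have a stabilizer of order two, which disappears at any
further point that it moves. -/
theorem isIBIS_plus (hF : Nat.card F = 2 ^ 1) (G : Subgroup (Equiv.Perm (Omega 2 F 0)))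
    (hN : spDerivedPerms 2 F 0 ≤ G) (hGamma : G ≤ gammaSpPerms 2 F 0) : IsIBIS G := by
  have hcard := three_le_card_omega F 0
  have hrep : ∀ g ∈ G, ∃ x ∈ G.comap (spHom 2 F 0), g = spHom 2 F 0 x := fun g hg => by
    obtain ⟨x, rfl⟩ := exists_eq_spHom (eq_zero_or_one hF) (hGamma hg)
    exact ⟨x, hg, rfl⟩
  have hne : ∀ {θ : Omega 2 F 0} {c}, θ ≠ shift θ c → c ≠ 0 := fun {θ c} h hc =>
    h (by rw [hc, shift_zero])
  rcases even_or_eq_top hF (Subgroup.map_le_iff_le_comap.mp hN) with h | h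
  · refine isIBIS_of_forall_pair (by omega) (fun θ θ' hθ => ?_)
      fun θ θ' hθ θ'' k _ hk1 hk2 hk3 g hg hg1 hg2 hg3 => ?_
    · obtain ⟨c, hc, rfl⟩ := exists_eq_shift θ θ'
      have hθc := eq_zero_of_tr_eq_zero hF hc
      obtain ⟨s, hs1, hs2, hs3, hs4⟩ := exists_even_stabilizer hF (hne hθ) hθc
      exact ⟨_, hN ⟨s, mem_commutator_of_spSign hF hs1, rfl⟩, hs2, hs3, hs4⟩
    · obtain ⟨c, hc, rfl⟩ := exists_eq_shift θ θ'
      obtain ⟨d, hd, rfl⟩ := exists_eq_shift θ θ''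
      obtain ⟨x, hx, rfl⟩ := hrep g hg
      obtain ⟨s, hs, -, -, -, -, hall⟩ := exists_stabilizer_generator hF (θ := θ) (c := c) (d := d)
        (hne hθ) (hne fun h => hk3 (by rw [← h, hk1])) (fun h => hk3 (by rw [← h, hk2]))
        (eq_zero_of_tr_eq_zero hF hc) (eq_zero_of_tr_eq_zero hF hd)
      rcases hall x hg1 ((spHom_fix_shift_iff hg1 hc).mp hg2)
        ((spHom_fix_shift_iff hg1 hd).mp hg3) with rfl | rfl
      · exact map_one _
      · rw [h x hx] at hs
        exact absurd hs (by decide)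
  · have htop : ∀ x, spHom 2 F 0 x ∈ G := fun x => by
      have : x ∈ G.comap (spHom 2 F 0) := h ▸ Subgroup.mem_top x
      exact this
    have key : ∀ ω : Fin 3 → Omega 2 F 0, Function.Injective ω → ∃ s, spHom 2 F 0 s ≠ 1 ∧
        (∀ i, spHom 2 F 0 s (ω i) = ω i) ∧
        ∀ g ∈ G, (∀ i, g (ω i) = ω i) → g = 1 ∨ g = spHom 2 F 0 s := by
      intro ω hω
      obtain ⟨c, hc, h1⟩ := exists_eq_shift (ω 0) (ω 1)
      obtain ⟨d, hd, h2⟩ := exists_eq_shift (ω 0) (ω 2)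
      obtain ⟨s, -, hs1, hs2, hs3, ⟨e, he, hse⟩, hall⟩ := exists_stabilizer_generator hF (θ := ω 0)
        (c := c) (d := d) (hne (by rw [← h1]; exact hω.ne (by decide)))
        (hne (by rw [← h2]; exact hω.ne (by decide)))
        (fun h => hω.ne (show (1 : Fin 3) ≠ 2 by decide) (by rw [h1, h2, h]))
        (eq_zero_of_tr_eq_zero hF hc) (eq_zero_of_tr_eq_zero hF hd)
      refine ⟨s, fun h => hse ?_, fun i => ?_, fun g hg hgf => ?_⟩
      · exact (spHom_fix_shift_iff hs1 (by rw [he, tr_zero])).mp (by rw [h]; rfl)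
      · fin_cases i
        · exact hs1
        · change spHom 2 F 0 s (ω 1) = ω 1
          rw [h1]
          exact (spHom_fix_shift_iff hs1 hc).mpr hs2
        · change spHom 2 F 0 s (ω 2) = ω 2
          rw [h2]
          exact (spHom_fix_shift_iff hs1 hd).mpr hs3
      · obtain ⟨x, hx, rfl⟩ := hrep g hg
        have g1 := hgf 1
        have g2 := hgf 2
        rw [h1] at g1
        rw [h2] at g2
        rcases hall x (hgf 0) ((spHom_fix_shift_iff (hgf 0) hc).mp g1)
          ((spHom_fix_shift_iff (hgf 0) hd).mp g2) with rfl | rfl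
        · exact Or.inl (map_one _)
        · exact Or.inr rfl
    refine isIBIS_of_forall_injective 3 hcard (fun ω hω => ?_)
      fun ω hω a k hk hkf hka g hg hgf hga => ?_
    · obtain ⟨s, hs1, hs2, -⟩ := key ω hω
      exact ⟨_, htop s, hs2, hs1⟩
    · obtain ⟨s, hs1, hs2, hall⟩ := key ω hω
      refine (hall g hg hgf).resolve_right fun hgs => ?_
      rcases hall k hk hkf with rfl | rfl
      · exact hka rfl
      · rw [hgs] at hga
        exact hka hga

end TenPoints

theorem isIBIS_four_two {F : Type*} [Field F] [Algebra (ZMod 2) F] [Finite F]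
    (hF : Nat.card F = 2 ^ 1) (t : ZMod 2) (G : Subgroup (Equiv.Perm (Omega 2 F t)))
    (hN : spDerivedPerms 2 F t ≤ G) (hGamma : G ≤ gammaSpPerms 2 F t) : IsIBIS G := by
  have h2 : ∀ t : ZMod 2, t = 0 ∨ t = 1 := by decide
  rcases h2 t with rfl | rfl
  · exact isIBIS_plus hF G hN hGamma
  · exact isIBIS_minus hF G hN hGamma

/-! ### Galois theory and elements of trace zero -/

section Automorphisms

variable {F : Type*} [Field F] [Algebra (ZMod 2) F] [Finite F] {f : ℕ}

theorem tr_algEquiv (σ : F ≃ₐ[ZMod 2] F) (x : F) : tr (σ x) = tr x :=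
  Algebra.trace_eq_of_algEquiv σ x

theorem card_algEquiv (hF : Nat.card F = 2 ^ f) : Nat.card (F ≃ₐ[ZMod 2] F) = f := by
  rw [IsGalois.card_aut_eq_finrank, finrank_eq hF]

theorem eq_zero_or_one_of_fixed {z : F} (h : ∀ τ : F ≃ₐ[ZMod 2] F, τ z = z) : z = 0 ∨ z = 1 := by
  obtain ⟨k, rfl⟩ := IntermediateField.mem_bot.mp ((IsGalois.mem_bot_iff_fixed z).mpr h)
  have h2 : ∀ k : ZMod 2, k = 0 ∨ k = 1 := by decide
  rcases h2 k with rfl | rfl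
  · exact Or.inl (map_zero _)
  · exact Or.inr (map_one _)

theorem fixed_of_mem_zpowers {σ τ : F ≃ₐ[ZMod 2] F} {z : F} (hz : σ z = z)
    (h : τ ∈ Subgroup.zpowers σ) : τ z = z := by
  have : Subgroup.zpowers σ ≤ MulAction.stabilizer (F ≃ₐ[ZMod 2] F) z :=
    (Subgroup.zpowers_le).mpr hz
  exact this h

theorem zpowers_eq_top_of_fixed {σ : F ≃ₐ[ZMod 2] F} (h : ∀ z, σ z = z → z = 0 ∨ z = 1) :
    Subgroup.zpowers σ = ⊤ := by
  have : IntermediateField.fixedField (Subgroup.zpowers σ) = ⊥ := by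
    rw [eq_bot_iff]
    intro z hz
    rw [IntermediateField.mem_fixedField_iff] at hz
    rcases h z (hz σ (Subgroup.mem_zpowers σ)) with rfl | rfl
    · exact zero_mem _
    · exact one_mem _
  rw [← IntermediateField.fixingSubgroup_fixedField (Subgroup.zpowers σ), this,
    IntermediateField.fixingSubgroup_bot]

theorem eq_zero_or_one_of_prime (hF : Nat.card F = 2 ^ f) (hf : f.Prime) {σ : F ≃ₐ[ZMod 2] F}
    (hσ : σ ≠ 1) {z : F} (hz : σ z = z) : z = 0 ∨ z = 1 := by
  have := Fact.mk hf
  exact eq_zero_or_one_of_fixed fun τ =>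
    fixed_of_mem_zpowers hz (mem_zpowers_of_prime_card (card_algEquiv hF) hσ)

/-- If no nonzero element of trace zero is fixed by a nontrivial element of a nontrivial group of
field automorphisms, then the degree is an odd prime and the group contains all automorphisms. -/
theorem prime_of_forall_fixed (hF : Nat.card F = 2 ^ f) {K : Subgroup (F ≃ₐ[ZMod 2] F)}
    (hK : ∃ σ ∈ K, σ ≠ 1)
    (h : ∀ σ ∈ K, σ ≠ 1 → ∀ d, σ d = d → tr d = 0 → d = 0) : f.Prime ∧ Odd f ∧ K = ⊤ := by
  obtain ⟨σ, hσ, hσ1⟩ := hK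
  have h1 : tr (1 : F) = 1 := (tr_eq_zero_or (1 : F)).resolve_left fun h1 =>
    one_ne_zero (h σ hσ hσ1 1 (map_one σ) h1)
  -- Since Tr 1 = 1, an element z fixed by τ has z or z + 1 of trace zero, so z is 0 or 1 and τ
  -- generates the Galois group. Applied to an element of prime order p, this gives f = p.
  have key : ∀ τ ∈ K, τ ≠ 1 → Subgroup.zpowers τ = ⊤ := fun τ hτ hτ1 =>
    zpowers_eq_top_of_fixed fun z hz => by
      rcases tr_eq_zero_or z with hz0 | hz1
      · exact Or.inl (h τ hτ hτ1 z hz hz0)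
      · refine Or.inr (eq_of_add_eq_zero (h τ hτ hτ1 _ (by rw [map_add, hz, map_one]) ?_))
        rw [tr_add, hz1, h1]
        decide
  have hKtop : K = ⊤ := by
    rw [eq_top_iff, ← key σ hσ hσ1]
    exact (Subgroup.zpowers_le).mpr hσ
  have hodd : Odd f := by
    rw [tr_one hF] at h1
    exact ZMod.natCast_eq_one_iff_odd.mp h1
  have hf1 : f ≠ 1 := by
    rintro rfl
    exact hσ1 (algEquiv_eq_one (eq_zero_or_one hF) σ)
  obtain ⟨p, hp, hpf⟩ := Nat.exists_prime_and_dvd hf1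
  have := Fact.mk hp
  obtain ⟨τ, hτ⟩ := exists_prime_orderOf_dvd_card' (G := F ≃ₐ[ZMod 2] F) p
    (by rw [card_algEquiv hF]; exact hpf)
  have hτ1 : τ ≠ 1 := by
    rintro rfl
    rw [orderOf_one] at hτ
    exact hp.one_lt.ne hτ
  have h3 := Nat.card_zpowers τ
  rw [key τ (hKtop ▸ Subgroup.mem_top τ) hτ1, Subgroup.card_top, card_algEquiv hF, hτ] at h3
  exact ⟨h3 ▸ hp, hodd, hKtop⟩

/-- Otherwise every element moved by σ gives trace one, so the sum of two moved elements is fixed.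
For fixed x ≠ 0 and moved k, both xk and k are moved, so (x + 1)k is fixed and x = 1. The moved
elements then lie in k + {0, 1}, and the field has at most four elements. -/
theorem exists_tr_sq_mul_eq_zero (hF : Nat.card F = 2 ^ f) (hf : 3 ≤ f) {σ : F ≃ₐ[ZMod 2] F}
    (hσ : σ ≠ 1) (d : F) : ∃ l : F, tr (l ^ 2 * d) = 0 ∧ σ l ≠ l := by
  have := charTwo F
  by_contra! hcon
  obtain ⟨k, hk⟩ : ∃ k, σ k ≠ k := by
    by_contra! h
    exact hσ (AlgEquiv.ext h)
  have hadd : ∀ x y, σ x ≠ x → σ y ≠ y → σ (x + y) = x + y := fun x y hx hy => by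
    have hx1 := (tr_eq_zero_or (x ^ 2 * d)).resolve_left fun h => hx (hcon x h)
    have hy1 := (tr_eq_zero_or (y ^ 2 * d)).resolve_left fun h => hy (hcon y h)
    refine hcon _ ?_
    rw [CharTwo.add_sq, add_mul, tr_add, hx1, hy1]
    decide
  have hfix : ∀ x, σ x = x → x = 0 ∨ x = 1 := fun x hx => by
    by_cases hx0 : x = 0
    · exact Or.inl hx0
    right
    have h1 : σ (x * k) ≠ x * k := fun h => by
      rw [map_mul, hx] at h
      exact hk (mul_left_cancel₀ hx0 h)
    have h2 := hadd _ _ h1 hk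
    have h3 : (x + 1) * (σ k - k) = 0 := by
      rw [map_add, map_mul, hx] at h2
      linear_combination h2
    exact eq_of_add_eq_zero ((mul_eq_zero.mp h3).resolve_right (sub_ne_zero.mpr hk))
  classical
  obtain ⟨x, hx⟩ := exists_not_mem_of_card hF {0, 1, k, k + 1} (lt_of_le_of_lt Finset.card_le_four
    (calc 4 < 2 ^ 3 := by norm_num
      _ ≤ 2 ^ f := Nat.pow_le_pow_right two_pos hf))
  simp only [Finset.mem_insert, Finset.mem_singleton, not_or] at hx
  have hx1 : σ x ≠ x := fun h => (hfix x h).elim hx.1 hx.2.1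
  rcases hfix _ (hadd x k hx1 hk) with h | h
  · exact hx.2.2.1 (eq_of_add_eq_zero h)
  · exact hx.2.2.2 (by linear_combination h - k * add_self (1 : F))

end Automorphisms

/-! ### Dimension two: groups that are not IBIS -/

section DimensionTwo

variable {F : Type*} [Field F] [Algebra (ZMod 2) F] [Finite F] {t : ZMod 2} {f : ℕ}

theorem eq_vec_zero (u : V 1 F) : u = vec 0 (u (Sum.inl 0)) (u (Sum.inr 0)) := by
  conv_lhs => rw [eq_sum_vec u, Fin.sum_univ_one]

theorem sform_one (u v : V 1 F) :
    sform u v = u (Sum.inr 0) * v (Sum.inl 0) - u (Sum.inl 0) * v (Sum.inr 0) := by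
  rw [sform_eq, Fin.sum_univ_one]

theorem eq_smul_add_smul {c u : V 1 F} (h : sform u c ≠ 0) (z : V 1 F) :
    z = (sform z u / sform u c) • c + (sform z c / sform u c) • u := by
  have h2 := add_self (1 : F)
  rw [sform_one] at h
  rw [sform_one u c, sform_one z u, sform_one z c]
  ext j
  simp only [Pi.add_apply, Pi.smul_apply, smul_eq_mul]
  rw [div_mul_eq_mul_div, div_mul_eq_mul_div, ← add_div, eq_div_iff h]
  rcases j with j | j <;> rw [Subsingleton.elim j 0]
  · linear_combination (z (Sum.inl 0) * (u (Sum.inr 0) * c (Sum.inl 0) -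
      u (Sum.inl 0) * c (Sum.inr 0)) - z (Sum.inr 0) * u (Sum.inl 0) * c (Sum.inl 0) +
      z (Sum.inl 0) * u (Sum.inl 0) * c (Sum.inr 0)) * h2
  · linear_combination (z (Sum.inl 0) * u (Sum.inr 0) * c (Sum.inr 0) -
      z (Sum.inr 0) * u (Sum.inl 0) * c (Sum.inr 0)) * h2

theorem eq_of_vecMul_eq {c u : V 1 F} (h : sform u c ≠ 0) {x y : symplecticGroup (Fin 1) F}
    (hc : c ᵥ* x.1 = c ᵥ* y.1) (hu : u ᵥ* x.1 = u ᵥ* y.1) : x = y := by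
  refine symplectic_ext fun z => ?_
  rw [eq_smul_add_smul h z, add_vecMul, add_vecMul, smul_vecMul, smul_vecMul, smul_vecMul,
    smul_vecMul, hc, hu]

/-- The stabilizer of a form and of a vector is generated by a transvection. -/
theorem eq_one_or_eq_otv {θ : Omega 1 F t} {c : V 1 F} (hc : c ≠ 0)
    {x : symplecticGroup (Fin 1) F} (hx : spHom 1 F t x θ = θ) (hxc : c ᵥ* x.1 = c) :
    x = 1 ∨ x = otv θ c := by
  obtain ⟨u, hu⟩ := exists_sform_ne_zero hc
  have h1 : sform (u ᵥ* x.1) c = sform u c := by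
    conv_lhs => rw [← hxc]
    exact sform_vecMul x u c
  have h2 := eq_smul_add_smul hu (u ᵥ* x.1)
  rw [h1, div_self hu, one_smul] at h2
  have h3 : θ.1 (u ᵥ* x.1) = θ.1 u := by rw [← spHom_apply_apply, hx]
  generalize sform (u ᵥ* x.1) u / sform u c = l at h2
  rw [h2, omega_add, omega_smul, sform_smul_left, sform_comm c u] at h3
  -- The image of u is u + l c, and preservation of θ is a quadratic equation for l: the root 0 is
  -- the identity, the other the transvection.
  have h4 : l * (l * θ.1 c + sform u c) = 0 := by linear_combination h3
  rcases mul_eq_zero.mp h4 with hl | hl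
  · left
    refine eq_of_vecMul_eq hu (by rw [hxc, vecMul_one_val]) ?_
    rw [h2, hl, zero_smul, zero_add, vecMul_one_val]
  · right
    have hl2 := eq_of_add_eq_zero hl
    have h0 : θ.1 c ≠ 0 := fun h0 => hu (by rw [← hl2, h0, mul_zero])
    refine eq_of_vecMul_eq hu ?_ ?_
    · rw [hxc, otv, vecMul_tv_of_sform_eq_zero _ (sform_self c)]
    · rw [h2, otv, vecMul_tv, ← hl2, mul_comm l, inv_mul_cancel_left₀ h0, add_comm]

theorem omega_ne_zero (θ : Omega 1 F 1) {c : V 1 F} (hc : c ≠ 0) : θ.1 c ≠ 0 := by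
  intro h
  obtain ⟨a, ha, rfl⟩ := exists_eq_thetaPt θ
  rw [thetaPt_apply, sform_one, theta0, Fin.sum_univ_one] at h
  rw [theta0, Fin.sum_univ_one] at ha
  obtain ⟨h1, h2⟩ := eq_zero_of_anisotropic ha h
  refine hc ?_
  rw [eq_vec_zero c, h1, h2, ← zero_smul F (vec 0 0 0), smul_vec, zero_mul]

theorem exists_shift_moved (hF : Nat.card F = 2 ^ f) (hf : 2 ≤ f) (θ : Omega 1 F t)
    {c : V 1 F} (hc : c ≠ 0) : ∃ d, tr (θ.1 d) = 0 ∧ sform d c ≠ 0 := by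
  obtain ⟨u, hu⟩ := exists_sform_ne_zero hc
  obtain ⟨p, hp, hp'⟩ := exists_smul_tr_eq_zero hF hf θ u
  exact ⟨p • u, hp', by rw [sform_smul_left]; exact mul_ne_zero hp hu⟩

theorem spHom_otv_ne_one (hF : Nat.card F = 2 ^ f) (hf : 2 ≤ f) {θ : Omega 1 F t}
    {c : V 1 F} (hc : θ.1 c ≠ 0) : spHom 1 F t (otv θ c) ≠ 1 := by
  intro h
  obtain ⟨d, hd, hdc⟩ := exists_shift_moved hF hf θ
    (c := c) (by rintro rfl; exact hc (omega_zero θ))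
  exact hdc ((otv_fix_shift_iff θ hc hd).mp (by rw [h]; rfl))

theorem two_le_card_omega (hF : Nat.card F = 2 ^ f) (hf : 2 ≤ f) (t : ZMod 2) :
    2 ≤ Nat.card (Omega 1 F t) := by
  obtain ⟨a, b, hab, -⟩ := exists_type (F := F) t
  have ht : tr (theta0 (vec 0 a b : V 1 F)) = t := by rw [theta0_vec, hab]
  obtain ⟨p, hp, hp'⟩ := exists_smul_tr_eq_zero hF hf (thetaPt _ ht) (vec 0 1 0)
  have := shift_ne_self hp' (smul_ne_zero hp (vec_ne_zero_left 0 0 one_ne_zero))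
  exact (Finite.one_lt_card_iff_nontrivial).mpr ⟨_, _, this⟩

theorem autHom_thetaPt_apply (σ : F ≃ₐ[ZMod 2] F) (a : V 1 F) (h : tr (theta0 a) = t) (u : V 1 F) :
    (autHom 1 F t σ (thetaPt a h)).1 u = theta0 u + sform u (σ ∘ a) ^ 2 := by
  change σ (theta0 (σ.symm ∘ u) + sform (σ.symm ∘ u) a ^ 2) = _
  have e : σ ∘ (σ.symm ∘ u) = u := by ext; simp
  rw [map_add, map_pow, ← theta0_map, ← sform_map, e]

theorem comp_vec' (σ : F ≃ₐ[ZMod 2] F) (x y : F) :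
    σ ∘ (vec 0 x y : V 1 F) = vec 0 (σ x) (σ y) := comp_vec σ.toRingEquiv 0 x y

theorem comp_smul (σ : F ≃ₐ[ZMod 2] F) (c : F) (u : V 1 F) : σ ∘ (c • u) = σ c • (σ ∘ u) := by
  ext
  simp

theorem autHom_fix_shift_iff {σ : F ≃ₐ[ZMod 2] F} {θ : Omega 1 F t}
    (h : autHom 1 F t σ θ = θ) {c : V 1 F} (hc : tr (θ.1 c) = 0) :
    autHom 1 F t σ (shift θ c) = shift θ c ↔ σ ∘ c = c := by
  have := fix_shift_iff (x := 1) (σ := σ) (θ := θ) (by rw [map_one, one_mul, h]) hc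
  rw [map_one, one_mul, vecMul_one_val] at this
  rw [this, eq_comm]

variable (F) in
/-- The form `x y`. -/
def hyp : Omega 1 F 0 := thetaPt (vec 0 0 0) (by rw [theta0_vec, mul_zero, tr_zero])

theorem hyp_apply (x y : F) : (hyp F).1 (vec 0 x y) = x * y := by
  rw [hyp, thetaPt_vec]
  ring

theorem autHom_hyp (σ : F ≃ₐ[ZMod 2] F) : autHom 1 F 0 σ (hyp F) = hyp F := omega_ext fun u => by
  rw [hyp, autHom_thetaPt_apply, comp_vec', map_zero, thetaPt_apply]

theorem hyp_vec_one_zero : (hyp F).1 (vec 0 1 0) = 0 := by rw [hyp_apply, mul_zero]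

theorem eq_one_of_fix_hyp {x : symplecticGroup (Fin 1) F} (h : spHom 1 F 0 x (hyp F) = hyp F)
    (hx : vec 0 1 0 ᵥ* x.1 = vec 0 1 0) : x = 1 :=
  eq_one_of_fix 0 h hyp_vec_one_zero hx fun j hj => absurd (Subsingleton.elim j 0) hj

/-- A semilinear isometry which fixes `hyp` and `vec 0 1 0` is a field automorphism. -/
theorem eq_one_of_fix_hyp_semilinear {x : symplecticGroup (Fin 1) F} {σ : F ≃ₐ[ZMod 2] F}
    (h : (spHom 1 F 0 x * autHom 1 F 0 σ) (hyp F) = hyp F)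
    (hx : (spHom 1 F 0 x * autHom 1 F 0 σ) (shift (hyp F) (vec 0 1 0)) =
      shift (hyp F) (vec 0 1 0)) : x = 1 := by
  rw [fix_shift_iff h (by rw [hyp_vec_one_zero, tr_zero]), comp_vec', map_one, map_zero] at hx
  rw [Equiv.Perm.mul_apply, autHom_hyp] at h
  exact eq_one_of_fix_hyp h hx

section NotIBIS

variable {G : Subgroup (Equiv.Perm (Omega 1 F t))}

/-- After `hyp`, the linear group admits two irredundant steps if the first vector is nonsingular,
whereas the singular vector (1, 0) alone leaves only field automorphisms. -/
theorem irr_hyp (hF : Nat.card F = 2 ^ f) (hf : 2 ≤ f)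
    {G : Subgroup (Equiv.Perm (Omega 1 F 0))} (hSp : ∀ x, spHom 1 F 0 x ∈ G) {d : F}
    (hd : d ≠ 0) (hdt : tr d = 0) :
    Irr (listStab G [hyp F]) [shift (hyp F) (vec 0 d 1), shift (hyp F) (vec 0 1 0)] := by
  obtain ⟨c, hc0, hc1⟩ := exists_ne_zero_ne_one hF hf
  refine irr_map_shift (hyp F) [(vec 0 d 1, vec 0 (c * d) 1), (vec 0 1 0, vec 0 d 1)] _ ?_ ?_ ?_
  · intro p _
    rw [mem_listStab]
    exact ⟨hSp _, by simpa using otv_fix _ _⟩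
  · intro p hp
    simp only [List.mem_cons, List.not_mem_nil, or_false] at hp
    rcases hp with rfl | rfl
    · refine ⟨by rw [hyp_apply, mul_one, hdt], ?_, ?_⟩
      · rw [hyp_apply, mul_one]
        exact mul_ne_zero hc0 hd
      · rw [sform_vec_self, mul_one, one_mul, sub_ne_zero]
        exact fun h => hc1 (mul_right_cancel₀ hd (by rw [h, one_mul]))
    · refine ⟨by rw [hyp_apply, mul_zero, tr_zero], ?_, ?_⟩
      · rwa [hyp_apply, mul_one]
      · rw [sform_vec_self]
        simp
  · simp [sform_self]

theorem not_isIBIS_hyp_of_trivial (hF : Nat.card F = 2 ^ f) (hf : 2 ≤ f)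
    {G : Subgroup (Equiv.Perm (Omega 1 F 0))} (hSp : ∀ x, spHom 1 F 0 x ∈ G)
    (hGamma : G ≤ gammaSpPerms 1 F 0) (hK : ∀ σ, autHom 1 F 0 σ ∈ G → σ = 1) : ¬ IsIBIS G := by
  obtain ⟨d, hd, hdt⟩ := exists_ne_zero_tr_eq_zero hF hf
  refine not_isIBIS [hyp F] [shift (hyp F) (vec 0 1 0)] _ (fun g hg hfix => ?_)
    (irr_hyp hF hf hSp hd hdt) (by simp)
  rw [mem_listStab] at hg
  obtain ⟨x, σ, rfl⟩ := exists_eq_of_mem_gammaSpPerms (hGamma hg.1)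
  have hσ := hK σ ((mul_mem_cancel_left (hSp x)).mp hg.1)
  have hx := eq_one_of_fix_hyp_semilinear (hg.2 _ (by simp)) (hfix _ (by simp))
  rw [hσ, hx, map_one, map_one, one_mul]

/-- After `hyp`, the points of (1, 0) and (η, 0) form a base, as η generates the field. But σ fixes
the points of (d, 1) and (1, 0) and moves that of (η, 0), which gives an irredundant sequence of
three. -/
theorem not_isIBIS_hyp_of_fixed (hF : Nat.card F = 2 ^ f) (hf : 2 ≤ f)
    {G : Subgroup (Equiv.Perm (Omega 1 F 0))} (hSp : ∀ x, spHom 1 F 0 x ∈ G)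
    (hGamma : G ≤ gammaSpPerms 1 F 0) {σ : F ≃ₐ[ZMod 2] F} (hσ : σ ≠ 1)
    (hσG : autHom 1 F 0 σ ∈ G) {d : F} (hd : d ≠ 0) (hσd : σ d = d) (hdt : tr d = 0) :
    ¬ IsIBIS G := by
  obtain ⟨η, -, hη⟩ := exists_generator F
  have hηt : tr ((hyp F).1 (vec 0 η 0)) = 0 := by rw [hyp_apply, mul_zero, tr_zero]
  refine not_isIBIS [hyp F] [shift (hyp F) (vec 0 1 0), shift (hyp F) (vec 0 η 0)]
    ([shift (hyp F) (vec 0 d 1), shift (hyp F) (vec 0 1 0)] ++ [shift (hyp F) (vec 0 η 0)])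
    (fun g hg hfix => ?_) (irr_append.mpr ⟨irr_hyp hF hf hSp hd hdt, ?_⟩) (by simp)
  · rw [mem_listStab] at hg
    obtain ⟨x, τ, rfl⟩ := exists_eq_of_mem_gammaSpPerms (hGamma hg.1)
    have h0 := hg.2 _ (List.mem_singleton_self _)
    have h1 := hfix (shift (hyp F) (vec 0 1 0)) (by simp)
    have hx := eq_one_of_fix_hyp_semilinear h0 h1
    have h2 := (fix_shift_iff h0 hηt).mp (hfix (shift (hyp F) (vec 0 η 0)) (by simp))
    rw [hx, vecMul_one_val, comp_vec', map_zero] at h2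
    have h3 : τ = 1 := hη τ (by
      have := congrFun h2 (Sum.inl 0)
      simpa [vec_inl] using this.symm)
    rw [hx, h3, map_one, map_one, one_mul]
  · refine ⟨⟨autHom 1 F 0 σ, ?_, ?_⟩, trivial⟩
    · rw [mem_listStab, mem_listStab]
      refine ⟨⟨hσG, by simpa using autHom_hyp σ⟩, ?_⟩
      simp only [List.mem_cons, List.not_mem_nil, or_false, forall_eq_or_imp, forall_eq]
      constructor
      · rw [autHom_fix_shift_iff (autHom_hyp σ) (by rw [hyp_apply, mul_one, hdt]), comp_vec', hσd,
          map_one]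
      · rw [autHom_fix_shift_iff (autHom_hyp σ) (by rw [hyp_vec_one_zero, tr_zero]), comp_vec',
          map_one, map_zero]
    · rw [Ne, autHom_fix_shift_iff (autHom_hyp σ) hηt, comp_vec', map_zero]
      intro h
      refine hσ (hη σ ?_)
      have := congrFun h (Sum.inl 0)
      simpa [vec_inl] using this

/-- A form θ with θ(e) = d is chosen, where e = (1, 0). The points of e, le and a vector v not
orthogonal to e are irredundant: e is moved by a transvection, le by a semilinear map fixing e, and
v by the transvection with centre e. Two points from `exists_plane_base` already form a base in the
stabilizer of θ. -/
theorem not_isIBIS_minus_of_fixed (hF : Nat.card F = 2 ^ f) (hf : 3 ≤ f)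
    {G : Subgroup (Equiv.Perm (Omega 1 F 1))} (hSp : ∀ x, spHom 1 F 1 x ∈ G)
    (hGamma : G ≤ gammaSpPerms 1 F 1) {σ : F ≃ₐ[ZMod 2] F} (hσ : σ ≠ 1)
    (hσG : autHom 1 F 1 σ ∈ G) {d : F} (hd : d ≠ 0) (hσd : σ d = d) (hdt : tr d = 0) :
    ¬ IsIBIS G := by
  have hf2 : 2 ≤ f := by omega
  have h2 := add_self (1 : F)
  obtain ⟨b, rfl⟩ := exists_sq_eq d
  have hb : b ≠ 0 := fun h => hd (by rw [h, zero_pow two_ne_zero])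
  have hσb : σ b = b := sq_injective (by rw [← map_pow, hσd])
  obtain ⟨a, hab⟩ := exists_tr_mul b hb
  have ht : tr (theta0 (vec 0 a b : V 1 F)) = 1 := by rw [theta0_vec, hab]
  obtain ⟨x, y, x', y', hD, hx, hx', hplane⟩ := exists_plane_base hF hf2 0 (Or.inr hab) ht
  obtain ⟨l, hl, hσl⟩ := exists_tr_sq_mul_eq_zero hF hf hσ (b ^ 2)
  have hθe : (thetaPt (vec 0 a b : V 1 F) ht).1 (vec 0 1 0) = b ^ 2 := by
    rw [thetaPt_vec]
    ring
  -- Applying σ changes the label (a, b) to (σ(a), b), and a transvection with centre e must undo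
  -- this. Its coefficient n solves an Artin–Schreier equation, solvable because Tr(ba) = Tr(bσ(a)).
  obtain ⟨n, hn⟩ : ∃ n : F, n + n ^ 2 * b ^ 2 = (a + σ a) ^ 2 := by
    obtain ⟨n, hn⟩ := exists_sq_add_self_eq (y := b ^ 2 * (a + σ a) ^ 2) (by
      rw [← mul_pow, tr_sq, mul_add, tr_add, ← tr_algEquiv σ (b * a), map_mul, hσb]
      generalize tr (b * σ a) = z
      revert z
      decide)
    refine ⟨n / b ^ 2, mul_left_cancel₀ (pow_ne_zero 2 hb) ?_⟩
    rw [← hn]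
    field_simp
  have hg : (spHom 1 F 1 (tv (vec 0 1 0) n) * autHom 1 F 1 σ) (thetaPt (vec 0 a b) ht) =
      thetaPt (vec 0 a b) ht := by
    refine omega_ext fun u => ?_
    rw [Equiv.Perm.mul_apply, spHom_tv_apply, autHom_thetaPt_apply, autHom_thetaPt_apply,
      thetaPt_apply, comp_vec', hσb, sform_vec_self, sform_vec_right, sform_vec_right,
      sform_vec_right, theta0_vec]
    linear_combination u (Sum.inr 0) ^ 2 * hn +
      (u (Sum.inr 0) ^ 2 * (a * σ a + (σ a) ^ 2) - u (Sum.inr 0) * u (Sum.inl 0) * b * (σ a - a)) *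
        h2
  have hθl : tr ((thetaPt (vec 0 a b : V 1 F) ht).1 (l • vec 0 1 0)) = 0 := by
    rw [omega_smul, hθe, hl]
  have hθe' : tr ((thetaPt (vec 0 a b : V 1 F) ht).1 (vec 0 1 0)) = 0 := by rw [hθe, hdt]
  generalize thetaPt (vec 0 a b : V 1 F) ht = θ at *
  have he0 : (vec 0 1 0 : V 1 F) ≠ 0 := vec_ne_zero_left 0 0 one_ne_zero
  obtain ⟨v, hv, hve⟩ := exists_shift_moved hF hf2 θ he0
  have hv0 : v ≠ 0 := by
    rintro rfl
    exact hve (sform_zero_left _)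
  have hθe0 := omega_ne_zero θ he0
  refine not_isIBIS [θ] [shift θ (vec 0 x y), shift θ (vec 0 x' y')]
    [shift θ (vec 0 1 0), shift θ (l • vec 0 1 0), shift θ v] (fun g hg hfix => ?_)
    ⟨⟨spHom 1 F 1 (otv θ v), ?_, ?_⟩,
      ⟨spHom 1 F 1 (tv (vec 0 1 0) n) * autHom 1 F 1 σ, ?_, ?_⟩,
      ⟨spHom 1 F 1 (otv θ (vec 0 1 0)), ?_, ?_⟩, trivial⟩ (by simp)
  · rw [mem_listStab] at hg
    obtain ⟨s, τ, rfl⟩ := exists_eq_of_mem_gammaSpPerms (hGamma hg.1)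
    have h0 := hg.2 _ (List.mem_singleton_self _)
    have h1 := (fix_shift_iff h0 hx).mp (hfix (shift θ (vec 0 x y)) (by simp))
    have h2 := (fix_shift_iff h0 hx').mp (hfix (shift θ (vec 0 x' y')) (by simp))
    have hτ : τ = 1 := by
      refine hplane τ (apply_vecMul_of_fix h0 h1) (apply_vecMul_of_fix h0 h2) ?_
      rw [← sform_vec_self (0 : Fin 1)]
      exact sform_fix h1 h2
    subst hτ
    have hs : s = 1 := symplectic_ext fun u => by
      rw [vecMul_one_val, eq_vec_zero u]
      exact vecMul_vec_of_fix hD h1 h2 _ _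
    rw [hs, map_one, map_one, one_mul]
  · rw [mem_listStab]
    exact ⟨hSp _, by simpa using otv_fix θ v⟩
  · rw [Ne, otv_fix_shift_iff θ (omega_ne_zero θ hv0) hθe', sform_comm]
    exact hve
  · refine ⟨mem_listStab.mpr ⟨mul_mem (hSp _) hσG, by simpa using hg⟩, ?_⟩
    refine (fix_shift_iff hg hθe').mpr ?_
    rw [vecMul_tv_of_sform_eq_zero _ (sform_self _), comp_vec', map_one, map_zero]
  · rw [Ne, fix_shift_iff hg hθl, smul_vecMul, vecMul_tv_of_sform_eq_zero _ (sform_self _),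
      comp_smul, comp_vec', map_one, map_zero]
    intro h
    have := congrFun h (Sum.inl 0)
    simp only [Pi.smul_apply, vec_inl, if_true, smul_eq_mul, mul_one] at this
    exact hσl this.symm
  · refine ⟨⟨mem_listStab.mpr ⟨hSp _, by simpa using otv_fix θ _⟩, ?_⟩, ?_⟩
    · exact (otv_fix_shift_iff θ hθe0 hθe').mpr (sform_self _)
    · refine (otv_fix_shift_iff θ hθe0 hθl).mpr ?_
      rw [sform_smul_left, sform_self, mul_zero]
  · rw [Ne, otv_fix_shift_iff θ hθe0 hv]
    exact hve

end NotIBIS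

end DimensionTwo

/-! ### Dimension two: the IBIS groups -/

section DimensionTwoIBIS

variable {F : Type*} [Field F] [Algebra (ZMod 2) F] [Finite F] {t : ZMod 2} {f : ℕ}

theorem exists_shift_of_ne {θ θ' : Omega 1 F t} (h : θ ≠ θ') :
    ∃ c, c ≠ 0 ∧ tr (θ.1 c) = 0 ∧ θ' = shift θ c := by
  obtain ⟨c, hc, rfl⟩ := exists_eq_shift θ θ'
  refine ⟨c, ?_, hc, rfl⟩
  rintro rfl
  exact h (shift_zero θ).symm

theorem spHom_fix_pair {θ : Omega 1 F t} {c : V 1 F} (hc : c ≠ 0) (hct : tr (θ.1 c) = 0)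
    {x : symplecticGroup (Fin 1) F} (h : spHom 1 F t x θ = θ)
    (h' : spHom 1 F t x (shift θ c) = shift θ c) : x = 1 ∨ x = otv θ c :=
  eq_one_or_eq_otv hc h ((spHom_fix_shift_iff h hct).mp h')

theorem spHom_eq_one_of_fix {θ d : Omega 1 F t} {c : V 1 F} (hc : c ≠ 0) (hct : tr (θ.1 c) = 0)
    {x y : symplecticGroup (Fin 1) F} (hx : spHom 1 F t x θ = θ)
    (hx' : spHom 1 F t x (shift θ c) = shift θ c) (hxd : spHom 1 F t x d ≠ d)
    (hy : spHom 1 F t y θ = θ) (hy' : spHom 1 F t y (shift θ c) = shift θ c)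
    (hyd : spHom 1 F t y d = d) : spHom 1 F t y = 1 := by
  rcases spHom_fix_pair hc hct hy hy' with rfl | rfl
  · exact map_one _
  · rcases spHom_fix_pair hc hct hx hx' with rfl | rfl
    · exact absurd (by rw [map_one]; rfl) hxd
    · exact absurd hyd hxd

theorem isIBIS_spPerms_minus (hF : Nat.card F = 2 ^ f) (hf : 2 ≤ f) : IsIBIS (spPerms 1 F 1) := by
  refine isIBIS_of_forall_pair (two_le_card_omega hF hf 1) (fun θ θ' hne => ?_) ?_
  · obtain ⟨c, hc, hct, rfl⟩ := exists_shift_of_ne hne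
    have h0 := omega_ne_zero θ hc
    exact ⟨_, ⟨otv θ c, rfl⟩, otv_fix θ c, (otv_fix_shift_iff θ h0 hct).mpr (sform_self c),
      spHom_otv_ne_one hF hf h0⟩
  · rintro θ θ' hne d _ ⟨x, rfl⟩ hx hx' hxd _ ⟨y, rfl⟩ hy hy' hyd
    obtain ⟨c, hc, hct, rfl⟩ := exists_shift_of_ne hne
    exact spHom_eq_one_of_fix hc hct hx hx' hxd hy hy' hyd

theorem eq_one_of_tr_eq_zero (hF : Nat.card F = 2 ^ 2) {z : F} (h0 : z ≠ 0) (hz : tr z = 0) :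
    z = 1 := by
  by_contra h1
  have h : tr (1 : F) = 0 := by
    rw [tr_one hF]
    decide
  obtain ⟨y, hy⟩ := exists_tr_mul (1 : F) one_ne_zero
  rw [mul_one] at hy
  rcases (eq_of_card_four hF h0 h1).2 y with rfl | rfl | rfl | rfl
  · rw [tr_zero] at hy
    exact zero_ne_one hy
  · exact zero_ne_one (h.symm.trans hy)
  · exact zero_ne_one (hz.symm.trans hy)
  · rw [tr_add, hz, h] at hy
    exact absurd hy (by decide)

/-- For q = 4 the only nonzero element of trace zero is 1, so θ(c) = θ(c') = 1 for any two further
points. Then φ(c', c) is neither 0 nor 1, so it generates the field, and an element fixing all three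
points is linear and trivial. -/
theorem isIBIS_gammaSpPerms_minus (hF : Nat.card F = 2 ^ 2) : IsIBIS (gammaSpPerms 1 F 1) := by
  refine isIBIS_of_forall_pair (two_le_card_omega hF le_rfl 1) (fun θ θ' hne => ?_) ?_
  · obtain ⟨c, hc, hct, rfl⟩ := exists_shift_of_ne hne
    have h0 := omega_ne_zero θ hc
    exact ⟨_, spHom_mem_gammaSpPerms (otv θ c), otv_fix θ c,
      (otv_fix_shift_iff θ h0 hct).mpr (sform_self c), spHom_otv_ne_one hF le_rfl h0⟩
  · intro θ θ' hne d h hh h1 h2 hd g hg h3 h4 h5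
    obtain ⟨c, hc, hct, rfl⟩ := exists_shift_of_ne hne
    obtain ⟨c', hc', hct', rfl⟩ := exists_shift_of_ne (θ := θ) (θ' := d) (by
      rintro rfl
      exact hd h1)
    have hcc : c' ≠ c := by
      rintro rfl
      exact hd h2
    obtain ⟨x, σ, rfl⟩ := exists_eq_of_mem_gammaSpPerms hg
    have hθc := eq_one_of_tr_eq_zero hF (omega_ne_zero θ hc) hct
    have hθc' := eq_one_of_tr_eq_zero hF (omega_ne_zero θ hc') hct'
    have hx := (fix_shift_iff h3 hct).mp h4
    have hx' := (fix_shift_iff h3 hct').mp h5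
    have hφ0 : sform c' c ≠ 0 := by
      intro h0
      obtain ⟨u, hu⟩ := exists_sform_ne_zero hc
      have e := eq_smul_add_smul hu c'
      rw [h0, zero_div, zero_smul, add_zero] at e
      generalize sform c' u / sform u c = l at e
      rw [e, omega_smul, hθc, mul_one] at hθc'
      rw [sq_injective (hθc'.trans (one_pow 2).symm), one_smul] at e
      exact hcc e
    have hφ1 : sform c' c ≠ 1 := by
      intro h1
      obtain ⟨z, hz0, hz1⟩ := exists_ne_zero_ne_one hF le_rfl
      -- If φ(c', c) were 1, this vector would have value 1 + z + z² = 0, against anisotropy.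
      refine omega_ne_zero θ (c := c' + z • c) (fun h => ?_) ?_
      · have := sform_zero_left c
        rw [← h, sform_add_left, sform_smul_left, sform_self, h1, mul_zero, add_zero] at this
        exact one_ne_zero this
      · rw [omega_add, omega_smul, sform_smul_right, hθc, hθc', h1]
        linear_combination (eq_of_card_four hF hz0 hz1).1
    have hσ := eq_one_of_card_four hF hφ0 hφ1 (sform_fix hx' hx)
    subst hσ
    have : x = 1 := eq_of_vecMul_eq hφ0 (by rw [vecMul_one_val, hx]; rfl)
      (by rw [vecMul_one_val, hx']; rfl)
    rw [this, map_one, map_one, one_mul]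

theorem autHom_injective : Function.Injective (autHom 1 F 0) := by
  refine (injective_iff_map_eq_one _).mpr fun σ h => ?_
  obtain ⟨η, -, hη⟩ := exists_generator F
  have h1 := (autHom_fix_shift_iff (autHom_hyp σ) (c := vec 0 η 0)
    (by rw [hyp_apply, mul_zero, tr_zero])).mp (by rw [h]; rfl)
  rw [comp_vec', map_zero] at h1
  refine hη σ ?_
  have := congrFun h1 (Sum.inl 0)
  simpa [vec_inl] using this

/-- A pair of forms of plus type whose difference is singular is equivalent to a standard one. -/
theorem exists_spHom_eq_hyp {θ : Omega 1 F 0} {c : V 1 F} (hc : c ≠ 0) (hθc : θ.1 c = 0) :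
    ∃ p, spHom 1 F 0 p θ = hyp F ∧ spHom 1 F 0 p (shift θ c) = shift (hyp F) (vec 0 1 0) := by
  obtain ⟨u, hu⟩ := exists_sform_ne_zero hc
  obtain ⟨c', hcc, hθc'⟩ : ∃ c', sform c' c = 1 ∧ θ.1 c' = 0 := by
    obtain ⟨w, hwc⟩ : ∃ w, sform w c = 1 :=
      ⟨(sform u c)⁻¹ • u, by rw [sform_smul_left, inv_mul_cancel₀ hu]⟩
    refine ⟨w + θ.1 w • c, ?_, ?_⟩
    · rw [sform_add_left, sform_smul_left, sform_self, mul_zero, add_zero, hwc]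
    · rw [omega_add, omega_smul, sform_smul_right, hθc, hwc, mul_zero, add_zero, mul_one, add_self]
  have hcc' : sform c c' = 1 := by rw [sform_comm, hcc]
  let L : V 1 F →ₗ[F] V 1 F := (LinearMap.proj (Sum.inl 0)).smulRight c +
    (LinearMap.proj (Sum.inr 0)).smulRight c'
  have hL : ∀ u, L u = u (Sum.inl 0) • c + u (Sum.inr 0) • c' := fun u => rfl
  have hLs : ∀ u v, sform (L u) (L v) = sform u v := fun u v => by
    simp only [hL, sform_add_left, sform_add_right, sform_smul_left, sform_smul_right, sform_self,
      hcc, hcc', sform_one u v]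
    linear_combination u (Sum.inl 0) * v (Sum.inr 0) * add_self (1 : F)
  have h1 : spHom 1 F 0 (mkSp L hLs) θ = hyp F := omega_ext fun u => by
    rw [spHom_apply_apply, vecMul_mkSp, hL, omega_add, omega_smul, omega_smul, sform_smul_left,
      sform_smul_right, hcc', hθc, hθc', eq_vec_zero u, hyp_apply, vec_inl, vec_inr, if_pos rfl,
      if_pos rfl]
    ring
  refine ⟨mkSp L hLs, h1, omega_ext fun u => ?_⟩
  have hLe : L (vec 0 1 0) = c := by
    rw [hL, vec_inl, vec_inr, if_pos rfl, if_pos rfl, one_smul, zero_smul, add_zero]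
  rw [spHom_apply_apply, shift_apply (by rw [hθc, tr_zero]),
    shift_apply (by rw [hyp_vec_one_zero, tr_zero]), ← spHom_apply_apply, h1, vecMul_mkSp]
  conv_lhs => rw [← hLe, hLs]

theorem isIBIS_gammaSpPerms_of_prime (hF : Nat.card F = 2 ^ f) (hf : f.Prime) (hodd : Odd f) :
    IsIBIS (gammaSpPerms 1 F t) := by
  have hf2 := hf.two_le
  have := Fact.mk hf
  -- A nontrivial σ would fix θ(c), so θ(c) = 1, but Tr 1 = 1 as f is odd. The stabilizer of such a
  -- pair is therefore linear, of order two.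
  have key : ∀ {θ : Omega 1 F t} {c : V 1 F}, tr (θ.1 c) = 0 → θ.1 c ≠ 0 →
      ∀ g ∈ gammaSpPerms 1 F t, g θ = θ → g (shift θ c) = shift θ c → ∃ x, g = spHom 1 F t x := by
    intro θ c hct h0 g hg h1 h2
    obtain ⟨x, σ, rfl⟩ := exists_eq_of_mem_gammaSpPerms hg
    by_cases hσ : σ = 1
    · exact ⟨x, by rw [hσ, map_one, mul_one]⟩
    · have := apply_vecMul_of_fix h1 ((fix_shift_iff h1 hct).mp h2)
      rw [(eq_zero_or_one_of_prime hF hf hσ this).resolve_left h0, tr_one hF,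
        ZMod.natCast_eq_one_iff_odd.mpr hodd] at hct
      exact absurd hct one_ne_zero
  have hsing : ∀ {θ : Omega 1 F t} {c : V 1 F}, c ≠ 0 → θ.1 c = 0 → t = 0 := by
    intro θ c hc h
    have h2 : ∀ t : ZMod 2, t = 0 ∨ t = 1 := by decide
    rcases h2 t with rfl | rfl
    · rfl
    · exact absurd h (omega_ne_zero θ hc)
  -- If c is singular, the pair is equivalent to `hyp` and its translate by (1, 0). The pair
  -- stabilizer is then conjugate to the group of field automorphisms, which has prime order f.
  have hplus : ∀ {θ : Omega 1 F 0} {c : V 1 F}, c ≠ 0 → θ.1 c = 0 → ∃ A ∈ gammaSpPerms 1 F 0,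
      (∀ σ, (A⁻¹ * autHom 1 F 0 σ * A) θ = θ ∧
        (A⁻¹ * autHom 1 F 0 σ * A) (shift θ c) = shift θ c) ∧
      ∀ g ∈ gammaSpPerms 1 F 0, g θ = θ → g (shift θ c) = shift θ c →
        ∃ σ, g = A⁻¹ * autHom 1 F 0 σ * A := by
    intro θ c hc h
    obtain ⟨p, hp, hp'⟩ := exists_spHom_eq_hyp hc h
    refine ⟨spHom 1 F 0 p, spHom_mem_gammaSpPerms p, fun σ => ⟨?_, ?_⟩, fun g hg h1 h2 => ?_⟩
    · rw [Equiv.Perm.mul_apply, Equiv.Perm.mul_apply, hp, autHom_hyp, Equiv.Perm.inv_eq_iff_eq, hp]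
    · rw [Equiv.Perm.mul_apply, Equiv.Perm.mul_apply, hp', (autHom_fix_shift_iff (autHom_hyp σ)
        (by rw [hyp_vec_one_zero, tr_zero])).mpr (by rw [comp_vec', map_one, map_zero]),
        Equiv.Perm.inv_eq_iff_eq, hp']
    · obtain ⟨x, σ, e⟩ := exists_eq_of_mem_gammaSpPerms (mul_mem (mul_mem
        (spHom_mem_gammaSpPerms p) hg) (inv_mem (spHom_mem_gammaSpPerms p)))
      have hx : x = 1 := by
        refine eq_one_of_fix_hyp_semilinear (σ := σ) ?_ ?_
        · rw [← e, Equiv.Perm.mul_apply, Equiv.Perm.mul_apply,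
            Equiv.Perm.inv_eq_iff_eq.mpr hp.symm, h1, hp]
        · rw [← e, Equiv.Perm.mul_apply, Equiv.Perm.mul_apply,
            Equiv.Perm.inv_eq_iff_eq.mpr hp'.symm, h2, hp']
      rw [hx, map_one, one_mul] at e
      exact ⟨σ, by rw [← e]; group⟩
  refine isIBIS_of_forall_pair (two_le_card_omega hF hf2 t) (fun θ θ' hne => ?_) ?_
  · obtain ⟨c, hc, hct, rfl⟩ := exists_shift_of_ne hne
    by_cases h0 : θ.1 c = 0
    · obtain rfl := hsing hc h0
      obtain ⟨A, hA, hfix, -⟩ := hplus hc h0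
      have : Nontrivial (F ≃ₐ[ZMod 2] F) := by
        rw [← Finite.one_lt_card_iff_nontrivial, card_algEquiv hF]
        exact hf.one_lt
      obtain ⟨σ, hσ⟩ := exists_ne (1 : F ≃ₐ[ZMod 2] F)
      refine ⟨_, mul_mem (mul_mem (inv_mem hA) (autHom_mem_gammaSpPerms σ)) hA, (hfix σ).1,
        (hfix σ).2, fun h => hσ (autHom_injective ?_)⟩
      rw [map_one]
      have e : autHom 1 F 0 σ = A * (A⁻¹ * autHom 1 F 0 σ * A) * A⁻¹ := by group
      rw [e, h, mul_one, mul_inv_cancel]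
    · exact ⟨_, spHom_mem_gammaSpPerms (otv θ c), otv_fix θ c,
        (otv_fix_shift_iff θ h0 hct).mpr (sform_self c), spHom_otv_ne_one hF hf2 h0⟩
  · intro θ θ' hne d h hh h1 h2 hd g hg h3 h4 h5
    obtain ⟨c, hc, hct, rfl⟩ := exists_shift_of_ne hne
    by_cases h0 : θ.1 c = 0
    · obtain rfl := hsing hc h0
      obtain ⟨A, hA, -, hex⟩ := hplus hc h0
      obtain ⟨σ, rfl⟩ := hex g hg h3 h4
      obtain ⟨τ, rfl⟩ := hex h hh h1 h2
      by_cases hσ : σ = 1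
      · rw [hσ, map_one, mul_one, inv_mul_cancel]
      · exfalso
        rw [Equiv.Perm.mul_apply, Equiv.Perm.mul_apply, Equiv.Perm.inv_eq_iff_eq] at h5
        rw [Equiv.Perm.mul_apply, Equiv.Perm.mul_apply, Ne, Equiv.Perm.inv_eq_iff_eq] at hd
        have hle : Subgroup.zpowers σ ≤ MulAction.stabilizer (F ≃ₐ[ZMod 2] F) (A d) :=
          (Subgroup.zpowers_le).mpr h5
        exact hd (hle (mem_zpowers_of_prime_card (card_algEquiv hF) hσ))
    · obtain ⟨x, rfl⟩ := key hct h0 g hg h3 h4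
      obtain ⟨y, rfl⟩ := key hct h0 h hh h1 h2
      exact spHom_eq_one_of_fix hc hct h1 h2 hd h3 h4 h5

theorem isIBIS_one_iff (hF : Nat.card F = 2 ^ f) (hf : 2 ≤ f)
    {G : Subgroup (Equiv.Perm (Omega 1 F t))} (hSp : ∀ x, spHom 1 F t x ∈ G)
    (hGamma : G ≤ gammaSpPerms 1 F t) :
    IsIBIS G ↔ (t = 1 ∧ G = spPerms 1 F t) ∨ (t = 1 ∧ f = 2 ∧ G = gammaSpPerms 1 F t) ∨
      (f.Prime ∧ Odd f ∧ G = gammaSpPerms 1 F t) := by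
  have h01 : ∀ t : ZMod 2, t = 0 ∨ t = 1 := by decide
  replace h01 := h01 t
  constructor
  · intro hI
    -- As G contains Sp_2, it is the product of Sp_2 and K. The cases are K trivial, K with a
    -- nontrivial element fixing some nonzero d of trace zero, and neither.
    set K : Subgroup (F ≃ₐ[ZMod 2] F) := G.comap (autHom 1 F t) with hKdef
    have hGtop : K = ⊤ → G = gammaSpPerms 1 F t := fun hK => le_antisymm hGamma fun g hg => by
      obtain ⟨x, σ, rfl⟩ := exists_eq_of_mem_gammaSpPerms hg
      exact mul_mem (hSp x) (show σ ∈ K from hK ▸ Subgroup.mem_top σ)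
    by_cases hK : ∃ σ ∈ K, σ ≠ 1
    · by_cases hd : ∀ σ ∈ K, σ ≠ 1 → ∀ d, σ d = d → tr d = 0 → d = 0
      · obtain ⟨h1, h2, h3⟩ := prime_of_forall_fixed hF hK hd
        exact Or.inr (Or.inr ⟨h1, h2, hGtop h3⟩)
      · push Not at hd
        obtain ⟨σ, hσK, hσ, d, hσd, hdt, hd0⟩ := hd
        rcases h01 with rfl | rfl
        · exact absurd hI (not_isIBIS_hyp_of_fixed hF hf hSp hGamma hσ hσK hd0 hσd hdt)
        · by_cases hf3 : 3 ≤ f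
          · exact absurd hI (not_isIBIS_minus_of_fixed hF hf3 hSp hGamma hσ hσK hd0 hσd hdt)
          · obtain rfl : f = 2 := by omega
            refine Or.inr (Or.inl ⟨rfl, rfl, hGtop ?_⟩)
            have := Fact.mk Nat.prime_two
            rw [eq_top_iff]
            intro τ _
            exact (Subgroup.zpowers_le).mpr hσK (mem_zpowers_of_prime_card (card_algEquiv hF) hσ)
    · push Not at hK
      rcases h01 with rfl | rfl
      · exact absurd hI (not_isIBIS_hyp_of_trivial hF hf hSp hGamma fun σ hσ => hK σ hσ)
      · refine Or.inl ⟨rfl, le_antisymm (fun g hg => ?_) ?_⟩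
        · obtain ⟨x, σ, rfl⟩ := exists_eq_of_mem_gammaSpPerms (hGamma hg)
          rw [hK σ ((mul_mem_cancel_left (hSp x)).mp hg), map_one, mul_one]
          exact ⟨x, rfl⟩
        · rintro _ ⟨x, rfl⟩
          exact hSp x
  · rintro (⟨rfl, rfl⟩ | ⟨rfl, rfl, rfl⟩ | ⟨h1, h2, rfl⟩)
    · exact isIBIS_spPerms_minus hF hf
    · exact isIBIS_gammaSpPerms_minus hF
    · exact isIBIS_gammaSpPerms_of_prime hF h1 h2

end DimensionTwoIBIS

/-! ### Small degenerate cases -/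

section Main

variable {m : ℕ} {F : Type*} [Field F] [Algebra (ZMod 2) F] [Finite F] {t : ZMod 2} {f : ℕ}

theorem exists_injective_vec (m : ℕ) (F : Type*) [Field F] [Algebra (ZMod 2) F] [Finite F]
    (t : ZMod 2) :
    ∃ a : Omega m F t → V m F, Function.Injective a ∧ ∀ θ, tr (theta0 (a θ)) = t := by
  choose a ha h using fun θ : Omega m F t => exists_eq_thetaPt θ
  exact ⟨a, fun θ θ' e => by rw [h θ, h θ', thetaPt_eq _ _ e], ha⟩

theorem card_omega_zero_le : Nat.card (Omega 0 F t) ≤ 3 := by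
  obtain ⟨a, ha, -⟩ := exists_injective_vec 0 F t
  have := Nat.card_le_card_of_injective a ha
  rw [Nat.card_unique (α := V 0 F)] at this
  omega

/-- Both types occur among the labels, so at most three of the four vectors label points of Ω. -/
theorem card_omega_two_le (hF : Nat.card F = 2 ^ 1) : Nat.card (Omega 1 F t) ≤ 3 := by
  classical
  obtain ⟨a, ha, hat⟩ := exists_injective_vec 1 F t
  obtain ⟨b, hb⟩ : ∃ b : V 1 F, tr (theta0 b) ≠ t := by
    by_contra! h
    have h0 := h (vec 0 0 0)
    have h1 := h (vec 0 1 1)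
    rw [theta0_vec, mul_zero, tr_zero] at h0
    rw [theta0_vec, mul_one, tr_one hF, ← h0, Nat.cast_one] at h1
    exact one_ne_zero h1
  have := Fintype.ofFinite F
  have := Fintype.ofFinite (Omega 1 F t)
  have h := Fintype.card_lt_of_injective_of_notMem a ha (b := b) (by
    rintro ⟨θ, rfl⟩
    exact hb (hat θ))
  rw [← Nat.card_eq_fintype_card, ← Nat.card_eq_fintype_card, Nat.card_fun, hF, Nat.card_sum,
    Nat.card_unique (α := Fin 1)] at h
  omega

/-- The derived subgroup acts by even permutations. -/
theorem commute_of_card_le_three (h : Nat.card (Omega m F t) ≤ 3) {a b : Equiv.Perm (Omega m F t)}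
    (ha : a ∈ spDerivedPerms m F t) (hb : b ∈ spDerivedPerms m F t) : a * b = b * a := by
  classical
  have := Fintype.ofFinite (Omega m F t)
  have key : ∀ a ∈ spDerivedPerms m F t, a ∈ alternatingGroup (Omega m F t) := by
    rintro _ ⟨x, hx, rfl⟩
    exact MonoidHom.mem_ker.mp
      (Abelianization.commutator_subset_ker (Equiv.Perm.sign.comp (spHom m F t)) hx)
  have := alternatingGroup.isMulCommutative_of_card_le_three h
  exact congrArg Subtype.val
    (mul_comm' (⟨a, key a ha⟩ : alternatingGroup (Omega m F t)) ⟨b, key b hb⟩)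

end Main

end IBIS

end

open IBIS in
theorem proposition4p4 {F : Type*} [Field F] [Finite F] [Algebra (ZMod 2) F]
    (m f : ℕ) (hF : Nat.card F = 2 ^ f) (t : ZMod 2)
    (G : Subgroup (Equiv.Perm (Omega m F t)))
    (hG : IsAlmostSimpleWithSocle G (spDerivedPerms m F t))
    (hGamma : G ≤ gammaSpPerms m F t) :
    IsIBIS G ↔
      (m = 1 ∧ t = 1 ∧ 3 ≤ f ∧ G = spPerms m F t) ∨
      (m = 1 ∧ t = 1 ∧ f = 2 ∧ (G = spPerms m F t ∨ G = gammaSpPerms m F t)) ∨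
      (m = 1 ∧ f.Prime ∧ Odd f ∧ G = gammaSpPerms m F t) ∨
      (m = 2 ∧ f = 1) := by
  -- On at most three points the even permutations commute, so the socle would be abelian.
  have hcard : ¬ Nat.card (Omega m F t) ≤ 3 := fun h => by
    obtain ⟨a, ha, b, hb, hab⟩ := hG.nonabelian
    exact hab (commute_of_card_le_three h ha hb)
  have hm : m ≠ 0 := by
    rintro rfl
    exact hcard card_omega_zero_le
  have hf : f ≠ 0 := by
    rintro rfl
    have : 1 < Nat.card F := Finite.one_lt_card
    omega
  have hcomm : ∀ x ∈ commutator (Matrix.symplecticGroup (Fin m) F), spHom m F t x ∈ G :=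
    fun x hx => hG.le ⟨x, hx, rfl⟩
  by_cases hf1 : f = 1
  · subst hf1
    obtain rfl | rfl | hm3 : m = 1 ∨ m = 2 ∨ 3 ≤ m := by omega
    · exact absurd (card_omega_two_le hF) hcard
    · exact iff_of_true (isIBIS_four_two hF t G hG.le hGamma)
        (Or.inr (Or.inr (Or.inr ⟨rfl, rfl⟩)))
    · refine iff_of_false (not_isIBIS_of_three_le hm3 hF G (fun v b =>
        hcomm _ (tv_mem_commutator_of_three_le hm3 (eq_zero_or_one hF) v b)) hGamma) ?_
      omega
  · have hf2 : 2 ≤ f := by omega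
    obtain ⟨c, hc0, hc1⟩ := exists_ne_zero_ne_one hF hf2
    have htv := fun v b => tv_mem_commutator_of_ne (m := m) hc0 hc1 v b
    by_cases hm1 : m = 1
    · subst hm1
      have hle : tvGroup 1 F ≤ commutator (Matrix.symplecticGroup (Fin 1) F) := by
        rw [tvGroup, Subgroup.closure_le]
        rintro _ ⟨v, b, rfl⟩
        exact htv v b
      rw [isIBIS_one_iff hF hf2 (fun x => hcomm x (hle (mem_tvGroup x))) hGamma]
      constructor
      · rintro (⟨ht, h⟩ | ⟨ht, h2, h⟩ | ⟨h1, h2, h⟩)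
        · by_cases h3 : 3 ≤ f
          · exact Or.inl ⟨rfl, ht, h3, h⟩
          · exact Or.inr (Or.inl ⟨rfl, ht, by omega, Or.inl h⟩)
        · exact Or.inr (Or.inl ⟨rfl, ht, h2, Or.inr h⟩)
        · exact Or.inr (Or.inr (Or.inl ⟨rfl, h1, h2, h⟩))
      · rintro (⟨-, ht, -, h⟩ | ⟨-, ht, h2, h | h⟩ | ⟨-, h1, h2, h⟩ | ⟨h, -⟩)
        · exact Or.inl ⟨ht, h⟩
        · exact Or.inl ⟨ht, h⟩
        · exact Or.inr (Or.inl ⟨ht, h2, h⟩)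
        · exact Or.inr (Or.inr ⟨h1, h2, h⟩)
        · exact absurd h (by decide)
    · refine iff_of_false (not_isIBIS_of_two_le (by omega) hF hf2 G (fun v b => hcomm _ (htv v b))
        hGamma) ?_
      omega
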